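/- Let $X$ be a closed Riemann surface and let $A\in\mathfrak{sl}_2(\Omega^1(X))$ be a traceless $2\times2$ matrix of holomorphic 1-forms on $X$. **Tangent vectors.** Let $Z(X,A)$ be the set of pairs $(\mu,\dot A)$, where $\mu$ is a smooth Beltrami differential on $X$ and $\dot A$ is a smooth closed $\mathfrak{sl}_2(\mathbb C)$-valued 1-form with $\dot A^{0,1}=\mu A$. Put $(\mu,\dot A)\sim(\nu,\dot B)$ if $\int_X\mu\varphi=\int_X\nu\varphi$ for every holomorphic quadratic differential $\varphi\in \mathrm{QD}(X)$ and there is a smooth $T:X\to\mathfrak{sl}_2(\mathbb C)$ with $\dot A^{1,0}-\dot B^{1,0}-\partial T\in[A,\mathfrak{sl}_2(\mathbb C)]$. The quotient $Z(X,A)/\!\sim$ is the tangent space $T_{(X,A)}\mathcal S$ of the space $\mathcal S$ of $\mathfrak{sl}_2$-systems. **Monodromy.** The flat connection $d+A$ on $X\times\mathbb C^2$ has a monodromy representation $\rho:\pi_1(X,x_0)\to\mathrm{SL}_2(\mathbb C)$ (parallel transport along loops), and $\mathrm{RH}(X,A)=[\rho]$ in the character variety $\mathcal R$. The tangent space of $\mathcal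 R$ at $\rho$ is $H^1(\pi_1(X,x_0),\mathrm{Ad}_\rho)$, a curve $\rho_t$ having velocity $[\gamma\mapsto\dot\rho(\gamma)\rho(\gamma)^{-1}]$. For $v=[(\mu,\dot A)]$, $d(\mathrm{RH})(v)$ is the class of the cocycle $\gamma\mapsto\dot\rho(\gamma)\rho(\gamma)^{-1}$, where $\dot\rho(\gamma)$ is the derivative at $t=0$ of the parallel transport of $d+B_t$ along a $C^1$ loop representing $\gamma$, for any smooth family $B_t$ of $\mathfrak{sl}_2(\mathbb{C})$-valued 1-forms with $B_0=A$ and $\frac{d}{dt}B_t|_{t=0}=\dot A$. **Goldman form.** Let $\mathcal E$ be the local system of flat sections of $d+A$ and let $\iota:H^1(X,\mathfrak{sl}(\mathcal E))\to H^1(\pi_1(X,x_0),\mathrm{Ad}_\rho)$ be the de Rham isomorphism from the cohomology of $d_A=d+\mathrm{ad}(A)$. For $d_A$-closed forms $\chi_1,\chi_2$, the Goldman form is $\xi(\iota[\chi_1],\iota[\chi_2])=\int_X\mathrm{tr}(\chi_1\wedge\chi_2)$. **Proposition.** Let $v=[(\mu,\dot A_1)]$ and $w=[(0,\dot A_2)]$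 be tangent vectors to $\mathcal S$ at $(X,A)$. Then the monodromy $\rho$ and derivatives $d(\mathrm{RH})(v)$, $d(\mathrm{RH})(w)$ exist, and $$(\mathrm{RH}^*\xi)(v,w)=\xi\big(d(\mathrm{RH})(v),d(\mathrm{RH})(w)\big)=-\big\langle\mu,\,d(\mathbf{det})(\dot A_2)\big\rangle .$$ Here $d(\mathbf{det})(\dot A_2)=\frac{d}{dt}\big|_{t=0}\det(A+t\dot A_2)$ is the derivative at $A$ of the map $\mathbf{det}:\mathfrak{sl}_2(\Omega^1(X))\to\mathrm{QD}(X)$, and $\langle\mu,\varphi\rangle=\int_X\mu\varphi$, where $\mu\varphi$ is the 2-form given in a local coordinate $z$ by $\mu(z)\varphi(z)\,d\bar z\wedge dz$ and $X$ carries its complex orientation. -/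

import Mathlib

open scoped Manifold ContDiff ComplexConjugate

noncomputable section

namespace SlSystem

/-- `2 × 2` complex matrices. -/
abbrev Mat2 := Matrix (Fin 2) (Fin 2) ℂ

/-- The Lie algebra of traceless `2 × 2` complex matrices. -/
abbrev Sl2 := LieAlgebra.SpecialLinear.sl (Fin 2) ℂ

/-! ### Wirtinger derivatives -/

/-- `∂f/∂z = (∂f/∂x - i ∂f/∂y) / 2`. -/
def dz (f : ℂ → ℂ) (z : ℂ) : ℂ :=
  (fderiv ℝ f z 1 - Complex.I * fderiv ℝ f z Complex.I) / 2

/-- `∂f/∂z̄ = (∂f/∂x + i ∂f/∂y) / 2`. -/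
def dzbar (f : ℂ → ℂ) (z : ℂ) : ℂ :=
  (fderiv ℝ f z 1 + Complex.I * fderiv ℝ f z Complex.I) / 2

section Tensors

variable {X : Type} [TopologicalSpace X] [ChartedSpace ℂ X]

/-! ### Tensors on a Riemann surface

A tensor of type `(p, q)` (a section of `K^p ⊗ K̄^q`) is encoded by a function `f` on `X`: the value
`f x` is its coefficient at `x` with respect to `du^p dū^q`, where `u = chartAt ℂ x` is the
preferred chart at `x`. Products of tensors are then pointwise products, the types add up, and
two tensors are equal exactly when the functions are. Functions, `(1,0)`-forms, `(0,1)`-forms,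
quadratic differentials and Beltrami differentials have the types `(0,0)`, `(1,0)`, `(0,1)`,
`(2,0)` and `(-1,1)`. -/

/-- The derivative `du/dz` at `z`, where `u` is the preferred chart at the point with `e`-coordinate
`z`, and `z` is the coordinate given by the chart `e`. -/
def transitionDeriv (e : OpenPartialHomeomorph X ℂ) (z : ℂ) : ℂ :=
  deriv (fun w => chartAt ℂ (e.symm z) (e.symm w)) z

/-- The coefficient with respect to `dz^p dz̄^q`, in the chart `e`, of the tensor of type `(p, q)`
encoded by `f`. -/
def inChart {V : Type*} [AddCommGroup V] [Module ℂ V] (p q : ℤ) (f : X → V)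
    (e : OpenPartialHomeomorph X ℂ) (z : ℂ) : V :=
  (transitionDeriv e z ^ p * conj (transitionDeriv e z) ^ q) • f (e.symm z)

/-- The scalar tensor of type `(p, q)` encoded by `f` is smooth. -/
def IsSmoothTensor (p q : ℤ) (f : X → ℂ) : Prop :=
  ∀ e ∈ atlas ℂ X, ContDiffOn ℝ ∞ (inChart p q f e) e.target

/-- The tensor of type `(k, 0)` encoded by `f` is holomorphic. -/
def IsHolomorphicTensor (k : ℤ) (f : X → ℂ) : Prop :=
  ∀ e ∈ atlas ℂ X, DifferentiableOn ℂ (inChart k 0 f e) e.target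

/-- Holomorphic quadratic differentials: elements of `QD(X)`. -/
def IsQuadraticDifferential (φ : X → ℂ) : Prop := IsHolomorphicTensor 2 φ

lemma IsHolomorphicTensor.isSmooth {k : ℤ} {f : X → ℂ} (h : IsHolomorphicTensor k f) :
    IsSmoothTensor k 0 f := fun e he =>
  ((h e he).contDiffOn e.open_target).restrict_scalars ℝ

/-! ### Integration of `(1,1)`-tensors -/

lemma exists_partition (X : Type) [TopologicalSpace X] [ChartedSpace ℂ X] [CompactSpace X]
    [T2Space X] : ∃ σ : PartitionOfUnity X X Set.univ,
      σ.IsSubordinate fun x => (chartAt ℂ x).source :=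
  PartitionOfUnity.exists_isSubordinate isClosed_univ _ (fun x => (chartAt ℂ x).open_source)
    (fun x _ => Set.mem_iUnion.2 ⟨x, mem_chart_source ℂ x⟩)

/-- The integral over the compact Riemann surface `X` of the 2-form given in every local coordinate
`z` by `f(z) dz̄ ∧ dz = 2i f(z) dx ∧ dy`, where `f` encodes a tensor of type `(1,1)`; it is
defined through a partition of unity subordinate to coordinate charts, and `X` carries the
orientation of its complex structure. -/
def surfaceIntegral [CompactSpace X] [T2Space X] (f : X → ℂ) : ℂ :=
  ∑ᶠ x : X, 2 * Complex.I * ∫ z in (chartAt ℂ x).target,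
    (((exists_partition X).choose x ((chartAt ℂ x).symm z) : ℝ) : ℂ) *
      inChart 1 1 f (chartAt ℂ x) z

/-- The pairing `⟨μ, φ⟩ = ∫_X μ φ` of a Beltrami differential `μ dz̄/dz` with a quadratic
differential `φ dz²`; the product is the 2-form `μ φ dz̄ ∧ dz`. -/
def beltramiPairing [CompactSpace X] [T2Space X] (μ φ : X → ℂ) : ℂ :=
  surfaceIntegral fun x => μ x * φ x

end Tensors

/-! ### `sl₂`-valued 1-forms -/

section Forms

variable (X : Type) [TopologicalSpace X] [ChartedSpace ℂ X]

/-- Smooth `sl₂(ℂ)`-valued 1-forms `part10 dz + part01 dz̄` on `X`. -/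
structure SlForm where
  part10 : X → Mat2
  part01 : X → Mat2
  trace10 : ∀ x, (part10 x).trace = 0
  trace01 : ∀ x, (part01 x).trace = 0
  smooth10 : ∀ i j, IsSmoothTensor 1 0 fun x => part10 x i j
  smooth01 : ∀ i j, IsSmoothTensor 0 1 fun x => part01 x i j

/-- `sl₂(Ω¹(X))`: traceless `2 × 2` matrices of holomorphic 1-forms on `X`. -/
structure HolSlForm where
  toFun : X → Mat2
  trace_eq : ∀ x, (toFun x).trace = 0
  holo : ∀ i j, IsHolomorphicTensor 1 fun x => toFun x i j

variable {X}

/-- A holomorphic `sl₂`-valued 1-form, seen as a smooth `sl₂`-valued 1-form of type `(1,0)`. -/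
def HolSlForm.toSlForm (A : HolSlForm X) : SlForm X where
  part10 := A.toFun
  part01 := 0
  trace10 := A.trace_eq
  trace01 := fun x => by simp
  smooth10 := fun i j => (A.holo i j).isSmooth
  smooth01 := fun i j e _ => by
    have h : inChart 0 1 (fun x : X => (0 : X → Mat2) x i j) e = fun _ => (0 : ℂ) := by
      funext z
      simp [inChart]
    rw [h]
    exact contDiffOn_const

/-- The coefficient of the exterior derivative: `dχ = (dCoeff χ e) dz ∧ dz̄` in the chart `e`. -/
def SlForm.dCoeff (χ : SlForm X) (e : OpenPartialHomeomorph X ℂ) (z : ℂ) : Mat2 :=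
  Matrix.of fun i j => dz (inChart 0 1 (fun x => χ.part01 x i j) e) z -
    dzbar (inChart 1 0 (fun x => χ.part10 x i j) e) z

/-- `dχ = 0`. -/
def SlForm.IsClosed (χ : SlForm X) : Prop :=
  ∀ e ∈ atlas ℂ X, ∀ z ∈ e.target, χ.dCoeff e z = 0

/-- `d_A χ = dχ + A ∧ χ + χ ∧ A = 0`, where `d_A = d + ad(A)`. Since `A` is of type `(1,0)`, the
wedge terms only see the `(0,1)`-part of `χ`. -/
def SlForm.IsCovClosed (A : HolSlForm X) (χ : SlForm X) : Prop :=
  ∀ e ∈ atlas ℂ X, ∀ z ∈ e.target, χ.dCoeff e z +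
    (inChart 1 0 A.toFun e z * inChart 0 1 χ.part01 e z -
      inChart 0 1 χ.part01 e z * inChart 1 0 A.toFun e z) = 0

/-- `∫_X tr(χ ∧ ψ)`; in a local coordinate `tr(χ ∧ ψ)` is
`tr(χ^{0,1} ψ^{1,0} - χ^{1,0} ψ^{0,1}) dz̄ ∧ dz`. -/
def traceWedgeIntegral [CompactSpace X] [T2Space X] (χ ψ : SlForm X) : ℂ :=
  surfaceIntegral fun x => (χ.part01 x * ψ.part10 x - χ.part10 x * ψ.part01 x).trace

/-! ### The determinant map -/

/-- `det(A) = -α² - βγ`, a quadratic differential, for `A` with rows `(α, β)` and `(γ, -α)`. -/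
def detForm (A : X → Mat2) : X → ℂ := fun x => (A x).det

/-- The derivative of `det` at `A` in the direction of `B`. -/
def dDet (A B : X → Mat2) : X → ℂ := fun x => deriv (fun t : ℂ => detForm (A + t • B) x) 0

/-! ### The tangent space of the space of `sl₂`-systems -/

/-- The space `Z(X, A)` of pairs `(μ, Ȧ)`, with `μ` a Beltrami differential and `Ȧ` a closed
`sl₂`-valued 1-form such that `Ȧ^{0,1} = μ A`. -/
structure Deformation (A : HolSlForm X) where
  mu : X → ℂ
  form : SlForm X
  mu_smooth : IsSmoothTensor (-1) 1 mu
  closed : form.IsClosed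
  compat : ∀ x, form.part01 x = mu x • A.toFun x

/-- The `(1,0)`-derivative `∂T/∂z` of a matrix-valued function in the chart `e`. -/
def delCoeff (T : X → Mat2) (e : OpenPartialHomeomorph X ℂ) (z : ℂ) : Mat2 :=
  Matrix.of fun i j => dz (inChart 0 0 (fun x => T x i j) e) z

/-- Equality of `Ȧ` and `Ḃ` up to the ambiguity of the tangent space:
`Ȧ^{1,0} - Ḃ^{1,0} - ∂T ∈ [A, sl₂(ℂ)]` for some function `T : X → sl₂(ℂ)`. -/
def Equiv10 (A : HolSlForm X) (χ ψ : SlForm X) : Prop :=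
  ∃ T : X → Mat2, (∀ x, (T x).trace = 0) ∧ (∀ i j, IsSmoothTensor 0 0 fun x => T x i j) ∧
    ∃ C : Mat2, C.trace = 0 ∧ ∀ e ∈ atlas ℂ X, ∀ z ∈ e.target,
      inChart 1 0 χ.part10 e z - inChart 1 0 ψ.part10 e z - delCoeff T e z =
        inChart 1 0 A.toFun e z * C - C * inChart 1 0 A.toFun e z

lemma dz_add {f g : ℂ → ℂ} {z : ℂ} (hf : DifferentiableAt ℝ f z) (hg : DifferentiableAt ℝ g z) :
    dz (f + g) z = dz f z + dz g z := by
  simp only [dz, fderiv_add hf hg, add_apply]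
  ring

lemma dz_neg {f : ℂ → ℂ} {z : ℂ} : dz (-f) z = -dz f z := by
  simp only [dz, fderiv_neg, neg_apply]
  ring

lemma Equiv10.refl (A : HolSlForm X) (χ : SlForm X) : Equiv10 A χ χ := by
  have h (e : OpenPartialHomeomorph X ℂ) (i j : Fin 2) :
      inChart 0 0 (fun x : X => (0 : X → Mat2) x i j) e = fun _ => (0 : ℂ) := by
    funext z
    simp [inChart]
  refine ⟨0, fun x => by simp, fun i j e _ => ?_, 0, by simp, fun e _ z _ => ?_⟩
  · rw [h]
    exact contDiffOn_const
  · ext i j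
    simp only [delCoeff, h]
    simp [dz]

lemma Equiv10.symm {A : HolSlForm X} {χ ψ : SlForm X} (h : Equiv10 A χ ψ) : Equiv10 A ψ χ := by
  obtain ⟨T, hT, hs, C, hC, h⟩ := h
  have hn (e : OpenPartialHomeomorph X ℂ) (i j : Fin 2) :
      inChart 0 0 (fun x : X => (-T) x i j) e = -inChart 0 0 (fun x => T x i j) e := by
    funext z
    simp [inChart]
  refine ⟨-T, fun x => by simp [hT x], fun i j e he => ?_, -C, by simp [hC],
    fun e he z hz => ?_⟩
  · rw [hn]
    exact (hs i j e he).neg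
  · have hd : delCoeff (-T) e z = -delCoeff T e z := by
      ext i j
      simp only [delCoeff, hn, Matrix.of_apply, Matrix.neg_apply, dz_neg]
    rw [hd, Matrix.mul_neg, Matrix.neg_mul, ← neg_sub', ← h e he z hz]
    abel

lemma Equiv10.trans {A : HolSlForm X} {χ ψ θ : SlForm X} (h : Equiv10 A χ ψ)
    (h' : Equiv10 A ψ θ) : Equiv10 A χ θ := by
  obtain ⟨T, hT, hs, C, hC, h⟩ := h
  obtain ⟨T', hT', hs', C', hC', h'⟩ := h'
  have hn (e : OpenPartialHomeomorph X ℂ) (i j : Fin 2) :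
      inChart 0 0 (fun x : X => (T + T') x i j) e =
        inChart 0 0 (fun x => T x i j) e + inChart 0 0 (fun x => T' x i j) e := by
    funext z
    simp [inChart]
  refine ⟨T + T', fun x => by simp [hT x, hT' x], fun i j e he => ?_, C + C', by simp [hC, hC'],
    fun e he z hz => ?_⟩
  · rw [hn]
    exact (hs i j e he).add (hs' i j e he)
  · have hdiff {f : X → ℂ} (hf : IsSmoothTensor 0 0 f) :
        DifferentiableAt ℝ (inChart 0 0 f e) z :=
      ((hf e he).differentiableOn (by simp)).differentiableAt (e.open_target.mem_nhds hz)
    have hd : delCoeff (T + T') e z = delCoeff T e z + delCoeff T' e z := by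
      ext i j
      simp only [delCoeff, hn, Matrix.of_apply, Matrix.add_apply]
      exact dz_add (hdiff (hs i j)) (hdiff (hs' i j))
    have := congrArg₂ (· + ·) (h e he z hz) (h' e he z hz)
    rw [hd, Matrix.mul_add, Matrix.add_mul, add_sub_add_comm, ← this]
    abel

/-- The equivalence relation on `Z(X, A)`: `(μ, Ȧ) ∼ (ν, Ḃ)` if `⟨μ, φ⟩ = ⟨ν, φ⟩` for every
`φ ∈ QD(X)`, and `Ȧ^{1,0} - Ḃ^{1,0} - ∂T ∈ [A, sl₂(ℂ)]` for some `T : X → sl₂(ℂ)`. -/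
instance deformationSetoid [CompactSpace X] [T2Space X] (A : HolSlForm X) :
    Setoid (Deformation A) where
  r v w := (∀ φ : X → ℂ, IsQuadraticDifferential φ →
      beltramiPairing v.mu φ = beltramiPairing w.mu φ) ∧ Equiv10 A v.form w.form
  iseqv :=
    { refl := fun v => ⟨fun _ _ => rfl, Equiv10.refl A v.form⟩
      symm := fun h => ⟨fun φ hφ => (h.1 φ hφ).symm, h.2.symm⟩
      trans := fun h h' => ⟨fun φ hφ => (h.1 φ hφ).trans (h'.1 φ hφ), h.2.trans h'.2⟩ }

/-- The tangent space at `(X, A)` to the space of `sl₂`-systems. -/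
def TangentS [CompactSpace X] [T2Space X] (A : HolSlForm X) : Type :=
  Quotient (deformationSetoid A)

/-- The tangent vector `[(μ, Ȧ)]`. -/
def TangentS.mk [CompactSpace X] [T2Space X] {A : HolSlForm X} (z : Deformation A) : TangentS A :=
  Quotient.mk (deformationSetoid A) z

/-! ### Parallel transport and monodromy -/

/-- The path is `C¹`, up to and including its end points. -/
def IsC1Path {x y : X} (p : Path x y) : Prop :=
  ContMDiffOn 𝓘(ℝ, ℝ) 𝓘(ℝ, ℂ) 1 p.extend (Set.Icc 0 1)

/-- The value `χ(p'(s))` of the form `χ` on the velocity of the path `p` at time `s`. -/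
def SlForm.alongPath (χ : SlForm X) {x y : X} (p : Path x y) (s : ℝ) : Mat2 :=
  let w : ℂ := derivWithin (fun u => chartAt ℂ (p.extend s) (p.extend u)) (Set.Icc 0 1) s
  w • χ.part10 (p.extend s) + conj w • χ.part01 (p.extend s)

/-- `F` is the parallel frame of the connection `d + B` along `p` starting at the identity:
`F' + B(p') F = 0` on `[0, 1]` and `F 0 = 1`. -/
def IsParallelFrame (B : SlForm X) {x y : X} (p : Path x y) (F : ℝ → Mat2) : Prop :=
  F 0 = 1 ∧ ∀ s ∈ Set.Icc (0 : ℝ) 1, ∀ i j,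
    HasDerivWithinAt (fun u => F u i j) ((-(B.alongPath p s * F s)) i j) (Set.Icc 0 1) s

/-- `H` is the parallel transport of the connection `d + B` along `p`. -/
def IsHolonomy (B : SlForm X) {x y : X} (p : Path x y) (H : Mat2) : Prop :=
  ∃ F : ℝ → Mat2, IsParallelFrame B p F ∧ F 1 = H

/-- The class of a loop in the fundamental group. In this group `[p] * [q]` is the class of the
loop that runs through `q` first, so that parallel transport is multiplicative. -/
def loopClass {x₀ : X} (p : Path x₀ x₀) : FundamentalGroup X x₀ :=
  FundamentalGroup.fromPath (Path.Homotopic.Quotient.mk p)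

/-- `ρ` is the monodromy representation of the flat connection `d + A`, that is, a
representative of `RH(X, A)`. -/
def IsMonodromy (A : HolSlForm X) {x₀ : X}
    (ρ : FundamentalGroup X x₀ →* Matrix.SpecialLinearGroup (Fin 2) ℂ) : Prop :=
  ∀ p : Path x₀ x₀, IsC1Path p → IsHolonomy A.toSlForm p (ρ (loopClass p) : Mat2)

/-! ### The tangent space `H¹(π₁, Ad ρ)` of the character variety -/

/-- The adjoint representation of `SL₂(ℂ)` on `sl₂(ℂ)`. -/
def adjointRep : Representation ℂ (Matrix.SpecialLinearGroup (Fin 2) ℂ) Sl2 where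
  toFun g :=
    { toFun := fun M => ⟨(g : Mat2) * M.1 * ((g⁻¹ : Matrix.SpecialLinearGroup (Fin 2) ℂ) : Mat2), by
        have hM : M.1.trace = 0 := M.2
        have hg : ((g⁻¹ : Matrix.SpecialLinearGroup (Fin 2) ℂ) : Mat2) * (g : Mat2) = 1 := by
          rw [← Matrix.SpecialLinearGroup.coe_mul]
          simp
        change Matrix.trace (_ : Mat2) = 0
        rw [Matrix.trace_mul_comm, ← Matrix.mul_assoc, hg, Matrix.one_mul, hM]⟩
      map_add' := fun M N => Subtype.ext (by simp [Matrix.mul_add, Matrix.add_mul])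
      map_smul' := fun c M => Subtype.ext (by simp) }
  map_one' := by
    ext M : 1
    exact Subtype.ext (by simp)
  map_mul' g h := by
    ext M : 1
    exact Subtype.ext (by
      simp only [mul_inv_rev, Matrix.SpecialLinearGroup.coe_mul, LinearMap.coe_mk, AddHom.coe_mk,
        Module.End.mul_apply, Matrix.mul_assoc])

/-- The `π₁`-module `Ad ρ`. -/
abbrev adRho {x₀ : X} (ρ : FundamentalGroup X x₀ →* Matrix.SpecialLinearGroup (Fin 2) ℂ) :
    Rep ℂ (FundamentalGroup X x₀) :=
  Rep.of (adjointRep.comp ρ)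

/-- The tangent space `H¹(π₁(X, x₀), Ad ρ)` of the character variety at `ρ`; a curve `ρ_t`
through `ρ` has as velocity the class of the cocycle `γ ↦ ρ̇(γ) ρ(γ)⁻¹`. -/
abbrev TangentR {x₀ : X} (ρ : FundamentalGroup X x₀ →* Matrix.SpecialLinearGroup (Fin 2) ℂ) :=
  groupCohomology.H1 (adRho ρ)

/-! ### The derivative of the Riemann-Hilbert map -/

/-- `B` is a smooth one-parameter family of forms with `B 0 = χ` and derivative `χ'` at time `0`. -/
def IsSmoothFamily (χ χ' : SlForm X) (B : ℝ → SlForm X) : Prop :=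
  B 0 = χ ∧
  (∀ e ∈ atlas ℂ X, ∀ i j,
    ContDiffOn ℝ ∞ (fun y : ℝ × ℂ => inChart 1 0 (fun x => (B y.1).part10 x i j) e y.2)
      (Set.univ ×ˢ e.target) ∧
    ContDiffOn ℝ ∞ (fun y : ℝ × ℂ => inChart 0 1 (fun x => (B y.1).part01 x i j) e y.2)
      (Set.univ ×ˢ e.target)) ∧
  ∀ x i j, HasDerivAt (fun t => (B t).part10 x i j) (χ'.part10 x i j) 0 ∧
    HasDerivAt (fun t => (B t).part01 x i j) (χ'.part01 x i j) 0

/-- The derivative at time `0` of the parallel transport along every `C¹` loop `p`, for every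
smooth family of connections `d + B_t` with `B_0 = A` and velocity `Ȧ`, is `c([p]) ρ([p])`. In
particular this holds for the families given by curves `(X_t, A_t)` of `sl₂`-systems with
velocity `(μ, Ȧ)` at `(X, A)`, where the forms `A_t` are regarded as forms on the fixed smooth
surface underlying `X`; there `c` is the cocycle `γ ↦ ρ̇(γ) ρ(γ)⁻¹` of the monodromies. -/
def IsVariationCocycle (A : HolSlForm X) {x₀ : X}
    (ρ : FundamentalGroup X x₀ →* Matrix.SpecialLinearGroup (Fin 2) ℂ) (z : Deformation A)
    (c : groupCohomology.cocycles₁ (adRho ρ)) : Prop :=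
  ∀ B : ℝ → SlForm X, IsSmoothFamily A.toSlForm z.form B →
    ∀ p : Path x₀ x₀, IsC1Path p →
      ∀ H : ℝ → Mat2, (∀ t, IsHolonomy (B t) p (H t)) →
        ∀ i j, HasDerivAt (fun t => H t i j)
          (((c.1 (loopClass p) : Sl2).1 * (ρ (loopClass p) : Mat2)) i j) 0

/-- `a = d(RH)(v)`: the class `a` is represented by the cocycle obtained by differentiating the
monodromy in the direction of a representative `(μ, Ȧ)` of `v`. -/
def IsDerivRH [CompactSpace X] [T2Space X] (A : HolSlForm X) {x₀ : X}
    (ρ : FundamentalGroup X x₀ →* Matrix.SpecialLinearGroup (Fin 2) ℂ)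
    (v : TangentS A) (a : TangentR ρ) : Prop :=
  ∃ z : Deformation A, TangentS.mk z = v ∧ ∃ c : groupCohomology.cocycles₁ (adRho ρ),
    IsVariationCocycle A ρ z c ∧ groupCohomology.H1π (adRho ρ) c = a

/-! ### The Goldman form -/

/-- `a = ι([χ])`: the form `χ` is `d_A`-closed, and `a` is the image of its cohomology class under
the de Rham isomorphism `ι : H¹(X, sl(ℰ)) → H¹(π₁, Ad ρ)`, where `ℰ` is the local system of flat
sections of `d + A`. The class `ι([χ])` is represented by the cocycle that sends `[p]` to the
integral of `χ` along `p`, with the values of `χ` carried to the end point of `p` by parallel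
transport. -/
def IsDeRhamClass (A : HolSlForm X) {x₀ : X}
    (ρ : FundamentalGroup X x₀ →* Matrix.SpecialLinearGroup (Fin 2) ℂ)
    (χ : SlForm X) (a : TangentR ρ) : Prop :=
  χ.IsCovClosed A ∧ ∃ c : groupCohomology.cocycles₁ (adRho ρ),
    groupCohomology.H1π (adRho ρ) c = a ∧
    ∀ p : Path x₀ x₀, IsC1Path p → ∀ F : ℝ → Mat2, IsParallelFrame A.toSlForm p F →
      ∀ i j, (c.1 (loopClass p) : Sl2).1 i j =
        ∫ s in (0 : ℝ)..1, (F 1 * (F s)⁻¹ * χ.alongPath p s * F s * (F 1)⁻¹) i j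

instance : Nonempty (SlForm X) := by
  have h (p q : ℤ) (e : OpenPartialHomeomorph X ℂ) (i j : Fin 2) :
      inChart p q (fun x : X => (0 : X → Mat2) x i j) e = fun _ => (0 : ℂ) := by
    funext z
    simp [inChart]
  exact ⟨⟨0, 0, fun x => by simp, fun x => by simp,
    fun i j e _ => by rw [h]; exact contDiffOn_const,
    fun i j e _ => by rw [h]; exact contDiffOn_const⟩⟩

/-- A `d_A`-closed form that represents the class `a` under the de Rham isomorphism. -/
def deRhamRep (A : HolSlForm X) {x₀ : X}
    (ρ : FundamentalGroup X x₀ →* Matrix.SpecialLinearGroup (Fin 2) ℂ) (a : TangentR ρ) :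
    SlForm X :=
  Classical.epsilon fun χ => IsDeRhamClass A ρ χ a

/-- The Goldman form `ξ(a, b) = ∫_X tr(χ_a ∧ χ_b)` on `H¹(π₁, Ad ρ) ≅ H¹(X, sl(ℰ))`. -/
def goldmanForm [CompactSpace X] [T2Space X] (A : HolSlForm X) {x₀ : X}
    (ρ : FundamentalGroup X x₀ →* Matrix.SpecialLinearGroup (Fin 2) ℂ) (a b : TangentR ρ) : ℂ :=
  traceWedgeIntegral (deRhamRep A ρ a) (deRhamRep A ρ b)

end Forms

end SlSystem

end

noncomputable section

namespace SlSystem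

open Set Filter Topology MeasureTheory

/-! ### Linear ordinary differential equations -/

section LinearODE

variable {V : Type*} [NormedAddCommGroup V] [NormedSpace ℝ V]

/-! Write Ȧ₁, Ȧ₂ for the forms of the two tangent vectors. Since Ȧ^{0,1} = μA commutes with A, a
closed form of this kind is also d_A-closed (`Deformation.isCovClosed`) and has a twisted cohomology
class. Differentiating the parallel transport equation shows that ρ̇ρ⁻¹ is minus the integral of Ȧ,
carried to the end point of the loop, so d(RH) sends [(μ, Ȧ)] to -ι[Ȧ]
(`IsMonodromy.isDeRhamClass_of_isVariationCocycle`). In the Goldman form the two signs cancel and ∫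
tr(Ȧ₁ ∧ Ȧ₂) remains. As μ₂ = 0, the form Ȧ₂ has type (1,0), so the integrand is μ tr(AȦ₂) dz̄ ∧ dz.
On traceless matrices det M = -½ tr M², whence d(det)(Ȧ₂) = -tr(AȦ₂), and this is the formula.

Three points make this rigorous.

Monodromy. A flat connection has local flat frames, and the quotient of two of them is locally
constant. The germs of flat sections therefore form a covering space, whose monodromy is parallel
transport depending only on the homotopy class (`IsFlatConnection.transport`). This is done with
values in any complete normed algebra, so that it also covers d + A + εχ with ε² = 0, which is flat
when χ is d_A-closed. The ε-part of its transport records the periods of χ, and multiplicativity of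
transport becomes the cocycle rule. Every path class contains a C¹ path, so conditions stated for C¹
loops determine homomorphisms and cocycles.

The Goldman form. It is evaluated on chosen representatives. If two d_A-closed forms have the same
class, the periods of their difference form a coboundary, so integration along paths gives a
single-valued T with d_A T equal to the difference. By Stokes, ∫ tr(d_A T ∧ ψ) = 0 for d_A-closed ψ
(`IsDeRhamClass.traceWedgeIntegral_eq`).

Tangent vectors. Suppose (μ, Ȧ) ∼ (ν, Ḃ), with T and C as in the relation. Closedness makes η = (μ -
ν)A - ∂̄T antiholomorphic. For each entry, ∫ |η|² is the pairing of μ - ν with a holomorphic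
quadratic differential minus the integral of ∂̄T against a holomorphic form. Both vanish, so η = 0
and Ȧ - Ḃ = dT + [A, C]. This is not claimed to be d_A-exact, but it pairs to zero with the form of
every tangent vector, by Stokes and tr([A, C]A) = 0 (`Deformation.traceWedgeIntegral_eq`). -/

theorem exists_hasDerivWithinAt_linear_short [CompleteSpace V] {L : ℝ → V →L[ℝ] V} {a b m : ℝ} (hab : a ≤ b)
    (hm : 0 ≤ m) (hL : ContinuousOn L (Icc a b)) (hb : ∀ s ∈ Icc a b, ‖L s‖ ≤ m)
    (hd : m * (b - a) ≤ 1 / 2) (y₀ : V) :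
    ∃ Y : ℝ → V, Y a = y₀ ∧ ∀ s ∈ Icc a b, HasDerivWithinAt Y (L s (Y s)) (Icc a b) s := by
  -- On the ball of radius ‖y₀‖ about y₀ one has ‖x‖ ≤ 2‖y₀‖, so the speed is at most 2m‖y₀‖. In
  -- time b - a with m(b - a) ≤ 1/2 the solution cannot leave this ball.
  have hP : IsPicardLindelof (fun t x => L t x) (⟨a, left_mem_Icc.2 hab⟩ : Icc a b) y₀
      ‖y₀‖₊ 0 (⟨m, hm⟩ * (2 * ‖y₀‖₊)) ⟨m, hm⟩ := by
    refine ⟨fun t ht => ?_, fun x _ => hL.clm_apply continuousOn_const, fun t ht x hx => ?_, ?_⟩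
    · exact ((L t).lipschitz.weaken (by exact_mod_cast hb t ht)).lipschitzOnWith
    · refine ((L t).le_opNorm x).trans ?_
      have hx' : ‖x‖ ≤ 2 * ‖y₀‖ := by
        have h1 : ‖x - y₀‖ ≤ ‖y₀‖ := by simpa [dist_eq_norm] using hx
        have h2 := norm_le_norm_add_norm_sub' x y₀
        linarith [norm_sub_rev x y₀]
      exact mul_le_mul (hb t ht) hx' (norm_nonneg _) hm
    · simp only [sub_self]
      rw [max_eq_left (sub_nonneg.2 hab)]
      push_cast
      change m * (2 * ‖y₀‖) * (b - a) ≤ ‖y₀‖ - 0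
      nlinarith [norm_nonneg y₀]
  exact hP.exists_eq_forall_mem_Icc_hasDerivWithinAt₀

theorem hasDerivWithinAt_glue {Y Z : ℝ → V} {f : ℝ → V → V} {a b c : ℝ} (hab : a ≤ b) (hbc : b ≤ c)
    (hY : ∀ s ∈ Icc a b, HasDerivWithinAt Y (f s (Y s)) (Icc a b) s)
    (hZ : ∀ s ∈ Icc b c, HasDerivWithinAt Z (f s (Z s)) (Icc b c) s) (h : Y b = Z b) :
    ∀ s ∈ Icc a c, HasDerivWithinAt (fun s => if s ≤ b then Y s else Z s)
      (f s (if s ≤ b then Y s else Z s)) (Icc a c) s := by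
  intro s hs
  have hl : ∀ u ∈ Icc a b, (if u ≤ b then Y u else Z u) = Y u := fun u hu => if_pos hu.2
  have hr : ∀ u ∈ Icc b c, (if u ≤ b then Y u else Z u) = Z u := by
    intro u hu
    split_ifs with h1
    · rw [le_antisymm h1 hu.1, h]
    · rfl
  -- Away from a closed interval a derivative within it is a vacuous condition, so each half of the
  -- union only has to be examined on its own interval.
  have hmem (u v : ℝ) (hs' : s ∉ Icc u v) :
      HasDerivWithinAt (fun s => if s ≤ b then Y s else Z s)
        (f s (if s ≤ b then Y s else Z s)) (Icc u v) s := by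
    refine HasFDerivWithinAt.of_notMem_closure ?_
    rwa [isClosed_Icc.closure_eq]
  rw [← Icc_union_Icc_eq_Icc hab hbc]
  refine HasDerivWithinAt.union ?_ ?_
  · by_cases h1 : s ∈ Icc a b
    · rw [hl s h1]
      exact (hY s h1).congr hl (hl s h1)
    · exact hmem _ _ h1
  · by_cases h1 : s ∈ Icc b c
    · rw [hr s h1]
      exact (hZ s h1).congr hr (hr s h1)
    · exact hmem _ _ h1

/-- For a linear equation the admissible step length depends only on a bound for L and not on the
initial value. Hence finitely many steps of length 1/N with N > 2m reach the end of the interval. -/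
theorem exists_hasDerivWithinAt_linear [CompleteSpace V] {L : ℝ → V →L[ℝ] V} (hL : ContinuousOn L (Icc 0 1))
    (y₀ : V) :
    ∃ Y : ℝ → V, Y 0 = y₀ ∧ ∀ s ∈ Icc (0 : ℝ) 1, HasDerivWithinAt Y (L s (Y s)) (Icc 0 1) s := by
  obtain ⟨m, hm⟩ := isCompact_Icc.exists_bound_of_continuousOn hL
  have hm0 : 0 ≤ m := (norm_nonneg _).trans (hm 0 (left_mem_Icc.2 zero_le_one))
  obtain ⟨N, hN⟩ := exists_nat_gt (2 * m)
  have hN0 : (0 : ℝ) < N := by linarith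
  have key : ∀ n : ℕ, n ≤ N → ∃ Y : ℝ → V, Y 0 = y₀ ∧
      ∀ s ∈ Icc (0 : ℝ) (n / N), HasDerivWithinAt Y (L s (Y s)) (Icc 0 (n / N)) s := by
    intro n
    induction n with
    | zero =>
      intro _
      refine ⟨fun _ => y₀, rfl, fun s hs => ?_⟩
      simp only [Nat.cast_zero, zero_div, Icc_self] at hs ⊢
      exact HasFDerivWithinAt.of_subsingleton subsingleton_singleton
    | succ n ih =>
      intro hn
      obtain ⟨Y, hY0, hY⟩ := ih (by omega)
      have h1 : (0 : ℝ) ≤ n / N := by positivity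
      have h2 : (n / N : ℝ) ≤ ((n + 1 : ℕ) : ℝ) / N := by
        push_cast
        gcongr
        linarith
      have h3 : ((n + 1 : ℕ) : ℝ) / N ≤ 1 := by
        rw [div_le_one hN0]
        exact_mod_cast hn
      have hsub : Icc (n / N : ℝ) (((n + 1 : ℕ) : ℝ) / N) ⊆ Icc 0 1 := Icc_subset_Icc h1 h3
      obtain ⟨Z, hZ0, hZ⟩ := exists_hasDerivWithinAt_linear_short h2 hm0 (hL.mono hsub)
        (fun s hs => hm s (hsub hs)) (by
          push_cast
          rw [add_div, add_sub_cancel_left, mul_one_div, div_le_iff₀ hN0]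
          linarith) (Y (n / N))
      exact ⟨fun s => if s ≤ n / N then Y s else Z s, by simp [h1, hY0],
        hasDerivWithinAt_glue (f := fun s y => L s y) h1 h2 hY hZ hZ0.symm⟩
  obtain ⟨Y, h0, hY⟩ := key N le_rfl
  rw [div_self hN0.ne'] at hY
  exact ⟨Y, h0, hY⟩

end LinearODE

/-! ### Frames of a connection on an interval -/

section Frames

variable {𝔸 : Type*} [NormedRing 𝔸] [NormedAlgebra ℝ 𝔸]

/-- `F` solves `F' = -M F` on `[0, 1]`, with `F 0 = 1`. -/
def IsFrame (M F : ℝ → 𝔸) : Prop :=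
  F 0 = 1 ∧ ∀ s ∈ Icc (0 : ℝ) 1, HasDerivWithinAt F (-(M s * F s)) (Icc 0 1) s

variable {M F : ℝ → 𝔸}

theorem IsFrame.continuousOn (h : IsFrame M F) : ContinuousOn F (Icc 0 1) :=
  fun s hs => (h.2 s hs).continuousWithinAt

theorem exists_isFrame [CompleteSpace 𝔸] (hM : ContinuousOn M (Icc 0 1)) : ∃ F, IsFrame M F := by
  have hL : ContinuousOn (fun s => -ContinuousLinearMap.mul ℝ 𝔸 (M s)) (Icc 0 1) :=
    ((ContinuousLinearMap.mul ℝ 𝔸).continuous.comp_continuousOn hM).neg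
  obtain ⟨Y, h0, hY⟩ := exists_hasDerivWithinAt_linear hL (1 : 𝔸)
  exact ⟨Y, h0, fun s hs => by simpa using hY s hs⟩

theorem eqOn_Icc_of_hasDerivWithinAt_zero {V : Type*} [NormedAddCommGroup V] [NormedSpace ℝ V]
    {f : ℝ → V} {a b : ℝ} (h : ∀ s ∈ Icc a b, HasDerivWithinAt f 0 (Icc a b) s) :
    ∀ s ∈ Icc a b, f s = f a := by
  refine constant_of_has_deriv_right_zero (fun s hs => (h s hs).continuousWithinAt) fun s hs => ?_
  exact (h s (Ico_subset_Icc_self hs)).mono_of_mem_nhdsWithin (Icc_mem_nhdsGE_of_mem hs)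

/-- The inverse is the solution of K' = KM with K(0) = 1: the product KF has derivative zero. In a
noncommutative algebra FK = 1 needs a separate argument. The product FK solves Z' = -MZ + ZM, as
does the constant 1, and solutions are unique. -/
theorem IsFrame.isUnit [CompleteSpace 𝔸] (hM : ContinuousOn M (Icc 0 1)) (h : IsFrame M F) :
    ∀ s ∈ Icc (0 : ℝ) 1, IsUnit (F s) := by
  have hL : ContinuousOn (fun s => (ContinuousLinearMap.mul ℝ 𝔸).flip (M s)) (Icc 0 1) :=
    (ContinuousLinearMap.mul ℝ 𝔸).flip.continuous.comp_continuousOn hM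
  obtain ⟨K, hK0, hK⟩ := exists_hasDerivWithinAt_linear hL (1 : 𝔸)
  replace hK : ∀ s ∈ Icc (0 : ℝ) 1, HasDerivWithinAt K (K s * M s) (Icc 0 1) s :=
    fun s hs => by simpa using hK s hs
  have hKF : ∀ s ∈ Icc (0 : ℝ) 1, K s * F s = 1 := by
    intro s hs
    have := eqOn_Icc_of_hasDerivWithinAt_zero (f := fun s => K s * F s) (a := 0) (b := 1)
      (fun s hs => ((hK s hs).mul (h.2 s hs)).congr_deriv (by simp [mul_assoc])) s hs
    simpa [hK0, h.1] using this
  obtain ⟨m, hm⟩ := isCompact_Icc.exists_bound_of_continuousOn hM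
  have hFK : ∀ s ∈ Icc (0 : ℝ) 1, F s * K s = 1 := by
    have hd : ∀ s ∈ Icc (0 : ℝ) 1, HasDerivWithinAt (fun s => F s * K s)
        (-(M s * (F s * K s)) + F s * K s * M s) (Icc 0 1) s := fun s hs =>
      ((h.2 s hs).mul (hK s hs)).congr_deriv (by simp [mul_assoc])
    have hlip : ∀ s ∈ Ico (0 : ℝ) 1, LipschitzOnWith (2 * m).toNNReal
        (fun y => -(M s * y) + y * M s) univ := by
      intro s hs
      have hms := hm s (Ico_subset_Icc_self hs)
      refine LipschitzOnWith.of_dist_le_mul fun x _ y _ => ?_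
      rw [dist_eq_norm, dist_eq_norm, Real.coe_toNNReal _ (by linarith [norm_nonneg (M s)])]
      have e : -(M s * x) + x * M s - (-(M s * y) + y * M s) =
          (x - y) * M s - M s * (x - y) := by noncomm_ring
      rw [e]
      refine (norm_sub_le _ _).trans ?_
      nlinarith [norm_mul_le (x - y) (M s), norm_mul_le (M s) (x - y), norm_nonneg (x - y)]
    have hIci {f : ℝ → 𝔸} {f' : 𝔸} {s : ℝ} (hs : s ∈ Ico (0 : ℝ) 1)
        (hf : HasDerivWithinAt f f' (Icc 0 1) s) : HasDerivWithinAt f f' (Ici s) s :=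
      hf.mono_of_mem_nhdsWithin (Icc_mem_nhdsGE_of_mem hs)
    refine ODE_solution_unique_of_mem_Icc_right (v := fun s y => -(M s * y) + y * M s)
      (s := fun _ => univ) (g := fun _ => (1 : 𝔸)) hlip
      (fun s hs => (hd s hs).continuousWithinAt)
      (fun s hs => hIci hs (hd s (Ico_subset_Icc_self hs))) (fun _ _ => mem_univ _)
      continuousOn_const (fun s hs => ?_) (fun _ _ => mem_univ _) (by simp [hK0, h.1])
    simpa using hasDerivWithinAt_const s (Ici s) (1 : 𝔸)
  exact fun s hs => ⟨⟨F s, K s, hFK s hs, hKF s hs⟩, rfl⟩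

theorem hasDerivWithinAt_inverse_frame [CompleteSpace 𝔸] {S : Set ℝ} {s : ℝ}
    (hu : IsUnit (F s)) {m : 𝔸} (h : HasDerivWithinAt F (-(m * F s)) S s) :
    HasDerivWithinAt (fun s => Ring.inverse (F s)) (Ring.inverse (F s) * m) S s := by
  obtain ⟨u, hu⟩ := hu
  have h1 := hasFDerivAt_ringInverse (𝕜 := ℝ) u
  rw [hu] at h1
  refine (h1.comp_hasDerivWithinAt s h).congr_deriv ?_
  rw [← hu, Ring.inverse_unit]
  simp [mul_assoc]

/-- Variation of constants. With m = m' it yields uniqueness of frames up to a constant right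
factor, and with m ≠ m' the perturbation formula. -/
theorem hasDerivWithinAt_inverse_mul_frame [CompleteSpace 𝔸] {S : Set ℝ} {s : ℝ}
    {F' : ℝ → 𝔸} (hu : IsUnit (F s)) {m m' : 𝔸} (h : HasDerivWithinAt F (-(m * F s)) S s)
    (h' : HasDerivWithinAt F' (-(m' * F' s)) S s) :
    HasDerivWithinAt (fun s => Ring.inverse (F s) * F' s)
      (-(Ring.inverse (F s) * (m' - m) * F' s)) S s :=
  ((hasDerivWithinAt_inverse_frame hu h).mul h').congr_deriv (by noncomm_ring)

/-- Solutions of `F' = -M F` on an interval differ by a constant factor on the right. -/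
theorem frame_eq_mul_const [CompleteSpace 𝔸] {F' : ℝ → 𝔸} {a b : ℝ}
    (hu : ∀ s ∈ Icc a b, IsUnit (F s))
    (h : ∀ s ∈ Icc a b, HasDerivWithinAt F (-(M s * F s)) (Icc a b) s)
    (h' : ∀ s ∈ Icc a b, HasDerivWithinAt F' (-(M s * F' s)) (Icc a b) s) :
    ∀ s ∈ Icc a b, F' s = F s * (Ring.inverse (F a) * F' a) := by
  intro s hs
  rw [← eqOn_Icc_of_hasDerivWithinAt_zero (f := fun s => Ring.inverse (F s) * F' s)
    (fun s hs => (hasDerivWithinAt_inverse_mul_frame (hu s hs) (h s hs) (h' s hs)).congr_deriv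
      (by simp)) s hs, ← mul_assoc, Ring.mul_inverse_cancel _ (hu s hs), one_mul]

theorem IsFrame.unique [CompleteSpace 𝔸] (hM : ContinuousOn M (Icc 0 1)) {F' : ℝ → 𝔸}
    (h : IsFrame M F) (h' : IsFrame M F') : ∀ s ∈ Icc (0 : ℝ) 1, F' s = F s := by
  intro s hs
  rw [frame_eq_mul_const (h.isUnit hM) h.2 h'.2 s hs, h.1, h'.1]
  simp

theorem IsFrame.norm_le (h : IsFrame M F) {m : ℝ} (hm : ∀ s ∈ Icc (0 : ℝ) 1, ‖M s‖ ≤ m) :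
    ∀ s ∈ Icc (0 : ℝ) 1, ‖F s‖ ≤ ‖(1 : 𝔸)‖ * Real.exp m := by
  have hm0 : 0 ≤ m := (norm_nonneg _).trans (hm 0 (left_mem_Icc.2 zero_le_one))
  intro s hs
  have := norm_le_gronwallBound_of_norm_deriv_right_le (δ := ‖(1 : 𝔸)‖) (K := m) (ε := 0)
    h.continuousOn
    (fun s hs => (h.2 s (Ico_subset_Icc_self hs)).mono_of_mem_nhdsWithin
      (Icc_mem_nhdsGE_of_mem hs)) (by rw [h.1])
    (fun s hs => by
      rw [norm_neg, add_zero]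
      exact (norm_mul_le _ _).trans
        (mul_le_mul_of_nonneg_right (hm s (Ico_subset_Icc_self hs)) (norm_nonneg _))) s hs
  rw [gronwallBound_ε0, sub_zero] at this
  refine this.trans ?_
  gcongr
  nlinarith [hs.1, hs.2]

end Frames

end SlSystem

end

noncomputable section

namespace SlSystem

open Set Filter Topology MeasureTheory

/-! ### Dependence of a frame on a parameter -/

section Parameter

variable {𝔸 : Type*} [NormedRing 𝔸] [NormedAlgebra ℝ 𝔸] [CompleteSpace 𝔸]

/-- Duhamel's formula: it makes the difference of two transports first order in the difference of
the coefficients. -/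
theorem IsFrame.inverse_mul_eq_integral {M M' F F' : ℝ → 𝔸} (hM : ContinuousOn M (Icc 0 1))
    (hM' : ContinuousOn M' (Icc 0 1)) (h : IsFrame M F) (h' : IsFrame M' F') :
    ∀ s ∈ Icc (0 : ℝ) 1, Ring.inverse (F s) * F' s =
      1 - ∫ u in (0 : ℝ)..s, Ring.inverse (F u) * (M' u - M u) * F' u := by
  intro s hs
  have hsub : Icc 0 s ⊆ Icc (0 : ℝ) 1 := Icc_subset_Icc_right hs.2
  have hd : ∀ u ∈ Icc (0 : ℝ) 1, HasDerivWithinAt (fun u => Ring.inverse (F u) * F' u)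
      (-(Ring.inverse (F u) * (M' u - M u) * F' u)) (Icc 0 1) u := fun u hu =>
    hasDerivWithinAt_inverse_mul_frame (h.isUnit hM u hu) (h.2 u hu) (h'.2 u hu)
  have hinv : ContinuousOn (fun u => Ring.inverse (F u)) (Icc 0 1) := fun u hu =>
    (hasDerivWithinAt_inverse_frame (h.isUnit hM u hu) (h.2 u hu)).continuousWithinAt
  have hint : ContinuousOn (fun u => Ring.inverse (F u) * (M' u - M u) * F' u) (Icc 0 1) :=
    (hinv.mul (hM'.sub hM)).mul h'.continuousOn
  have := intervalIntegral.integral_eq_sub_of_hasDeriv_right_of_le hs.1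
    (f := fun u => Ring.inverse (F u) * F' u)
    (f' := fun u => -(Ring.inverse (F u) * (M' u - M u) * F' u))
    (fun u hu => ((hd u (hsub hu)).mono hsub).continuousWithinAt)
    (fun u hu => (hd u (hsub (Ioo_subset_Icc_self hu))).mono_of_mem_nhdsWithin
      (mem_nhdsWithin_of_mem_nhds (Icc_mem_nhds hu.1 (hu.2.trans_le hs.2))))
    ((hint.mono hsub).neg.intervalIntegrable_of_Icc hs.1)
  rw [intervalIntegral.integral_neg, h.1, h'.1, Ring.inverse_one, one_mul] at this
  rw [sub_eq_add_neg, this]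
  abel

/-- The derivative of the transport `F t 1` with respect to the parameter `t`. -/
theorem hasDerivAt_frame_apply_one {M F : ℝ → ℝ → 𝔸} {N : ℝ → 𝔸} {C : ℝ}
    (hM0 : ContinuousOn (M 0) (Icc 0 1)) (hM : ∀ᶠ t in 𝓝 0, ContinuousOn (M t) (Icc 0 1))
    (hN : ∀ s ∈ Icc (0 : ℝ) 1, HasDerivAt (fun t => M t s) (N s) 0)
    (hC : ∀ᶠ t in 𝓝 0, ∀ s ∈ Icc (0 : ℝ) 1, ‖M t s - M 0 s‖ ≤ C * |t|)
    (hF0 : IsFrame (M 0) (F 0)) (hF : ∀ᶠ t in 𝓝 0, IsFrame (M t) (F t)) :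
    HasDerivAt (fun t => F t 1)
      (-(F 0 1 * ∫ s in (0 : ℝ)..1, Ring.inverse (F 0 s) * N s * F 0 s)) 0 := by
  have h01 : (1 : ℝ) ∈ Icc (0 : ℝ) 1 := right_mem_Icc.2 zero_le_one
  have hinv : ContinuousOn (fun u => Ring.inverse (F 0 u)) (Icc 0 1) := fun u hu =>
    (hasDerivWithinAt_inverse_frame (hF0.isUnit hM0 u hu) (hF0.2 u hu)).continuousWithinAt
  obtain ⟨m, hm⟩ := isCompact_Icc.exists_bound_of_continuousOn hM0
  obtain ⟨k, hk⟩ := isCompact_Icc.exists_bound_of_continuousOn hinv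
  obtain ⟨f, hf⟩ := isCompact_Icc.exists_bound_of_continuousOn hF0.continuousOn
  have h0 : (0 : ℝ) ∈ Icc (0 : ℝ) 1 := left_mem_Icc.2 zero_le_one
  have hk0 : 0 ≤ k := (norm_nonneg _).trans (hk 0 h0)
  have hf0 : 0 ≤ f := (norm_nonneg _).trans (hf 0 h0)
  -- For |t| ≤ 1 the coefficient is bounded by m + |C|, so Grönwall bounds all frames `F t` by this
  -- constant, independently of t.
  set B := ‖(1 : 𝔸)‖ * Real.exp (m + |C|) with hB
  have hB0 : 0 ≤ B := by positivity
  have hsmall : ∀ᶠ t : ℝ in 𝓝 0, |t| ≤ 1 := by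
    filter_upwards [Metric.closedBall_mem_nhds (0 : ℝ) one_pos] with t ht
    simpa using ht
  have hbound : ∀ᶠ t in 𝓝 0, ∀ s ∈ Icc (0 : ℝ) 1, ‖F t s‖ ≤ B := by
    filter_upwards [hC, hF, hsmall] with t hCt hFt ht
    refine hFt.norm_le fun s hs => ?_
    have h1 := norm_le_norm_add_norm_sub' (M t s) (M 0 s)
    have h2 := hCt s hs
    have h3 : C * |t| ≤ |C| := by
      calc C * |t| ≤ |C| * |t| := by gcongr; exact le_abs_self C
        _ ≤ |C| * 1 := by gcongr
        _ = |C| := mul_one _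
    linarith [hm s hs]
  -- The Duhamel integrand is O(|t|) uniformly in s. This gives the convergence of `F t s` to `F 0
  -- s` and, after division by t, the dominating constant.
  have hQ : ∀ᶠ t in 𝓝 0, ∀ s ∈ Icc (0 : ℝ) 1,
      ‖Ring.inverse (F 0 s) * (M t s - M 0 s) * F t s‖ ≤ k * (|C| * |t|) * B := by
    filter_upwards [hC, hbound] with t hCt hbt s hs
    refine (norm_mul_le _ _).trans (mul_le_mul ((norm_mul_le _ _).trans (mul_le_mul (hk s hs)
      ((hCt s hs).trans ?_) (norm_nonneg _) hk0)) (hbt s hs) (norm_nonneg _) (by positivity))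
    gcongr
    exact le_abs_self C
  have hlim : ∀ s ∈ Icc (0 : ℝ) 1, Tendsto (fun t => F t s) (𝓝 0) (𝓝 (F 0 s)) := by
    intro s hs
    rw [tendsto_iff_norm_sub_tendsto_zero]
    have hz : Tendsto (fun t : ℝ => f * (k * (|C| * |t|) * B)) (𝓝 0) (𝓝 0) := by
      have : Continuous fun t : ℝ => f * (k * (|C| * |t|) * B) := by fun_prop
      simpa using this.tendsto 0
    refine squeeze_zero' (Eventually.of_forall fun _ => norm_nonneg _) ?_ hz
    filter_upwards [hQ, hF, hM] with t hQt hFt hMt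
    have h1 := hF0.inverse_mul_eq_integral hM0 hMt hFt s hs
    have h2 : F t s - F 0 s = -(F 0 s * ∫ u in (0 : ℝ)..s,
        Ring.inverse (F 0 u) * (M t u - M 0 u) * F t u) := by
      have h3 := congrArg (F 0 s * ·) h1
      rw [mul_sub, mul_one, ← mul_assoc, Ring.mul_inverse_cancel _ (hF0.isUnit hM0 s hs), one_mul] at h3
      rw [h3]
      abel
    rw [h2, norm_neg]
    refine (norm_mul_le _ _).trans (mul_le_mul (hf s hs) ?_ (norm_nonneg _) hf0)
    have h4 := intervalIntegral.norm_integral_le_of_norm_le_const (a := 0) (b := s)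
      (f := fun u => Ring.inverse (F 0 u) * (M t u - M 0 u) * F t u) (C := k * (|C| * |t|) * B)
      (fun u hu => hQt u (by
        rw [uIoc_of_le hs.1] at hu
        exact ⟨hu.1.le, hu.2.trans hs.2⟩))
    refine h4.trans ?_
    rw [sub_zero, abs_of_nonneg hs.1]
    exact mul_le_of_le_one_right (by positivity) hs.2
  have hmain : HasDerivAt
      (fun t => ∫ s in (0 : ℝ)..1, Ring.inverse (F 0 s) * (M t s - M 0 s) * F t s)
      (∫ s in (0 : ℝ)..1, Ring.inverse (F 0 s) * N s * F 0 s) 0 := by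
    rw [hasDerivAt_iff_tendsto_slope]
    -- At t = 0 the Duhamel integral vanishes, so its difference quotient is the integral with `M t
    -- - M 0` replaced by its own difference quotient. Dominated convergence then applies.
    have hslope : ∀ t : ℝ, slope (fun t => ∫ s in (0 : ℝ)..1,
        Ring.inverse (F 0 s) * (M t s - M 0 s) * F t s) 0 t =
        ∫ s in (0 : ℝ)..1, Ring.inverse (F 0 s) * (t⁻¹ • (M t s - M 0 s)) * F t s := by
      intro t
      simp only [slope_def_module, sub_self, mul_zero, zero_mul, sub_zero,
        intervalIntegral.integral_zero]
      rw [← intervalIntegral.integral_smul]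
      simp
    rw [funext hslope]
    refine intervalIntegral.tendsto_integral_filter_of_dominated_convergence
      (fun _ => k * |C| * B) ?_ ?_ intervalIntegrable_const ?_
    · filter_upwards [hM.filter_mono nhdsWithin_le_nhds, hF.filter_mono nhdsWithin_le_nhds]
        with t hMt hFt
      have : ContinuousOn
          (fun s => Ring.inverse (F 0 s) * (t⁻¹ • (M t s - M 0 s)) * F t s) (Icc 0 1) :=
        (hinv.mul ((hMt.sub hM0).const_smul _)).mul hFt.continuousOn
      rw [uIoc_of_le zero_le_one]
      exact (this.mono Ioc_subset_Icc_self).aestronglyMeasurable measurableSet_Ioc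
    · filter_upwards [hQ.filter_mono nhdsWithin_le_nhds, self_mem_nhdsWithin] with t hQt ht
      refine Eventually.of_forall fun s hs => ?_
      rw [uIoc_of_le zero_le_one] at hs
      have ht' : (0 : ℝ) < |t| := abs_pos.2 ht
      rw [mul_smul_comm, smul_mul_assoc, norm_smul, norm_inv, Real.norm_eq_abs,
        inv_mul_le_iff₀ ht']
      refine (hQt s (Ioc_subset_Icc_self hs)).trans (le_of_eq ?_)
      ring
    · refine Eventually.of_forall fun s hs => ?_
      rw [uIoc_of_le zero_le_one] at hs
      have hs := Ioc_subset_Icc_self hs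
      have h1 := (hasDerivAt_iff_tendsto_slope.1 (hN s hs))
      simp only [slope_fun_def, sub_zero, vsub_eq_sub] at h1
      exact (h1.const_mul _).mul ((hlim s hs).mono_left nhdsWithin_le_nhds)
  have hfin := (hmain.const_sub (1 : 𝔸)).const_mul (F 0 1)
  rw [mul_neg] at hfin
  refine hfin.congr_of_eventuallyEq ?_
  filter_upwards [hF, hM] with t hFt hMt
  rw [← hF0.inverse_mul_eq_integral hM0 hMt hFt 1 h01, ← mul_assoc,
    Ring.mul_inverse_cancel _ (hF0.isUnit hM0 1 h01), one_mul]

end Parameter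

end SlSystem

end

noncomputable section

namespace SlSystem

open Set Filter Topology MeasureTheory

/-! ### Local flat sections -/

section FlatSections

theorem integral_eq_sub_of_hasDerivWithinAt_Icc {V : Type*} [NormedAddCommGroup V]
    [NormedSpace ℝ V] [CompleteSpace V] {f f' : ℝ → V}
    (h : ∀ s ∈ Icc (0 : ℝ) 1, HasDerivWithinAt f (f' s) (Icc 0 1) s)
    (hc : ContinuousOn f' (Icc 0 1)) : ∫ s in (0 : ℝ)..1, f' s = f 1 - f 0 :=
  intervalIntegral.integral_eq_sub_of_hasDeriv_right_of_le zero_le_one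
    (fun u hu => (h u hu).continuousWithinAt)
    (fun u hu => (h u (Ioo_subset_Icc_self hu)).mono_of_mem_nhdsWithin
      (mem_nhdsWithin_of_mem_nhds (Icc_mem_nhds hu.1 hu.2)))
    (hc.intervalIntegrable_of_Icc zero_le_one)

variable {E : Type*} [NormedAddCommGroup E] [NormedSpace ℝ E]

theorem hasDerivAt_line_of_hasDerivAt_zero {V : Type*} [NormedAddCommGroup V] [NormedSpace ℝ V]
    {f : E → V} {z v : E} {d : V} {t : ℝ}
    (h : HasDerivAt (fun u : ℝ => f (z + t • v + u • v)) d 0) :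
    HasDerivAt (fun u : ℝ => f (z + u • v)) d t := by
  have h' : HasDerivAt (fun u : ℝ => f (z + t • v + u • v)) d (t - t) := by rwa [sub_self]
  have := h'.comp_sub_const t t
  refine this.congr_of_eventuallyEq (Eventually.of_forall fun u => ?_)
  simp only
  congr 1
  module

/-- Differentiability along lines suffices when the directional derivatives come from linear maps
continuous at the point: the mean value inequality is applied on the segment after subtracting the
linear term. -/
theorem hasFDerivAt_of_hasDerivAt_line {V : Type*} [NormedAddCommGroup V] [NormedSpace ℝ V]
    {f : E → V} {L : E → E →L[ℝ] V} {z₀ : E}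
    (h : ∀ᶠ z in 𝓝 z₀, ∀ v, HasDerivAt (fun t : ℝ => f (z + t • v)) (L z v) 0)
    (hL : ContinuousAt L z₀) : HasFDerivAt f (L z₀) z₀ := by
  rw [hasFDerivAt_iff_isLittleO_nhds_zero, Asymptotics.isLittleO_iff]
  intro ε hε
  obtain ⟨δ, hδ, hball⟩ := Metric.eventually_nhds_iff_ball.1
    (h.and (Metric.continuousAt_iff'.1 hL ε hε))
  filter_upwards [Metric.ball_mem_nhds (0 : E) hδ] with v hv
  have hmem : ∀ t ∈ Icc (0 : ℝ) 1, z₀ + t • v ∈ Metric.ball z₀ δ := by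
    intro t ht
    rw [mem_ball_iff_norm, add_sub_cancel_left, norm_smul, Real.norm_eq_abs, abs_of_nonneg ht.1]
    rw [mem_ball_zero_iff] at hv
    nlinarith [norm_nonneg v, ht.2]
  have := norm_image_sub_le_of_norm_deriv_le_segment_01'
    (f := fun t : ℝ => f (z₀ + t • v) - t • L z₀ v)
    (f' := fun t => L (z₀ + t • v) v - L z₀ v) (C := ε * ‖v‖)
    (fun t ht => by
      have h1 := hasDerivAt_line_of_hasDerivAt_zero ((hball _ (hmem t ht)).1 v)
      have h2 := (hasDerivAt_id t).smul_const (L z₀ v)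
      rw [one_smul] at h2
      exact (h1.sub h2).hasDerivWithinAt)
    (fun t ht => by
      have h1 := (hball _ (hmem t (Ico_subset_Icc_self ht))).2
      rw [dist_eq_norm] at h1
      rw [← sub_apply]
      exact ((L (z₀ + t • v) - L z₀).le_opNorm v).trans (by gcongr))
  simpa [sub_right_comm] using this

variable {𝔸 : Type*} [NormedRing 𝔸] [NormedAlgebra ℝ 𝔸]

/-- The linear map `v ↦ -(η v) g`, the derivative prescribed for a flat section with value `g` by
the connection form `η`. -/
def flatDeriv (η : E →L[ℝ] 𝔸) (g : 𝔸) : E →L[ℝ] 𝔸 :=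
  -((ContinuousLinearMap.mul ℝ 𝔸).flip g).comp η

@[simp] theorem flatDeriv_apply (η : E →L[ℝ] 𝔸) (g : 𝔸) (v : E) :
    flatDeriv η g v = -(η v * g) := rfl

/-- The radial coefficient of the connection form `Ω` on the segment from `0` to `z`. -/
def radial (Ω : E → E →L[ℝ] 𝔸) (z : E) (s : ℝ) : 𝔸 := Ω (s • z) z

variable {Ω : E → E →L[ℝ] 𝔸} {r C : ℝ}

theorem smul_mem_ball_of_mem_Icc {z : E} (hz : z ∈ Metric.ball (0 : E) r) {s : ℝ}
    (hs : s ∈ Icc (0 : ℝ) 1) : s • z ∈ Metric.ball (0 : E) r := by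
  rw [mem_ball_zero_iff] at hz ⊢
  rw [norm_smul, Real.norm_eq_abs, abs_of_nonneg hs.1]
  nlinarith [norm_nonneg z, hs.2]

theorem continuousOn_radial (hΩ : ContinuousOn Ω (Metric.ball 0 r)) {z : E}
    (hz : z ∈ Metric.ball (0 : E) r) : ContinuousOn (radial Ω z) (Icc 0 1) :=
  (hΩ.comp (by fun_prop) fun _ hs => smul_mem_ball_of_mem_Icc hz hs).clm_apply continuousOn_const

theorem hasDerivAt_radial {Ω' : E → E →L[ℝ] E →L[ℝ] 𝔸}
    (hΩ : ∀ z ∈ Metric.ball (0 : E) r, HasFDerivAt Ω (Ω' z) z) {z v : E} {t s : ℝ}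
    (hz : z + t • v ∈ Metric.ball (0 : E) r) (hs : s ∈ Icc (0 : ℝ) 1) :
    HasDerivAt (fun t : ℝ => radial Ω (z + t • v) s)
      (Ω' (s • (z + t • v)) (s • v) (z + t • v) + Ω (s • (z + t • v)) v) t := by
  have h1 : HasDerivAt (fun t : ℝ => z + t • v) v t := by
    simpa using ((hasDerivAt_id t).smul_const v).const_add z
  have h2 : HasDerivAt (fun t : ℝ => Ω (s • (z + t • v))) (Ω' (s • (z + t • v)) (s • v)) t :=
    (hΩ _ (smul_mem_ball_of_mem_Icc hz hs)).comp_hasDerivAt t (h1.const_smul s)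
  exact h2.clm_apply h1

/-- Transport along rays is flat in the radial direction by construction. For another direction v,
vanishing curvature turns the integrand F⁻¹NF of the variation formula into the derivative in s of
F⁻¹ Ω(sz)(sv) F. The integral then reduces to the boundary term at s = 1, the one at s = 0 being
zero. -/
theorem hasDerivAt_transport_line [CompleteSpace 𝔸] {Ω' : E → E →L[ℝ] E →L[ℝ] 𝔸} {F : E → ℝ → 𝔸}
    (hΩ : ∀ z ∈ Metric.ball (0 : E) r, HasFDerivAt Ω (Ω' z) z)
    (hΩ' : ContinuousOn Ω' (Metric.ball 0 r))
    (hC : ∀ z ∈ Metric.ball (0 : E) r, ‖Ω z‖ ≤ C) (hC' : ∀ z ∈ Metric.ball (0 : E) r, ‖Ω' z‖ ≤ C)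
    (hflat : ∀ z ∈ Metric.ball (0 : E) r, ∀ u v,
      Ω' z u v - Ω' z v u + (Ω z u * Ω z v - Ω z v * Ω z u) = 0)
    (hF : ∀ z ∈ Metric.ball (0 : E) r, IsFrame (radial Ω z) (F z)) {z : E}
    (hz : z ∈ Metric.ball (0 : E) r) (v : E) :
    HasDerivAt (fun t : ℝ => F (z + t • v) 1) (flatDeriv (Ω z) (F z 1) v) 0 := by
  have hcont : ContinuousOn Ω (Metric.ball 0 r) := fun z hz => (hΩ z hz).continuousAt.continuousWithinAt
  have hC0 : 0 ≤ C := (norm_nonneg _).trans (hC z hz)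
  have hr0 : 0 ≤ r := (dist_nonneg.trans_lt (Metric.mem_ball.1 hz)).le
  have hline : Continuous fun t : ℝ => z + t • v := by fun_prop
  have hnear : ∀ᶠ t : ℝ in 𝓝 0, z + t • v ∈ Metric.ball (0 : E) r :=
    hline.continuousAt.eventually_mem (by simpa using Metric.isOpen_ball.mem_nhds hz)
  have hball : ∀ s ∈ Icc (0 : ℝ) 1, s • z ∈ Metric.ball (0 : E) r :=
    fun s hs => smul_mem_ball_of_mem_Icc hz hs
  set N : ℝ → 𝔸 := fun s => Ω' (s • z) (s • v) z + Ω (s • z) v with hN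
  have hsmul (w : E) : ContinuousOn (fun s : ℝ => s • w) (Icc 0 1) := by fun_prop
  have hNc : ContinuousOn N (Icc 0 1) :=
    (((hΩ'.comp (hsmul z) hball).clm_apply (hsmul v)).clm_apply continuousOn_const).add
      ((hcont.comp (hsmul z) hball).clm_apply continuousOn_const)
  have hrad := continuousOn_radial hcont hz
  have hFz := hF z hz
  -- The Lipschitz constant in t bounds the two terms of the derivative of the radial coefficient:
  -- one differentiates the base point of Ω, the other its argument.
  have hd := hasDerivAt_frame_apply_one (M := fun t => radial Ω (z + t • v))
    (F := fun t => F (z + t • v)) (N := N) (C := C * ‖v‖ * r + C * ‖v‖)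
    (by simpa using hrad)
    (hnear.mono fun t ht => continuousOn_radial hcont ht)
    (fun s hs => by
      simpa [hN] using hasDerivAt_radial hΩ (t := 0) (v := v) (by simpa using hz) hs)
    (by
      obtain ⟨δ, hδ, hb⟩ := Metric.eventually_nhds_iff_ball.1 hnear
      filter_upwards [Metric.ball_mem_nhds (0 : ℝ) hδ] with t ht s hs
      have := (convex_ball (0 : ℝ) δ).norm_image_sub_le_of_norm_hasDerivWithin_le
        (f := fun t => radial Ω (z + t • v) s) (C := C * ‖v‖ * r + C * ‖v‖)
        (fun u hu => (hasDerivAt_radial hΩ (hb u hu) hs).hasDerivWithinAt)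
        (fun u hu => by
          have hm := smul_mem_ball_of_mem_Icc (hb u hu) hs
          refine (norm_add_le _ _).trans (add_le_add ?_ ?_)
          · refine (ContinuousLinearMap.le_opNorm₂ _ _ _).trans ?_
            have h1 : ‖s • v‖ ≤ ‖v‖ := by
              rw [norm_smul, Real.norm_eq_abs, abs_of_nonneg hs.1]
              nlinarith [norm_nonneg v, hs.2]
            have h2 : ‖z + u • v‖ ≤ r := (mem_ball_zero_iff.1 (hb u hu)).le
            have h3 := hC' _ hm
            gcongr
          · refine (ContinuousLinearMap.le_opNorm _ _).trans ?_
            have h3 := hC _ hm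
            gcongr)
        (Metric.mem_ball_self hδ) ht
      simpa using this)
    (by simpa using hFz)
    (hnear.mono fun t ht => hF _ ht)
  simp only [zero_smul, add_zero] at hd
  have hint : ∫ s in (0 : ℝ)..1, Ring.inverse (F z s) * N s * F z s =
      Ring.inverse (F z 1) * Ω z v * F z 1 := by
    have hu := hFz.isUnit hrad
    have hinv : ContinuousOn (fun s => Ring.inverse (F z s)) (Icc 0 1) := fun s hs =>
      (hasDerivWithinAt_inverse_frame (hu s hs) (hFz.2 s hs)).continuousWithinAt
    rw [integral_eq_sub_of_hasDerivWithinAt_Icc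
      (f := fun s => Ring.inverse (F z s) * Ω (s • z) (s • v) * F z s)
      (f' := fun s => Ring.inverse (F z s) * N s * F z s) (fun s hs => ?_)
      ((hinv.mul hNc).mul hFz.continuousOn)]
    · simp
    · have hz' (w : E) : HasDerivWithinAt (fun s : ℝ => s • w) w (Icc 0 1) s := by
        simpa using ((hasDerivAt_id s).smul_const w).hasDerivWithinAt
      have h0 : HasDerivWithinAt (fun s : ℝ => Ω (s • z)) (Ω' (s • z) z) (Icc 0 1) s :=
        (hΩ _ (hball s hs)).comp_hasDerivWithinAt s (hz' z)
      have h1 : HasDerivWithinAt (fun s : ℝ => Ω (s • z) (s • v))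
          (Ω' (s • z) z (s • v) + Ω (s • z) v) (Icc 0 1) s := h0.clm_apply (hz' v)
      refine (((hasDerivWithinAt_inverse_frame (hu s hs) (hFz.2 s hs)).mul h1).mul
        (hFz.2 s hs)).congr_deriv ?_
      have hfl := hflat _ (hball s hs) z (s • v)
      -- Flatness exchanges the two arguments of Ω' at the cost of the commutator, which is what the
      -- derivatives of F and F⁻¹ contribute.
      have e : N s = Ω' (s • z) z (s • v) + Ω (s • z) v +
          (Ω (s • z) z * Ω (s • z) (s • v) - Ω (s • z) (s • v) * Ω (s • z) z) := by
        rw [hN]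
        simp only
        rw [← sub_eq_zero, ← neg_eq_zero, ← hfl]
        abel
      rw [e, radial, Pi.mul_apply]
      noncomm_ring
  rw [hint, ← mul_assoc, ← mul_assoc,
    Ring.mul_inverse_cancel _ (hFz.isUnit hrad 1 (right_mem_Icc.2 zero_le_one)), one_mul] at hd
  exact hd

/-- A connection form `Ω` with vanishing curvature has a local flat frame `G`. -/
theorem exists_flat_frame_zero [CompleteSpace 𝔸] {r₀ : ℝ} (hr₀ : 0 < r₀) (hΩ : ContDiffOn ℝ 1 Ω (Metric.ball 0 r₀))
    (hflat : ∀ z ∈ Metric.ball (0 : E) r₀, ∀ u v,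
      fderiv ℝ Ω z u v - fderiv ℝ Ω z v u + (Ω z u * Ω z v - Ω z v * Ω z u) = 0) :
    ∃ r > 0, r ≤ r₀ ∧ ∃ G : E → 𝔸, G 0 = 1 ∧ ∀ z ∈ Metric.ball (0 : E) r,
      IsUnit (G z) ∧ HasFDerivAt G (flatDeriv (Ω z) (G z)) z := by
  have hΩ' : ContinuousOn (fderiv ℝ Ω) (Metric.ball 0 r₀) :=
    hΩ.continuousOn_fderiv_of_isOpen Metric.isOpen_ball le_rfl
  have hb0 := Metric.isOpen_ball.mem_nhds (Metric.mem_ball_self hr₀ : (0 : E) ∈ _)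
  -- Ω and its derivative are only continuous on the given ball. Near the centre both stay below
  -- their larger value there plus one, which fixes the smaller radius.
  set C := max ‖Ω 0‖ ‖fderiv ℝ Ω 0‖ + 1 with hCdef
  have h1 : ∀ᶠ z in 𝓝 (0 : E), ‖Ω z‖ < C :=
    (hΩ.continuousOn.continuousAt hb0).norm.eventually_lt continuousAt_const
      ((le_max_left _ _).trans_lt (lt_add_one _))
  have hn : ContinuousAt (fun z => ‖fderiv ℝ Ω z‖) 0 :=
    ContinuousAt.norm (E := E →L[ℝ] E →L[ℝ] 𝔸) (hΩ'.continuousAt hb0)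
  have h2 : ∀ᶠ z in 𝓝 (0 : E), ‖fderiv ℝ Ω z‖ < C :=
    hn.eventually_lt continuousAt_const
      ((le_max_right ‖Ω 0‖ ‖fderiv ℝ Ω 0‖).trans_lt (lt_add_one _))
  obtain ⟨r₁, hr₁, hb⟩ := Metric.eventually_nhds_iff_ball.1 (h1.and h2)
  set r := min r₀ r₁ with hr
  have hrpos : 0 < r := lt_min hr₀ hr₁
  have hs0 : Metric.ball (0 : E) r ⊆ Metric.ball 0 r₀ := Metric.ball_subset_ball (min_le_left _ _)
  have hs1 : Metric.ball (0 : E) r ⊆ Metric.ball 0 r₁ := Metric.ball_subset_ball (min_le_right _ _)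
  have hC : ∀ z ∈ Metric.ball (0 : E) r, ‖Ω z‖ ≤ C := fun z hz => (hb z (hs1 hz)).1.le
  have hcont : ContinuousOn Ω (Metric.ball 0 r) := hΩ.continuousOn.mono hs0
  have hex : ∀ z ∈ Metric.ball (0 : E) r, ∃ F, IsFrame (radial Ω z) F := fun z hz =>
    exists_isFrame (continuousOn_radial hcont hz)
  choose! F hF using hex
  have hline : ∀ z ∈ Metric.ball (0 : E) r, ∀ v,
      HasDerivAt (fun t : ℝ => F (z + t • v) 1) (flatDeriv (Ω z) (F z 1) v) 0 := fun z hz v =>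
    hasDerivAt_transport_line (Ω' := fderiv ℝ Ω) (C := C)
      (fun z hz => ((hΩ.differentiableOn one_ne_zero).differentiableAt
        (Metric.isOpen_ball.mem_nhds (hs0 hz))).hasFDerivAt)
      (hΩ'.mono hs0) hC (fun z hz => (hb z (hs1 hz)).2.le) (fun z hz => hflat z (hs0 hz)) hF hz v
  have hC0 : 0 ≤ C := by positivity
  set B := ‖(1 : 𝔸)‖ * Real.exp (C * r) with hB
  have hB0 : 0 ≤ B := by positivity
  have hbd : ∀ z ∈ Metric.ball (0 : E) r, ‖F z 1‖ ≤ B := by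
    intro z hz
    refine (hF z hz).norm_le (fun s hs => ?_) 1 (right_mem_Icc.2 zero_le_one)
    refine (ContinuousLinearMap.le_opNorm _ _).trans ?_
    have := hC _ (smul_mem_ball_of_mem_Icc hz hs)
    have := (mem_ball_zero_iff.1 hz).le
    gcongr
  -- The prescribed derivative -ΩG contains G itself, so its continuity requires that of G. A
  -- Lipschitz estimate from the derivatives along lines supplies it.
  have hcontG : ∀ z₀ ∈ Metric.ball (0 : E) r, ContinuousAt (fun z => F z 1) z₀ := by
    intro z₀ hz₀
    obtain ⟨δ, hδ, hsub⟩ := Metric.isOpen_iff.1 Metric.isOpen_ball z₀ hz₀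
    refine continuousAt_of_locally_lipschitz hδ (C * B) fun z hz => ?_
    rw [dist_eq_norm, dist_eq_norm]
    have hmem : ∀ t ∈ Icc (0 : ℝ) 1, z₀ + t • (z - z₀) ∈ Metric.ball (0 : E) r := by
      intro t ht
      refine hsub ?_
      rw [mem_ball_iff_norm, add_sub_cancel_left, norm_smul, Real.norm_eq_abs,
        abs_of_nonneg ht.1]
      rw [dist_eq_norm] at hz
      nlinarith [norm_nonneg (z - z₀), ht.2]
    have := norm_image_sub_le_of_norm_deriv_le_segment_01'
      (f := fun t : ℝ => F (z₀ + t • (z - z₀)) 1)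
      (f' := fun t => flatDeriv (Ω (z₀ + t • (z - z₀))) (F (z₀ + t • (z - z₀)) 1) (z - z₀))
      (C := C * B * ‖z - z₀‖)
      (fun t ht => (hasDerivAt_line_of_hasDerivAt_zero (f := fun z => F z 1)
        (hline _ (hmem t ht) (z - z₀))).hasDerivWithinAt)
      (fun t ht => by
        have hm := hmem t (Ico_subset_Icc_self ht)
        rw [flatDeriv_apply, norm_neg]
        refine (norm_mul_le _ _).trans ?_
        have h3 := hbd _ hm
        have h4 := (ContinuousLinearMap.le_opNorm (Ω (z₀ + t • (z - z₀))) (z - z₀)).trans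
          (mul_le_mul_of_nonneg_right (hC _ hm) (norm_nonneg _))
        calc _ ≤ C * ‖z - z₀‖ * B := by gcongr
          _ = _ := by ring)
    simpa using this
  refine ⟨r, hrpos, min_le_left _ _, fun z => F z 1, ?_, fun z hz => ⟨?_, ?_⟩⟩
  · have h0 := Metric.mem_ball_self hrpos (x := (0 : E))
    have h3 := (hF 0 h0).unique (continuousOn_radial hcont h0) (F' := fun _ => 1)
      ⟨rfl, fun s _ => by simpa [radial] using hasDerivWithinAt_const s (Icc 0 1) (1 : 𝔸)⟩
    exact (h3 1 (right_mem_Icc.2 zero_le_one)).symm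
  · exact (hF z hz).isUnit (continuousOn_radial hcont hz) 1 (right_mem_Icc.2 zero_le_one)
  · refine hasFDerivAt_of_hasDerivAt_line (f := fun z => F z 1)
      (L := fun z => flatDeriv (Ω z) (F z 1)) ?_ ?_
    · filter_upwards [Metric.isOpen_ball.mem_nhds hz] with z hz v using hline z hz v
    · have hΩz := hcont.continuousAt (Metric.isOpen_ball.mem_nhds hz)
      exact (((ContinuousLinearMap.mul ℝ 𝔸).flip.continuous.continuousAt.comp
        (hcontG z hz)).clm_comp hΩz).neg

end FlatSections

end SlSystem

end

noncomputable section

namespace SlSystem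

open Set Filter Topology MeasureTheory

/-! ### Changes of charts -/

section Charts

variable {X : Type} [TopologicalSpace X] {e e' : OpenPartialHomeomorph X ℂ} {z : ℂ}

theorem eventually_transition (hz : z ∈ e.target) (hz' : e.symm z ∈ e'.source) :
    ∀ᶠ w in 𝓝 z, w ∈ e.target ∧ e.symm w ∈ e'.source :=
  (e.open_target.eventually_mem hz).and
    ((e.continuousAt_symm hz).eventually_mem (e'.open_source.mem_nhds hz'))

theorem deriv_transition_self (hz : z ∈ e.target) : deriv (fun w => e (e.symm w)) z = 1 := by
  have : (fun w => e (e.symm w)) =ᶠ[𝓝 z] id := by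
    filter_upwards [e.open_target.mem_nhds hz] with w hw using e.right_inv hw
  rw [this.deriv_eq, deriv_id]

variable [ChartedSpace ℂ X]

/-- The underlying smooth surface of a Riemann surface. -/
theorem isManifold_real [IsManifold 𝓘(ℂ, ℂ) ω X] : IsManifold 𝓘(ℝ, ℂ) ∞ X := by
  refine isManifold_of_contDiffOn _ _ _ fun e e' he he' => ?_
  have h := (contDiffGroupoid ω 𝓘(ℂ, ℂ)).compatible he he'
  rw [contDiffGroupoid, mem_groupoid_of_pregroupoid] at h
  exact (ContDiffOn.restrict_scalars ℝ h.1).of_le le_top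

theorem differentiableAt_transition [IsManifold 𝓘(ℂ, ℂ) ω X] (he : e ∈ atlas ℂ X)
    (he' : e' ∈ atlas ℂ X) (hz : z ∈ e.target) (hz' : e.symm z ∈ e'.source) :
    DifferentiableAt ℂ (fun w => e' (e.symm w)) z := by
  have h1 : ContMDiffAt 𝓘(ℂ, ℂ) 𝓘(ℂ, ℂ) ω e.symm z :=
    contMDiffAt_symm_of_mem_maximalAtlas (IsManifold.subset_maximalAtlas he) hz
  have h2 : ContMDiffAt 𝓘(ℂ, ℂ) 𝓘(ℂ, ℂ) ω e' (e.symm z) :=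
    contMDiffAt_of_mem_maximalAtlas (IsManifold.subset_maximalAtlas he') hz'
  exact ((h2.comp z h1).contDiffAt).differentiableAt (by simp)

theorem deriv_transition_mul [IsManifold 𝓘(ℂ, ℂ) ω X] {e'' : OpenPartialHomeomorph X ℂ}
    (he : e ∈ atlas ℂ X) (he' : e' ∈ atlas ℂ X) (he'' : e'' ∈ atlas ℂ X) (hz : z ∈ e.target)
    (hz' : e.symm z ∈ e'.source) (hz'' : e.symm z ∈ e''.source) :
    deriv (fun w => e'' (e.symm w)) z =
      deriv (fun w => e'' (e'.symm w)) (e' (e.symm z)) * deriv (fun w => e' (e.symm w)) z := by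
  have h1 := differentiableAt_transition he he' hz hz'
  have h2 := differentiableAt_transition he' he'' (e'.map_source hz')
    (by rwa [e'.left_inv hz'])
  rw [← deriv_comp (h₂ := fun w => e'' (e'.symm w)) (h := fun w => e' (e.symm w)) z h2 h1]
  refine Filter.EventuallyEq.deriv_eq ?_
  filter_upwards [eventually_transition hz hz'] with w hw
  simp [e'.left_inv hw.2]

theorem deriv_transition_ne_zero [IsManifold 𝓘(ℂ, ℂ) ω X] (he : e ∈ atlas ℂ X)
    (he' : e' ∈ atlas ℂ X) (hz : z ∈ e.target) (hz' : e.symm z ∈ e'.source) :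
    deriv (fun w => e' (e.symm w)) z ≠ 0 := by
  have h := deriv_transition_mul he he' he hz hz' (e.map_target hz)
  rw [deriv_transition_self hz] at h
  exact right_ne_zero_of_mul (h ▸ one_ne_zero)

theorem transitionDeriv_eq [IsManifold 𝓘(ℂ, ℂ) ω X] (he : e ∈ atlas ℂ X)
    (he' : e' ∈ atlas ℂ X) (hz : z ∈ e.target) (hz' : e.symm z ∈ e'.source) :
    transitionDeriv e z =
      deriv (fun w => e' (e.symm w)) z * transitionDeriv e' (e' (e.symm z)) := by
  rw [transitionDeriv, transitionDeriv, e'.left_inv hz', mul_comm]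
  exact deriv_transition_mul he he' (chart_mem_atlas ℂ _) hz hz' (mem_chart_source ℂ _)

theorem transitionDeriv_ne_zero [IsManifold 𝓘(ℂ, ℂ) ω X] (he : e ∈ atlas ℂ X)
    (hz : z ∈ e.target) : transitionDeriv e z ≠ 0 :=
  deriv_transition_ne_zero he (chart_mem_atlas ℂ _) hz (mem_chart_source ℂ _)

theorem transitionDeriv_chartAt (x : X) : transitionDeriv (chartAt ℂ x) (chartAt ℂ x x) = 1 := by
  rw [transitionDeriv, (chartAt ℂ x).left_inv (mem_chart_source ℂ x)]
  exact deriv_transition_self (mem_chart_target ℂ x)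

variable {V : Type*} [AddCommGroup V] [Module ℂ V]

theorem inChart_chartAt (p q : ℤ) (f : X → V) (x : X) :
    inChart p q f (chartAt ℂ x) (chartAt ℂ x x) = f x := by
  simp [inChart, transitionDeriv_chartAt, (chartAt ℂ x).left_inv (mem_chart_source ℂ x)]

/-- Both coefficients refer to the same preferred chart at the given point, so the transformation
law is the chain rule for transition maps and holds for every function f, with no regularity. -/
theorem inChart_change [IsManifold 𝓘(ℂ, ℂ) ω X] (p q : ℤ) (f : X → V) (he : e ∈ atlas ℂ X)
    (he' : e' ∈ atlas ℂ X) (hz : z ∈ e.target) (hz' : e.symm z ∈ e'.source) :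
    inChart p q f e z = (deriv (fun w => e' (e.symm w)) z ^ p *
      conj (deriv (fun w => e' (e.symm w)) z) ^ q) • inChart p q f e' (e' (e.symm z)) := by
  rw [inChart, inChart, transitionDeriv_eq he he' hz hz', smul_smul, e'.left_inv hz', map_mul,
    mul_zpow, mul_zpow]
  congr 1
  ring

theorem inChart_zero (f : X → V) : inChart 0 0 f e z = f (e.symm z) := by
  simp [inChart]

theorem inChart_mul {R : Type*} [Ring R] [Algebra ℂ R] [IsManifold 𝓘(ℂ, ℂ) ω X]
    (he : e ∈ atlas ℂ X) (hz : z ∈ e.target) (p q p' q' : ℤ) (f g : X → R) :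
    inChart (p + p') (q + q') (fun x => f x * g x) e z =
      inChart p q f e z * inChart p' q' g e z := by
  have h0 := transitionDeriv_ne_zero he hz
  rw [inChart, inChart, inChart, smul_mul_smul_comm, zpow_add₀ h0,
    zpow_add₀ ((map_ne_zero _).2 h0)]
  congr 1
  ring

end Charts

/-! ### Wirtinger derivatives of vector-valued functions -/

section Wirtinger

variable {V W : Type*} [NormedAddCommGroup V] [NormedSpace ℂ V] [NormedAddCommGroup W]
  [NormedSpace ℂ W]

/-- `∂f/∂z` for a vector-valued function. -/
def wdz (f : ℂ → V) (z : ℂ) : V :=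
  (2⁻¹ : ℂ) • (fderiv ℝ f z 1 - Complex.I • fderiv ℝ f z Complex.I)

/-- `∂f/∂z̄` for a vector-valued function. -/
def wdzbar (f : ℂ → V) (z : ℂ) : V :=
  (2⁻¹ : ℂ) • (fderiv ℝ f z 1 + Complex.I • fderiv ℝ f z Complex.I)

theorem wdz_eq_dz (f : ℂ → ℂ) : wdz f = dz f := by
  funext z
  simp only [wdz, dz, smul_eq_mul]
  ring

theorem wdzbar_eq_dzbar (f : ℂ → ℂ) : wdzbar f = dzbar f := by
  funext z
  simp only [wdzbar, dzbar, smul_eq_mul]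
  ring

theorem real_linear_apply (L : ℂ →L[ℝ] V) (v : ℂ) :
    L v = v • ((2⁻¹ : ℂ) • (L 1 - Complex.I • L Complex.I)) +
      conj v • ((2⁻¹ : ℂ) • (L 1 + Complex.I • L Complex.I)) := by
  have h : L v = (v.re : ℂ) • L 1 + (v.im : ℂ) • L Complex.I := by
    conv_lhs => rw [← Complex.re_add_im v]
    have e1 : (v.re : ℂ) = v.re • (1 : ℂ) := by simp
    have e2 : (v.im : ℂ) * Complex.I = v.im • Complex.I := by simp
    rw [map_add, e1, e2, map_smul, map_smul, Complex.coe_smul]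
    simp
  have hc : conj v = (v.re : ℂ) - v.im * Complex.I := by
    apply Complex.ext <;> simp
  have hv : v = (v.re : ℂ) + v.im * Complex.I := (Complex.re_add_im v).symm
  rw [h, hc]
  nth_rewrite 3 [hv]
  have hI : Complex.I * Complex.I = -1 := Complex.I_mul_I
  match_scalars
  · ring
  · linear_combination (v.im : ℂ) * hI

theorem fderiv_apply_eq_wirtinger (f : ℂ → V) (z v : ℂ) :
    fderiv ℝ f z v = v • wdz f z + conj v • wdzbar f z :=
  real_linear_apply _ v

/-- The real-linear map `v ↦ v a + v̄ b`, that is, `a dz + b dz̄`. -/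
def wirtingerForm (a b : V) : ℂ →L[ℝ] V :=
  (ContinuousLinearMap.id ℝ ℂ).smulRight a +
    (Complex.conjCLE : ℂ →L[ℝ] ℂ).smulRight b

@[simp] theorem wirtingerForm_apply (a b : V) (v : ℂ) :
    wirtingerForm a b v = v • a + conj v • b := rfl

theorem hasFDerivAt_wirtingerForm {f : ℂ → V} {z : ℂ} {a b : V}
    (h : HasFDerivAt f (wirtingerForm a b) z) : wdz f z = a ∧ wdzbar f z = b := by
  simp only [wdz, wdzbar, h.fderiv, wirtingerForm_apply, one_smul, map_one, Complex.conj_I,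
    smul_add, smul_smul, neg_smul, smul_neg, Complex.I_mul_I]
  constructor <;> match_scalars <;> ring

theorem wdz_clm_comp (L : V →L[ℂ] W) {f : ℂ → V} {z : ℂ} (hf : DifferentiableAt ℝ f z) :
    wdz (fun w => L (f w)) z = L (wdz f z) := by
  have h : fderiv ℝ (fun w => L (f w)) z = (L.restrictScalars ℝ).comp (fderiv ℝ f z) :=
    ((L.restrictScalars ℝ).hasFDerivAt.comp z hf.hasFDerivAt).fderiv
  simp [wdz, h]

theorem wdzbar_clm_comp (L : V →L[ℂ] W) {f : ℂ → V} {z : ℂ} (hf : DifferentiableAt ℝ f z) :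
    wdzbar (fun w => L (f w)) z = L (wdzbar f z) := by
  have h : fderiv ℝ (fun w => L (f w)) z = (L.restrictScalars ℝ).comp (fderiv ℝ f z) :=
    ((L.restrictScalars ℝ).hasFDerivAt.comp z hf.hasFDerivAt).fderiv
  simp [wdzbar, h]

end Wirtinger

end SlSystem

end

noncomputable section

namespace SlSystem

open Set Filter Topology MeasureTheory

/-! ### `C¹` paths and the values of 1-forms along them -/

section Paths

variable {X : Type} [TopologicalSpace X] [ChartedSpace ℂ X]

/-- The curve `p` is `C¹` on `[0, 1]`. -/
def IsC1On (p : ℝ → X) : Prop := ContMDiffOn 𝓘(ℝ, ℝ) 𝓘(ℝ, ℂ) 1 p (Icc 0 1)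

variable {p : ℝ → X} {e : OpenPartialHomeomorph X ℂ} {s : ℝ}

theorem IsC1On.contDiffWithinAt [IsManifold 𝓘(ℂ, ℂ) ω X] (hp : IsC1On p) (he : e ∈ atlas ℂ X)
    (hs : s ∈ Icc (0 : ℝ) 1) (hps : p s ∈ e.source) :
    ContDiffWithinAt ℝ 1 (fun u => e (p u)) (Icc 0 1) s := by
  have := isManifold_real (X := X)
  have : IsManifold 𝓘(ℝ, ℂ) 1 X := IsManifold.of_le (n := ∞) (by exact_mod_cast le_top)
  have h := (contMDiffWithinAt_iff_target_of_mem_maximalAtlas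
    (IsManifold.subset_maximalAtlas (I := 𝓘(ℝ, ℂ)) (n := 1) he) hps).1 (hp s hs)
  exact h.2.contDiffWithinAt

theorem IsC1On.continuousOn (hp : IsC1On p) : ContinuousOn p (Icc 0 1) :=
  ContMDiffOn.continuousOn hp

/-- The velocity of the curve `p` in the chart `e`. -/
def velocity (p : ℝ → X) (e : OpenPartialHomeomorph X ℂ) (s : ℝ) : ℂ :=
  derivWithin (fun u => e (p u)) (Icc 0 1) s

theorem IsC1On.hasDerivWithinAt [IsManifold 𝓘(ℂ, ℂ) ω X] (hp : IsC1On p) (he : e ∈ atlas ℂ X)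
    (hs : s ∈ Icc (0 : ℝ) 1) (hps : p s ∈ e.source) :
    HasDerivWithinAt (fun u => e (p u)) (velocity p e s) (Icc 0 1) s :=
  ((hp.contDiffWithinAt he hs hps).differentiableWithinAt one_ne_zero).hasDerivWithinAt

theorem IsC1On.continuousWithinAt_velocity [IsManifold 𝓘(ℂ, ℂ) ω X] (hp : IsC1On p)
    (he : e ∈ atlas ℂ X) (hs : s ∈ Icc (0 : ℝ) 1) (hps : p s ∈ e.source) :
    ContinuousWithinAt (velocity p e) (Icc 0 1) s := by
  have h := (hp.contDiffWithinAt he hs hps).fderivWithin_right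
    (uniqueDiffOn_Icc zero_lt_one) (m := 0) (by simp) hs
  exact h.continuousWithinAt.clm_apply continuousWithinAt_const

variable {V : Type*} [AddCommGroup V] [Module ℂ V]

/-- The value of the 1-form `P dz + Q dz̄` on the velocity of the curve `p` at time `s`. -/
def pathValue (P Q : X → V) (p : ℝ → X) (s : ℝ) : V :=
  velocity p (chartAt ℂ (p s)) s • P (p s) + conj (velocity p (chartAt ℂ (p s)) s) • Q (p s)

/-- In the definition the chart changes with the time s. Here one chart serves for all times near a
given one, so that continuity and differential equations along the curve can be studied. -/
theorem pathValue_eq_inChart [IsManifold 𝓘(ℂ, ℂ) ω X] (P Q : X → V) (hp : IsC1On p)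
    (he : e ∈ atlas ℂ X) (hs : s ∈ Icc (0 : ℝ) 1) (hps : p s ∈ e.source) :
    pathValue P Q p s = velocity p e s • inChart 1 0 P e (e (p s)) +
      conj (velocity p e s) • inChart 0 1 Q e (e (p s)) := by
  set c := chartAt ℂ (p s) with hc
  have hc' : c ∈ atlas ℂ X := chart_mem_atlas ℂ _
  have hps' : p s ∈ c.source := mem_chart_source ℂ _
  have hd := (differentiableAt_transition he hc' (e.map_source hps)
    (by rwa [e.left_inv hps])).hasDerivAt
  have hcomp : HasDerivWithinAt (fun u => c (p u))
      (deriv (fun w => c (e.symm w)) (e (p s)) * velocity p e s) (Icc 0 1) s := by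
    refine (hd.comp_hasDerivWithinAt s (hp.hasDerivWithinAt he hs hps)).congr_of_eventuallyEq
      ?_ (by simp [e.left_inv hps])
    filter_upwards [(hp.continuousOn s hs).eventually_mem (e.open_source.mem_nhds hps)] with u hu
    simp [e.left_inv hu]
  have hv : velocity p c s = transitionDeriv e (e (p s)) * velocity p e s := by
    rw [velocity, hcomp.derivWithin (uniqueDiffOn_Icc zero_lt_one s hs), transitionDeriv,
      e.left_inv hps]
  rw [pathValue, ← hc, hv, inChart, inChart, e.left_inv hps]
  simp only [zpow_one, zpow_zero, mul_one, one_mul, smul_smul, map_mul]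
  congr 2 <;> ring

end Paths

/-! ### Connections with values in an algebra -/

section Connections

variable {X : Type} [TopologicalSpace X] [ChartedSpace ℂ X]
variable {V : Type*} [NormedAddCommGroup V] [NormedSpace ℂ V]

/-- The 1-form `P dz + Q dz̄` in the chart `e`. -/
def connForm (P Q : X → V) (e : OpenPartialHomeomorph X ℂ) (z : ℂ) : ℂ →L[ℝ] V :=
  wirtingerForm (inChart 1 0 P e z) (inChart 0 1 Q e z)

/-- The 1-form `P dz + Q dz̄` is `C¹`. -/
structure IsC1Form (P Q : X → V) : Prop where
  contDiffOn10 : ∀ e ∈ atlas ℂ X, ContDiffOn ℝ 1 (inChart 1 0 P e) e.target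
  contDiffOn01 : ∀ e ∈ atlas ℂ X, ContDiffOn ℝ 1 (inChart 0 1 Q e) e.target

variable {P Q : X → V} {e : OpenPartialHomeomorph X ℂ}

theorem IsC1Form.contDiffOn_connForm (h : IsC1Form P Q) (he : e ∈ atlas ℂ X) :
    ContDiffOn ℝ 1 (connForm P Q e) e.target := by
  rw [contDiffOn_clm_apply]
  exact fun v => ((h.contDiffOn10 e he).const_smul v).add ((h.contDiffOn01 e he).const_smul (conj v))

theorem pathValue_eq_connForm [IsManifold 𝓘(ℂ, ℂ) ω X] {p : ℝ → X} (hp : IsC1On p) (he : e ∈ atlas ℂ X) {s : ℝ}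
    (hs : s ∈ Icc (0 : ℝ) 1) (hps : p s ∈ e.source) :
    pathValue P Q p s = connForm P Q e (e (p s)) (velocity p e s) :=
  pathValue_eq_inChart P Q hp he hs hps

theorem IsC1Form.continuousOn_pathValue [IsManifold 𝓘(ℂ, ℂ) ω X] (h : IsC1Form P Q) {p : ℝ → X} (hp : IsC1On p) :
    ContinuousOn (pathValue P Q p) (Icc 0 1) := by
  intro s hs
  set e := chartAt ℂ (p s)
  have he : e ∈ atlas ℂ X := chart_mem_atlas ℂ _
  have hps : p s ∈ e.source := mem_chart_source ℂ _
  have h0 : ContinuousWithinAt (fun u => connForm P Q e (e (p u))) (Icc 0 1) s :=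
    ContinuousAt.comp_continuousWithinAt (f := fun u => e (p u))
      ((h.contDiffOn_connForm he).continuousOn.continuousAt
        (e.open_target.mem_nhds (e.map_source hps)))
      (hp.contDiffWithinAt he hs hps).continuousWithinAt
  have h1 : ContinuousWithinAt (fun u => connForm P Q e (e (p u)) (velocity p e u))
      (Icc 0 1) s := h0.clm_apply (hp.continuousWithinAt_velocity he hs hps)
  refine h1.congr_of_eventuallyEq ?_ (pathValue_eq_connForm hp he hs hps)
  filter_upwards [(hp.continuousOn s hs).eventually_mem (e.open_source.mem_nhds hps),
    self_mem_nhdsWithin] with u hu hu'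
  exact pathValue_eq_connForm hp he hu' hu

variable {𝔸 : Type*} [NormedRing 𝔸] [NormedAlgebra ℂ 𝔸]

/-- The connection `d + P dz + Q dz̄` is flat: `∂Q/∂z - ∂P/∂z̄ + [P, Q] = 0`. -/
structure IsFlatConnection (P Q : X → 𝔸) : Prop extends IsC1Form P Q where
  flat : ∀ e ∈ atlas ℂ X, ∀ z ∈ e.target,
    wdz (inChart 0 1 Q e) z - wdzbar (inChart 1 0 P e) z +
      (inChart 1 0 P e z * inChart 0 1 Q e z - inChart 0 1 Q e z * inChart 1 0 P e z) = 0

variable {P Q : X → 𝔸}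

theorem IsFlatConnection.curvature_eq_zero (h : IsFlatConnection P Q) (he : e ∈ atlas ℂ X)
    {z : ℂ} (hz : z ∈ e.target) (u v : ℂ) :
    fderiv ℝ (connForm P Q e) z u v - fderiv ℝ (connForm P Q e) z v u +
      (connForm P Q e z u * connForm P Q e z v - connForm P Q e z v * connForm P Q e z u) = 0 := by
  have hnhds := e.open_target.mem_nhds hz
  have h10 : DifferentiableAt ℝ (inChart 1 0 P e) z :=
    ((h.contDiffOn10 e he).differentiableOn one_ne_zero).differentiableAt hnhds
  have h01 : DifferentiableAt ℝ (inChart 0 1 Q e) z :=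
    ((h.contDiffOn01 e he).differentiableOn one_ne_zero).differentiableAt hnhds
  have hd : DifferentiableAt ℝ (connForm P Q e) z :=
    ((h.contDiffOn_connForm he).differentiableOn one_ne_zero).differentiableAt hnhds
  have key (u v : ℂ) : fderiv ℝ (connForm P Q e) z u v =
      v • fderiv ℝ (inChart 1 0 P e) z u + conj v • fderiv ℝ (inChart 0 1 Q e) z u := by
    have e1 : HasFDerivAt (fun w => connForm P Q e w v)
        ((fderiv ℝ (connForm P Q e) z).flip v) z := by
      simpa using hd.hasFDerivAt.clm_apply (hasFDerivAt_const v z)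
    have e2 : HasFDerivAt (fun w => connForm P Q e w v)
        (v • fderiv ℝ (inChart 1 0 P e) z + conj v • fderiv ℝ (inChart 0 1 Q e) z) z :=
      (h10.hasFDerivAt.const_smul v).add (h01.hasFDerivAt.const_smul (conj v))
    simpa using DFunLike.congr_fun (e1.unique e2) u
  have hfl := h.flat e he z hz
  set p := inChart 1 0 P e z
  set q := inChart 0 1 Q e z
  rw [key, key]
  simp only [fderiv_apply_eq_wirtinger, connForm, wirtingerForm_apply]
  -- The scalar is the value of dz ∧ dz̄ on (u, v): the curvature as a bilinear form is its
  -- coefficient times this 2-form.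
  have : (conj v * u - v * conj u) • (wdz (inChart 0 1 Q e) z - wdzbar (inChart 1 0 P e) z +
      (p * q - q * p)) = 0 := by rw [hfl, smul_zero]
  rw [← this]
  simp only [add_mul, mul_add, smul_mul_smul_comm, smul_add, smul_sub, sub_smul, smul_smul]
  match_scalars <;> ring

/-- A flat connection has a local flat frame near every point. -/
theorem IsFlatConnection.exists_local_frame [CompleteSpace 𝔸] (h : IsFlatConnection P Q) (x : X) :
    ∃ r > 0, Metric.ball (chartAt ℂ x x) r ⊆ (chartAt ℂ x).target ∧
      ∃ g : ℂ → 𝔸, g (chartAt ℂ x x) = 1 ∧ ∀ z ∈ Metric.ball (chartAt ℂ x x) r,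
        IsUnit (g z) ∧ HasFDerivAt g (flatDeriv (connForm P Q (chartAt ℂ x) z) (g z)) z := by
  set e := chartAt ℂ x
  set c := e x
  have he : e ∈ atlas ℂ X := chart_mem_atlas ℂ x
  obtain ⟨r₀, hr₀, hball⟩ := Metric.isOpen_iff.1 e.open_target c (mem_chart_target ℂ x)
  have hmap : ∀ z ∈ Metric.ball (0 : ℂ) r₀, c + z ∈ e.target := fun z hz =>
    hball (by simpa using hz)
  obtain ⟨r, hr, hrr, G, hG0, hG⟩ := exists_flat_frame_zero (Ω := fun z => connForm P Q e (c + z))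
    hr₀ ((h.contDiffOn_connForm he).comp (contDiff_const.add contDiff_id).contDiffOn hmap)
    (fun z hz u v => by
      have := h.curvature_eq_zero he (hmap z hz) u v
      rwa [← fderiv_comp_add_left] at this)
  refine ⟨r, hr, (Metric.ball_subset_ball hrr).trans hball, fun z => G (z - c), by simpa using hG0,
    fun z hz => ?_⟩
  have hz' : z - c ∈ Metric.ball (0 : ℂ) r := by simpa [dist_eq_norm] using hz
  obtain ⟨h1, h2⟩ := hG _ hz'
  refine ⟨h1, ?_⟩
  rw [add_sub_cancel] at h2
  exact h2.comp z ((hasFDerivAt_id z).sub_const c)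

/-- Local flat frames are parallel along `C¹` curves. -/
theorem hasDerivWithinAt_local_frame [IsManifold 𝓘(ℂ, ℂ) ω X] {g : ℂ → 𝔸} (he : e ∈ atlas ℂ X) {p : ℝ → X} (hp : IsC1On p)
    {s : ℝ} (hs : s ∈ Icc (0 : ℝ) 1) (hps : p s ∈ e.source)
    (hg : HasFDerivAt g (flatDeriv (connForm P Q e (e (p s))) (g (e (p s)))) (e (p s))) :
    HasDerivWithinAt (fun u => g (e (p u))) (-(pathValue P Q p s * g (e (p s)))) (Icc 0 1) s := by
  rw [pathValue_eq_connForm hp he hs hps]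
  exact hg.comp_hasDerivWithinAt s (hp.hasDerivWithinAt he hs hps)

theorem frame_eq_local_frame [IsManifold 𝓘(ℂ, ℂ) ω X] [CompleteSpace 𝔸] {g : ℂ → 𝔸} {D : Set ℂ} (he : e ∈ atlas ℂ X)
    (hg : ∀ z ∈ D, IsUnit (g z) ∧ HasFDerivAt g (flatDeriv (connForm P Q e z) (g z)) z)
    {p : ℝ → X} (hp : IsC1On p) {F : ℝ → 𝔸} {a b : ℝ} (hab : Icc a b ⊆ Icc 0 1)
    (hF : ∀ s ∈ Icc a b, HasDerivWithinAt F (-(pathValue P Q p s * F s)) (Icc 0 1) s)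
    (hpab : ∀ s ∈ Icc a b, p s ∈ e.source ∧ e (p s) ∈ D) :
    ∀ s ∈ Icc a b, F s = g (e (p s)) * (Ring.inverse (g (e (p a))) * F a) :=
  frame_eq_mul_const (M := pathValue P Q p) (F := fun u => g (e (p u)))
    (fun s hs => (hg _ (hpab s hs).2).1)
    (fun s hs => (hasDerivWithinAt_local_frame he hp (hab hs) (hpab s hs).1
      (hg _ (hpab s hs).2).2).mono hab)
    (fun s hs => (hF s hs).mono hab)

end Connections

end SlSystem

end

noncomputable section

namespace SlSystem

open Set Filter Topology MeasureTheory

/-! ### Parallel transport of a flat connection along path classes -/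

section Transport

variable {X : Type} [TopologicalSpace X] [ChartedSpace ℂ X]

theorem connForm_change [IsManifold 𝓘(ℂ, ℂ) ω X] {V : Type*} [NormedAddCommGroup V]
    [NormedSpace ℂ V] (P Q : X → V) {e e' : OpenPartialHomeomorph X ℂ} (he : e ∈ atlas ℂ X)
    (he' : e' ∈ atlas ℂ X) {z : ℂ} (hz : z ∈ e.target) (hz' : e.symm z ∈ e'.source) (v : ℂ) :
    connForm P Q e z v =
      connForm P Q e' (e' (e.symm z)) (deriv (fun w => e' (e.symm w)) z * v) := by
  simp only [connForm, wirtingerForm_apply, inChart_change _ _ _ he he' hz hz', smul_smul,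
    map_mul, zpow_one, zpow_zero, mul_one, one_mul]
  congr 2 <;> ring

variable {𝔸 : Type*} [NormedRing 𝔸] [NormedAlgebra ℂ 𝔸] [CompleteSpace 𝔸]

/-- Restricted to a ray from the centre, both functions solve the same transport equation, so their
quotient keeps its value at the centre. -/
theorem inverse_mul_flat_const {Ω : ℂ → ℂ →L[ℝ] 𝔸} {f g : ℂ → 𝔸} {c : ℂ} {r : ℝ}
    (hu : ∀ z ∈ Metric.ball c r, IsUnit (g z))
    (hg : ∀ z ∈ Metric.ball c r, HasFDerivAt g (flatDeriv (Ω z) (g z)) z)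
    (hf : ∀ z ∈ Metric.ball c r, HasFDerivAt f (flatDeriv (Ω z) (f z)) z) :
    ∀ z ∈ Metric.ball c r, Ring.inverse (g z) * f z = Ring.inverse (g c) * f c := by
  intro z hz
  have hmem : ∀ s ∈ Icc (0 : ℝ) 1, c + s • (z - c) ∈ Metric.ball c r := by
    intro s hs
    rw [mem_ball_iff_norm, add_sub_cancel_left, norm_smul, Real.norm_eq_abs, abs_of_nonneg hs.1]
    rw [mem_ball_iff_norm] at hz
    nlinarith [norm_nonneg (z - c), hs.2]
  have hline (s : ℝ) : HasDerivWithinAt (fun s : ℝ => c + s • (z - c)) (z - c) (Icc 0 1) s := by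
    simpa using (((hasDerivAt_id s).smul_const (z - c)).const_add c).hasDerivWithinAt
  have hd {k : ℂ → 𝔸} (hk : ∀ z ∈ Metric.ball c r, HasFDerivAt k (flatDeriv (Ω z) (k z)) z)
      (s : ℝ) (hs : s ∈ Icc (0 : ℝ) 1) : HasDerivWithinAt (fun s : ℝ => k (c + s • (z - c)))
        (-(Ω (c + s • (z - c)) (z - c) * k (c + s • (z - c)))) (Icc 0 1) s :=
    HasFDerivAt.comp_hasDerivWithinAt (f := fun s : ℝ => c + s • (z - c)) s (hk _ (hmem s hs))
      (hline s)
  have := frame_eq_mul_const (F := fun s : ℝ => g (c + s • (z - c)))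
    (F' := fun s : ℝ => f (c + s • (z - c))) (M := fun s => Ω (c + s • (z - c)) (z - c))
    (fun s hs => hu _ (hmem s hs)) (hd hg) (hd hf) 1 (right_mem_Icc.2 zero_le_one)
  simp only [one_smul, add_sub_cancel, zero_smul, add_zero] at this
  rw [this, ← mul_assoc, Ring.inverse_mul_cancel _ (hu z hz), one_mul]

variable {P Q : X → 𝔸}

namespace IsFlatConnection

/-- The radius of the coordinate disc at `x` on which the local frame at `x` is defined. -/
def radius (h : IsFlatConnection P Q) (x : X) : ℝ := (h.exists_local_frame x).choose

theorem radius_pos (h : IsFlatConnection P Q) (x : X) : 0 < h.radius x :=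
  (h.exists_local_frame x).choose_spec.1

theorem ball_subset_target (h : IsFlatConnection P Q) (x : X) :
    Metric.ball (chartAt ℂ x x) (h.radius x) ⊆ (chartAt ℂ x).target :=
  (h.exists_local_frame x).choose_spec.2.1

/-- The coordinate expression of the local flat frame at `x`. -/
def coordFrame (h : IsFlatConnection P Q) (x : X) : ℂ → 𝔸 :=
  (h.exists_local_frame x).choose_spec.2.2.choose

/-- The coordinate disc on which the local frame at `x` is defined. -/
def disc (h : IsFlatConnection P Q) (x : X) : Set X :=
  (chartAt ℂ x).source ∩ chartAt ℂ x ⁻¹' Metric.ball (chartAt ℂ x x) (h.radius x)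

/-- The local flat frame at `x`. -/
def frame (h : IsFlatConnection P Q) (x y : X) : 𝔸 := h.coordFrame x (chartAt ℂ x y)

variable (h : IsFlatConnection P Q)

theorem frame_self (x : X) : h.frame x x = 1 :=
  (h.exists_local_frame x).choose_spec.2.2.choose_spec.1

theorem coordFrame_spec (x : X) {z : ℂ} (hz : z ∈ Metric.ball (chartAt ℂ x x) (h.radius x)) :
    IsUnit (h.coordFrame x z) ∧ HasFDerivAt (h.coordFrame x)
      (flatDeriv (connForm P Q (chartAt ℂ x) z) (h.coordFrame x z)) z :=
  (h.exists_local_frame x).choose_spec.2.2.choose_spec.2 z hz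

theorem isOpen_disc (x : X) : IsOpen (h.disc x) :=
  (chartAt ℂ x).isOpen_inter_preimage Metric.isOpen_ball

theorem mem_disc (x : X) : x ∈ h.disc x :=
  ⟨mem_chart_source ℂ x, Metric.mem_ball_self (h.radius_pos x)⟩

theorem isUnit_frame {x y : X} (hy : y ∈ h.disc x) : IsUnit (h.frame x y) :=
  (h.coordFrame_spec x hy.2).1

variable [IsManifold 𝓘(ℂ, ℂ) ω X]

/-- The quotient of two local flat frames is locally constant. -/
theorem eventually_inverse_frame_mul_frame {i j y : X} (hi : y ∈ h.disc i) (hj : y ∈ h.disc j) :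
    ∀ᶠ w in 𝓝 y, Ring.inverse (h.frame j w) * h.frame i w =
      Ring.inverse (h.frame j y) * h.frame i y := by
  set e := chartAt ℂ i with he_def
  set e' := chartAt ℂ j with he'_def
  have he : e ∈ atlas ℂ X := chart_mem_atlas ℂ i
  have he' : e' ∈ atlas ℂ X := chart_mem_atlas ℂ j
  have hopen : IsOpen (e.target ∩ e.symm ⁻¹' (h.disc i ∩ h.disc j)) :=
    e.symm.isOpen_inter_preimage ((h.isOpen_disc i).inter (h.isOpen_disc j))
  have hey : e y ∈ e.target ∩ e.symm ⁻¹' (h.disc i ∩ h.disc j) :=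
    ⟨e.map_source hi.1, by
      rw [mem_preimage, e.left_inv hi.1]
      exact ⟨hi, hj⟩⟩
  obtain ⟨r, hr, hball⟩ := Metric.isOpen_iff.1 hopen _ hey
  have key := inverse_mul_flat_const (Ω := connForm P Q e) (c := e y) (r := r)
    (f := h.coordFrame i) (g := fun z => h.coordFrame j (e' (e.symm z)))
    (fun z hz => h.isUnit_frame (hball hz).2.2)
    (fun z hz => by
      have h1 := (h.coordFrame_spec j (hball hz).2.2.2).2
      have h2 := (differentiableAt_transition he he' (hball hz).1 (hball hz).2.2.1).hasDerivAt
      refine (h1.comp z (h2.hasFDerivAt.restrictScalars ℝ)).congr_fderiv ?_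
      ext v
      simp [connForm_change P Q he he' (hball hz).1 (hball hz).2.2.1, he'_def,
        mul_comm v])
    (fun z hz => by
      have hz' := (hball hz).2.1.2
      rw [mem_preimage, e.right_inv (hball hz).1] at hz'
      exact (h.coordFrame_spec i hz').2)
  filter_upwards [(e.continuousAt hi.1).eventually_mem (Metric.ball_mem_nhds _ hr),
    e.open_source.mem_nhds hi.1] with w hw hw'
  have := key _ hw
  rw [e.left_inv hw', e.left_inv hi.1] at this
  exact this

end IsFlatConnection

/-- A type with the discrete topology. -/
def DiscreteCopy (α : Type*) := α

instance (α : Type*) : TopologicalSpace (DiscreteCopy α) := ⊥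

instance (α : Type*) : DiscreteTopology (DiscreteCopy α) := ⟨rfl⟩

/-- An element, regarded as a point of the discrete space. -/
def DiscreteCopy.mk {α : Type*} (v : α) : DiscreteCopy α := v

/-- The underlying element of the original type. -/
def DiscreteCopy.val {α : Type*} (v : DiscreteCopy α) : α := v

namespace IsFlatConnection

variable (h : IsFlatConnection P Q)

/-- `Γ` is a flat section along the path `p`. -/
def IsFlatAlong {x y : X} (p : Path x y) (Γ : unitInterval → 𝔸) : Prop :=
  ∀ s, ∀ᶠ u in 𝓝 s, Γ u = h.frame (p s) (p u) * Γ s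

theorem IsFlatAlong.mul_right {x y : X} {p : Path x y} {Γ : unitInterval → 𝔸}
    (hΓ : h.IsFlatAlong p Γ) (v : 𝔸) : h.IsFlatAlong p fun s => Γ s * v := fun s =>
  (hΓ s).mono fun u hu => by simp only [hu, mul_assoc]

variable [IsManifold 𝓘(ℂ, ℂ) ω X]

/-- The covering space of germs of flat sections. -/
def core : FiberBundleCore X X (DiscreteCopy 𝔸) where
  baseSet := h.disc
  isOpen_baseSet := h.isOpen_disc
  indexAt := id
  mem_baseSet_at := h.mem_disc
  coordChange i j y v := .mk (Ring.inverse (h.frame j y) * h.frame i y * v.val)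
  coordChange_self i y hy v := by
    change _ * _ * v.val = v.val
    rw [Ring.inverse_mul_cancel _ (h.isUnit_frame hy), one_mul]
  -- Because the fibre is discrete, v is fixed near (y, v), and continuity amounts to local
  -- constancy of the quotient of the two frames.
  continuousOn_coordChange i j := by
    rintro ⟨y, v⟩ ⟨⟨hi, hj⟩, -⟩
    refine ContinuousAt.continuousWithinAt ?_
    refine (continuousAt_const (y := DiscreteCopy.mk
      (Ring.inverse (h.frame j y) * h.frame i y * v.val))).congr ?_
    rw [nhds_prod_eq, nhds_discrete (DiscreteCopy 𝔸), Filter.prod_pure, Filter.EventuallyEq,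
      Filter.eventually_map]
    filter_upwards [h.eventually_inverse_frame_mul_frame hi hj] with w hw
    rw [hw]
  coordChange_comp i j k y hy v := by
    change _ * _ * (_ * _ * v.val) = _ * _ * v.val
    rw [← mul_assoc, mul_assoc _ (h.frame j y), ← mul_assoc (h.frame j y),
      Ring.mul_inverse_cancel _ (h.isUnit_frame hy.1.2), one_mul]

theorem isCoveringMap_proj : IsCoveringMap h.core.proj :=
  FiberBundle.isCoveringMap (E := h.core.Fiber)

/-- The value of a germ. -/
def value (q : h.core.TotalSpace) : 𝔸 := DiscreteCopy.val q.2

/-- The point of the covering space over `x` with value `v`. -/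
def germ (x : X) (v : 𝔸) : h.core.TotalSpace := ⟨x, v⟩

/-- In the trivialization at the point over which f lies at time s, a map to a discrete fibre is
continuous at s exactly when its fibre coordinate is locally constant. The frame at a point has
value 1 there, so values of germs are the coordinates in their own trivializations. Thus continuous
lifts of a path are the flat sections along it. -/
theorem continuousAt_lift_iff {f : unitInterval → h.core.TotalSpace} {s : unitInterval}
    (hf : ContinuousAt (fun u => (f u).1) s) :
    ContinuousAt f s ↔ ∀ᶠ u in 𝓝 s, h.value (f u) = h.frame (f s).1 (f u).1 * h.value (f s) := by
  rw [FiberBundle.continuousAt_totalSpace, and_iff_right hf, ContinuousAt, nhds_discrete (DiscreteCopy 𝔸),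
    tendsto_pure]
  have hmem : ∀ᶠ u in 𝓝 s, (f u).1 ∈ h.disc (f s).1 :=
    hf.eventually_mem ((h.isOpen_disc _).mem_nhds (h.mem_disc _))
  refine eventually_congr (hmem.mono fun u hu => ?_)
  change Ring.inverse (h.frame (f s).1 (f u).1) * h.frame (f u).1 (f u).1 * h.value (f u) =
    Ring.inverse (h.frame (f s).1 (f s).1) * h.frame (f s).1 (f s).1 * h.value (f s) ↔ _
  simp only [frame_self, mul_one, Ring.inverse_one, one_mul]
  constructor
  · intro h1
    rw [← h1, ← mul_assoc, Ring.mul_inverse_cancel _ (h.isUnit_frame hu), one_mul]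
  · intro h1
    rw [h1, ← mul_assoc, Ring.inverse_mul_cancel _ (h.isUnit_frame hu), one_mul]

theorem liftPath_eq {x y : X} {p : Path x y} {Γ : unitInterval → 𝔸} (hΓ : h.IsFlatAlong p Γ) :
    h.isCoveringMap_proj.liftPath p (h.germ x (Γ 0)) p.source 1 = h.germ y (Γ 1) := by
  have hc : Continuous fun s => h.germ (p s) (Γ s) := by
    refine continuous_iff_continuousAt.2 fun s => ?_
    rw [h.continuousAt_lift_iff p.continuous.continuousAt]
    exact hΓ s
  have := (h.isCoveringMap_proj.eq_liftPath_iff (γ := p) (e := h.germ x (Γ 0)) p.source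
    (Γ := fun s => h.germ (p s) (Γ s))).2 ⟨hc, rfl, by simp⟩
  rw [← congrFun this 1]
  simp

theorem exists_isFlatAlong {x y : X} (p : Path x y) (v : 𝔸) :
    ∃ Γ : unitInterval → 𝔸, h.IsFlatAlong p Γ ∧ Γ 0 = v := by
  set L := h.isCoveringMap_proj.liftPath p (h.germ x v) p.source with hL
  have hp : ∀ s, (L s).1 = p s := fun s =>
    congrFun (h.isCoveringMap_proj.liftPath_lifts p (h.germ x v) p.source) s
  have h0 : L 0 = h.germ x v := h.isCoveringMap_proj.liftPath_zero p (h.germ x v) p.source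
  refine ⟨fun s => h.value (L s), fun s => ?_, ?_⟩
  · have hc : ContinuousAt (fun u => (L u).1) s := by
      simp only [hp]
      exact p.continuous.continuousAt
    have := (h.continuousAt_lift_iff hc).1 L.continuous.continuousAt
    simpa only [hp] using this
  · exact congrArg h.value h0

/-- Parallel transport along a path class. -/
def transport {x y : X} (γ : Path.Homotopic.Quotient x y) : 𝔸 :=
  h.value (h.isCoveringMap_proj.monodromy γ ⟨h.germ x 1, rfl⟩).1

theorem transport_mk {x y : X} {p : Path x y} {Γ : unitInterval → 𝔸} (hΓ : h.IsFlatAlong p Γ)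
    (h0 : Γ 0 = 1) : h.transport (Path.Homotopic.Quotient.mk p) = Γ 1 := by
  have h1 := h.liftPath_eq hΓ
  simp only [h0] at h1
  change h.value (h.isCoveringMap_proj.liftPath p (h.germ x 1) p.source 1) = Γ 1
  rw [h1]
  rfl

/-- The flat equation is linear from the left, so right multiplication by v carries flat sections to
flat sections. The monodromy on a whole fibre is therefore left multiplication by one element. -/
theorem monodromy_eq {x y : X} (γ : Path.Homotopic.Quotient x y) (v : 𝔸) :
    (h.isCoveringMap_proj.monodromy γ ⟨h.germ x v, rfl⟩).1 = h.germ y (h.transport γ * v) := by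
  obtain ⟨p⟩ := γ
  obtain ⟨Γ, hΓ, h0⟩ := h.exists_isFlatAlong p 1
  have h1 := h.liftPath_eq (hΓ.mul_right h v)
  simp only [h0, one_mul] at h1
  change h.isCoveringMap_proj.liftPath p (h.germ x v) p.source 1 = _
  rw [h1]
  exact congrArg (fun w => h.germ y (w * v)) (h.transport_mk hΓ h0).symm

theorem transport_refl (x : X) : h.transport (Path.Homotopic.Quotient.refl x) = 1 := by
  rw [transport, h.isCoveringMap_proj.monodromy_refl]
  rfl

theorem transport_trans {x y z : X} (γ : Path.Homotopic.Quotient x y)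
    (γ' : Path.Homotopic.Quotient y z) :
    h.transport (γ.trans γ') = h.transport γ' * h.transport γ := by
  have h1 := h.monodromy_eq γ 1
  rw [mul_one] at h1
  rw [transport, h.isCoveringMap_proj.monodromy_trans_apply,
    show h.isCoveringMap_proj.monodromy γ ⟨h.germ x 1, rfl⟩ = ⟨h.germ y (h.transport γ), rfl⟩ from
      Subtype.ext h1, h.monodromy_eq γ']
  rfl

/-- Inside the disc at `x`, transport is given by the local flat frame. -/
theorem transport_of_mem_disc {x y : X} (p : Path x y) (hp : ∀ s, p s ∈ h.disc x) :
    h.transport (Path.Homotopic.Quotient.mk p) = h.frame x y := by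
  have := h.transport_mk (p := p) (Γ := fun s => h.frame x (p s)) (fun s => ?_)
    (by simp [frame_self])
  · simpa using this
  · have hev := p.continuous.continuousAt.eventually
      (h.eventually_inverse_frame_mul_frame (hp s) (h.mem_disc (p s)))
    have hmem := p.continuous.continuousAt.eventually_mem
      ((h.isOpen_disc (p s)).mem_nhds (h.mem_disc (p s)))
    filter_upwards [hev, hmem] with u hu hu'
    rw [frame_self, Ring.inverse_one, one_mul] at hu
    rw [← hu, ← mul_assoc, Ring.mul_inverse_cancel _ (h.isUnit_frame hu'), one_mul]

/-- Along `C¹` paths, transport is given by the solution of the parallel transport equation. -/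
theorem transport_eq_of_isFrame {x y : X} {p : Path x y} (hp : IsC1On p.extend) {F : ℝ → 𝔸}
    (hF : IsFrame (pathValue P Q p.extend) F) :
    h.transport (Path.Homotopic.Quotient.mk p) = F 1 := by
  refine h.transport_mk (p := p) (Γ := fun s => F s) (fun s => ?_) hF.1
  have hopen : ∀ᶠ u : ℝ in 𝓝 (s : ℝ), p.extend u ∈ h.disc (p s) := by
    refine p.continuous_extend.continuousAt.eventually_mem ?_
    rw [Path.extend_apply _ s.2]
    exact (h.isOpen_disc _).mem_nhds (h.mem_disc _)
  obtain ⟨δ, hδ, hb⟩ := Metric.eventually_nhds_iff_ball.1 hopen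
  have hδ' : ∀ᶠ u : unitInterval in 𝓝 s, (u : ℝ) ∈ Metric.ball (s : ℝ) δ :=
    continuous_subtype_val.continuousAt.eventually_mem (Metric.ball_mem_nhds _ hδ)
  filter_upwards [hδ'] with u hu
  -- Near time s the curve stays in the disc at `p s`. On the interval between s and u the ODE
  -- solution is then a constant right multiple of the local frame.
  have hsub : uIcc (s : ℝ) u ⊆ Metric.ball (s : ℝ) δ := by
    rw [← segment_eq_uIcc]
    exact (convex_ball _ _).segment_subset (Metric.mem_ball_self hδ) hu
  have hsub' : uIcc (s : ℝ) u ⊆ Icc 0 1 := by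
    rw [← segment_eq_uIcc]
    exact (convex_Icc _ _).segment_subset s.2 u.2
  have key := frame_eq_local_frame (P := P) (Q := Q) (chart_mem_atlas ℂ (p s))
    (fun z hz => h.coordFrame_spec (p s) hz) hp hsub' (fun v hv => hF.2 v (hsub' hv))
    (fun v hv => hb v (hsub hv))
  have hs := key s left_mem_uIcc
  have hu := key u right_mem_uIcc
  rw [Path.extend_apply _ s.2] at hs
  rw [Path.extend_apply _ u.2] at hu
  have h1 : h.coordFrame (p s) (chartAt ℂ (p s) (p s)) = 1 := h.frame_self (p s)
  rw [show p ⟨(s : ℝ), s.2⟩ = p s from rfl, h1, one_mul] at hs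
  rw [show p ⟨(u : ℝ), u.2⟩ = p u from rfl, ← hs] at hu
  exact hu

end IsFlatConnection

/-- `C¹` paths have parallel frames. -/
theorem IsC1Form.exists_isFrame_pathValue [IsManifold 𝓘(ℂ, ℂ) ω X] (h : IsC1Form P Q) {p : ℝ → X}
    (hp : IsC1On p) : ∃ F, IsFrame (pathValue P Q p) F :=
  exists_isFrame (h.continuousOn_pathValue hp)

end Transport

end SlSystem

end

noncomputable section

namespace SlSystem

open Set Filter Topology MeasureTheory

/-! ### Smooth representatives of path classes -/

section SmoothPaths

variable {X : Type} [TopologicalSpace X]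

/-- Paths with the same ends whose images lie in a convex coordinate domain are homotopic. -/
theorem homotopic_of_convex {e : OpenPartialHomeomorph X ℂ} {D : Set ℂ} (hD : Convex ℝ D)
    (hDe : D ⊆ e.target) {x y : X} (p q : Path x y) (hp : ∀ s, p s ∈ e.source ∧ e (p s) ∈ D)
    (hq : ∀ s, q s ∈ e.source ∧ e (q s) ∈ D) : p.Homotopic q := by
  have hc {p : Path x y} (hp : ∀ s, p s ∈ e.source ∧ e (p s) ∈ D) :
      Continuous fun s => e (p s) :=
    e.continuousOn.comp_continuous p.continuous fun s => (hp s).1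
  have hmem (y : unitInterval × unitInterval) :
      (1 - (y.1 : ℝ)) • e (p y.2) + (y.1 : ℝ) • e (q y.2) ∈ D :=
    hD (hp _).2 (hq _).2 (sub_nonneg.2 y.1.2.2) y.1.2.1 (by ring)
  refine ⟨{
    toFun := fun y => e.symm ((1 - (y.1 : ℝ)) • e (p y.2) + (y.1 : ℝ) • e (q y.2))
    continuous_toFun := ?_
    map_zero_left := fun s => by simp [e.left_inv (hp s).1]
    map_one_left := fun s => by simp [e.left_inv (hq s).1]
    prop' := ?_ }⟩
  · refine e.symm.continuousOn.comp_continuous ?_ fun y => hDe (hmem y)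
    have h1 := (hc hp).comp (continuous_snd (X := unitInterval) (Y := unitInterval))
    have h2 := (hc hq).comp (continuous_snd (X := unitInterval) (Y := unitInterval))
    have h3 : Continuous fun y : unitInterval × unitInterval => (y.1 : ℝ) := by fun_prop
    exact ((continuous_const.sub h3).smul h1).add (h3.smul h2)
  · rintro t s (rfl | rfl)
    · have := (hp 0).1
      rw [p.source] at this
      simp only [ContinuousMap.coe_mk, Path.source, Path.coe_toContinuousMap]
      rw [← add_smul, sub_add_cancel, one_smul, e.left_inv this]
    · have := (hp 1).1
      rw [p.target] at this
      simp only [ContinuousMap.coe_mk, Path.target, Path.coe_toContinuousMap]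
      rw [← add_smul, sub_add_cancel, one_smul, e.left_inv this]

variable [ChartedSpace ℂ X]

/-- The path is `C¹` and constant near its end points. -/
structure IsFlatEnded {x y : X} (p : Path x y) : Prop where
  contMDiff : ContMDiff 𝓘(ℝ, ℝ) 𝓘(ℝ, ℂ) 1 p.extend
  eventually_source : ∀ᶠ s in 𝓝 (0 : ℝ), p.extend s = x
  eventually_target : ∀ᶠ s in 𝓝 (1 : ℝ), p.extend s = y

theorem IsFlatEnded.isC1On {x y : X} {p : Path x y} (hp : IsFlatEnded p) : IsC1On p.extend :=
  hp.contMDiff.contMDiffOn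

theorem isFlatEnded_refl (x : X) : IsFlatEnded (Path.refl x) :=
  ⟨contMDiff_const, Eventually.of_forall fun _ => rfl, Eventually.of_forall fun _ => rfl⟩

/-- A concatenation of C¹ paths may have a corner at the junction. Constancy near the ends removes
it, since the concatenation is then locally constant at time 1/2. -/
theorem IsFlatEnded.trans {x y z : X} {p : Path x y} {q : Path y z} (hp : IsFlatEnded p)
    (hq : IsFlatEnded q) : IsFlatEnded (p.trans q) := by
  have hl : ContMDiff 𝓘(ℝ, ℝ) 𝓘(ℝ, ℝ) 1 fun s : ℝ => 2 * s :=
    (contDiff_const.mul contDiff_id).contMDiff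
  have hr : ContMDiff 𝓘(ℝ, ℝ) 𝓘(ℝ, ℝ) 1 fun s : ℝ => 2 * s - 1 :=
    ((contDiff_const.mul contDiff_id).sub contDiff_const).contMDiff
  refine ⟨fun s => ?_, ?_, ?_⟩
  · rcases lt_trichotomy s (1 / 2) with hs | hs | hs
    · refine ((hp.contMDiff.comp hl) s).congr_of_eventuallyEq ?_
      filter_upwards [Iio_mem_nhds hs] with u hu
      exact Path.extend_trans_of_le_half _ _ (le_of_lt hu)
    · refine (contMDiffAt_const (c := y)).congr_of_eventuallyEq ?_
      have h1 : Tendsto (fun u : ℝ => 2 * u) (𝓝 s) (𝓝 1) :=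
        Continuous.tendsto' (by fun_prop) _ _ (by rw [hs]; norm_num)
      have h2 : Tendsto (fun u : ℝ => 2 * u - 1) (𝓝 s) (𝓝 0) :=
        Continuous.tendsto' (by fun_prop) _ _ (by rw [hs]; norm_num)
      filter_upwards [h1.eventually hp.eventually_target, h2.eventually hq.eventually_source]
        with u hu hu'
      rcases le_total u (1 / 2) with h | h
      · rw [Path.extend_trans_of_le_half _ _ h, hu]
      · rw [Path.extend_trans_of_half_le _ _ h, hu']
    · refine ((hq.contMDiff.comp hr) s).congr_of_eventuallyEq ?_
      filter_upwards [Ioi_mem_nhds hs] with u hu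
      exact Path.extend_trans_of_half_le _ _ (le_of_lt hu)
  · have h1 : Tendsto (fun u : ℝ => 2 * u) (𝓝 0) (𝓝 0) :=
      Continuous.tendsto' (by fun_prop) _ _ (by norm_num)
    filter_upwards [h1.eventually hp.eventually_source,
      Iio_mem_nhds (show (0 : ℝ) < 1 / 2 by norm_num)] with u hu h
    rw [Path.extend_trans_of_le_half _ _ (le_of_lt h), hu]
  · have h1 : Tendsto (fun u : ℝ => 2 * u - 1) (𝓝 1) (𝓝 1) :=
      Continuous.tendsto' (by fun_prop) _ _ (by norm_num)
    filter_upwards [h1.eventually hq.eventually_target,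
      Ioi_mem_nhds (show (1 / 2 : ℝ) < 1 by norm_num)] with u hu h
    rw [Path.extend_trans_of_half_le _ _ (le_of_lt h), hu]

theorem exists_isFlatEnded_of_convex [IsManifold 𝓘(ℂ, ℂ) ω X] {e : OpenPartialHomeomorph X ℂ}
    (he : e ∈ atlas ℂ X) {D : Set ℂ} (hD : Convex ℝ D) (hDe : D ⊆ e.target) {x y : X}
    (hx : x ∈ e.source) (hxD : e x ∈ D) (hy : y ∈ e.source) (hyD : e y ∈ D) :
    ∃ p : Path x y, IsFlatEnded p ∧ ∀ s, p s ∈ e.source ∧ e (p s) ∈ D := by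
  have : IsManifold 𝓘(ℝ, ℂ) ∞ X := isManifold_real
  have : IsManifold 𝓘(ℝ, ℂ) 1 X := IsManifold.of_le (n := ∞) (by simp)
  -- The reparametrization is 0 up to 1/3 and 1 from 2/3 on, so the segment is traversed smoothly
  -- with rest at both ends.
  set κ : ℝ → ℝ := fun s => Real.smoothTransition (3 * s - 1) with hκ
  have hκd : ContDiff ℝ 1 κ :=
    Real.smoothTransition.contDiff.comp ((contDiff_const.mul contDiff_id).sub contDiff_const)
  set f : ℝ → ℂ := fun s => (1 - κ s) • e x + κ s • e y with hf
  have hfD (s : ℝ) : f s ∈ D :=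
    hD hxD hyD (sub_nonneg.2 (Real.smoothTransition.le_one _)) (Real.smoothTransition.nonneg _)
      (by ring)
  have hfd : ContDiff ℝ 1 f :=
    ((contDiff_const.sub hκd).smul contDiff_const).add (hκd.smul contDiff_const)
  have hsm : ContMDiff 𝓘(ℝ, ℝ) 𝓘(ℝ, ℂ) 1 fun s => e.symm (f s) :=
    (contMDiffOn_symm_of_mem_maximalAtlas (IsManifold.subset_maximalAtlas he)).comp_contMDiff
      hfd.contMDiff fun s => hDe (hfD s)
  have h0 {s : ℝ} (hs : s ≤ 1 / 3) : e.symm (f s) = x := by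
    have : κ s = 0 := Real.smoothTransition.zero_of_nonpos (by linarith)
    simp [hf, this, e.left_inv hx]
  have h1 {s : ℝ} (hs : 2 / 3 ≤ s) : e.symm (f s) = y := by
    have : κ s = 1 := Real.smoothTransition.one_of_one_le (by linarith)
    simp [hf, this, e.left_inv hy]
  let p : Path x y :=
    { toFun := fun s => e.symm (f s)
      continuous_toFun := hsm.continuous.comp continuous_subtype_val
      source' := h0 (by norm_num)
      target' := h1 (by norm_num) }
  have hp : p.extend = fun s => e.symm (f s) := by
    funext s
    rcases le_total s 0 with hs | hs
    · rw [Path.extend_of_le_zero _ hs, h0 (by linarith)]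
    rcases le_total s 1 with hs' | hs'
    · rw [Path.extend_apply _ ⟨hs, hs'⟩]
      rfl
    · rw [Path.extend_of_one_le _ hs', h1 (by linarith)]
  refine ⟨p, ⟨hp ▸ hsm, ?_, ?_⟩, fun s => ⟨e.map_target (hDe (hfD s)), ?_⟩⟩
  · rw [hp]
    filter_upwards [Iio_mem_nhds (show (0 : ℝ) < 1 / 3 by norm_num)] with s hs
    exact h0 (le_of_lt hs)
  · rw [hp]
    filter_upwards [Ioi_mem_nhds (show (2 / 3 : ℝ) < 1 by norm_num)] with s hs
    exact h1 (le_of_lt hs)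
  · change e (e.symm (f s)) ∈ D
    rw [e.right_inv (hDe (hfD s))]
    exact hfD s

/-- Every path is homotopic to a `C¹` path that is constant near its end points. -/
theorem exists_isFlatEnded_homotopic [IsManifold 𝓘(ℂ, ℂ) ω X] {x y : X} (p : Path x y) :
    ∃ q : Path x y, IsFlatEnded q ∧ p.Homotopic q := by
  have hball (z : X) : ∃ r > 0, Metric.ball (chartAt ℂ z z) r ⊆ (chartAt ℂ z).target :=
    Metric.isOpen_iff.1 (chartAt ℂ z).open_target _ (mem_chart_target ℂ z)
  choose r hr hrt using hball
  let U : X → Set X := fun z =>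
    (chartAt ℂ z).source ∩ chartAt ℂ z ⁻¹' Metric.ball (chartAt ℂ z z) (r z)
  have hU (z : X) : IsOpen (U z) :=
    (chartAt ℂ z).isOpen_inter_preimage Metric.isOpen_ball
  -- A subdivision whose pieces lie in convex coordinate discs: each piece is homotopic there to a
  -- reparametrized segment, and the segments are concatenated.
  obtain ⟨t, ht0, htm, ⟨m, hm⟩, ht⟩ :=
    exists_monotone_Icc_subset_open_cover_unitInterval (c := fun z => p ⁻¹' U z)
      (fun z => (hU z).preimage p.continuous) (fun s _ => mem_iUnion.2 ⟨p s,
        mem_chart_source ℂ _, Metric.mem_ball_self (hr _)⟩)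
  have key (n : ℕ) : ∃ q : Path (p (t 0)) (p (t n)), IsFlatEnded q ∧
      (p.subpath (t 0) (t n)).Homotopic q := by
    induction n with
    | zero => exact ⟨_, isFlatEnded_refl _, by rw [Path.subpath_self]⟩
    | succ n ih =>
      obtain ⟨q, hq, hpq⟩ := ih
      obtain ⟨z, hz⟩ := ht n
      have hle := htm n.le_succ
      have hsub (s) : p.subpath (t n) (t (n + 1)) s ∈ U z := by
        have : p.subpath (t n) (t (n + 1)) s ∈ p '' Icc (t n) (t (n + 1)) := by
          rw [← Path.range_subpath_of_le _ _ _ hle]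
          exact mem_range_self s
        obtain ⟨u, hu, h⟩ := this
        rw [← h]
        exact hz hu
      have h0 : p (t n) ∈ U z := hz (left_mem_Icc.2 hle)
      have h1 : p (t (n + 1)) ∈ U z := hz (right_mem_Icc.2 hle)
      obtain ⟨q', hq', hq'U⟩ := exists_isFlatEnded_of_convex (chart_mem_atlas ℂ z)
        (convex_ball _ _) (hrt z) h0.1 h0.2 h1.1 h1.2
      refine ⟨q.trans q', hq.trans hq', ?_⟩
      exact (Path.Homotopic.symm ⟨Path.Homotopy.subpathTransSubpath p (t 0) (t n) (t (n + 1))⟩).trans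
        (hpq.hcomp (homotopic_of_convex (convex_ball _ _) (hrt z) _ _ hsub hq'U))
  have key' : ∃ q : Path (p 0) (p 1), IsFlatEnded q ∧ (p.subpath 0 1).Homotopic q := by
    have := key m
    rwa [ht0, hm m le_rfl] at this
  obtain ⟨q, hq, hpq⟩ := key'
  rw [Path.subpath_zero_one] at hpq
  refine ⟨q.cast p.source.symm p.target.symm, ⟨?_, ?_, ?_⟩, ?_⟩
  · rw [Path.extend_cast]
    exact hq.contMDiff
  · rw [Path.extend_cast]
    simpa using hq.eventually_source
  · rw [Path.extend_cast]
    simpa using hq.eventually_target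
  · obtain ⟨H⟩ := hpq
    exact ⟨H.cast (by ext; rfl) (by ext; rfl)⟩

theorem exists_isFlatEnded_mk [IsManifold 𝓘(ℂ, ℂ) ω X] {x y : X}
    (γ : Path.Homotopic.Quotient x y) :
    ∃ q : Path x y, IsFlatEnded q ∧ Path.Homotopic.Quotient.mk q = γ := by
  induction γ using Quotient.inductionOn with
  | h p =>
    obtain ⟨q, hq, h⟩ := exists_isFlatEnded_homotopic p
    exact ⟨q, hq, Quotient.sound h.symm⟩

theorem pathConnectedSpace_of_charted [ConnectedSpace X] : PathConnectedSpace X := by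
  have : LocallyPathConnectedSpace X := ChartedSpace.locallyPathConnectedSpace ℂ X
  exact pathConnectedSpace_iff_connectedSpace.2 inferInstance

end SmoothPaths

end SlSystem

end

noncomputable section

namespace SlSystem

open Set Filter Topology MeasureTheory

/-! ### Integration of continuous `(1,1)`-tensors -/

section Integration

/-- Extension by zero is smooth because h already vanishes outside a compact subset of U, whose
complement is a neighbourhood of every point outside U. -/
theorem contDiff_indicator {V : Type*} [NormedAddCommGroup V] [NormedSpace ℝ V] {n : WithTop ℕ∞}
    {U K : Set ℂ} {h : ℂ → V} (hU : IsOpen U) (hK : IsCompact K) (hKU : K ⊆ U)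
    (hh : ContDiffOn ℝ n h U) (h0 : ∀ z ∈ U \ K, h z = 0) : ContDiff ℝ n (U.indicator h) := by
  rw [contDiff_iff_contDiffAt]
  intro z
  by_cases hz : z ∈ U
  · refine (hh.contDiffAt (hU.mem_nhds hz)).congr_of_eventuallyEq ?_
    filter_upwards [hU.mem_nhds hz] with w hw using indicator_of_mem hw h
  · have : ∀ᶠ w in 𝓝 z, U.indicator h w = 0 := by
      filter_upwards [hK.isClosed.isOpen_compl.mem_nhds fun hzK => hz (hKU hzK)] with w hw
      by_cases hwU : w ∈ U
      · rw [indicator_of_mem hwU, h0 w ⟨hwU, hw⟩]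
      · exact indicator_of_notMem hwU h
    exact contDiffAt_const.congr_of_eventuallyEq this

theorem hasCompactSupport_indicator {V : Type*} [NormedAddCommGroup V]
    {U K : Set ℂ} {h : ℂ → V} (hK : IsCompact K) (h0 : ∀ z ∈ U \ K, h z = 0) :
    HasCompactSupport (U.indicator h) := by
  refine HasCompactSupport.intro hK fun z hz => ?_
  by_cases hzU : z ∈ U
  · rw [indicator_of_mem hzU, h0 z ⟨hzU, hz⟩]
  · exact indicator_of_notMem hzU h

variable {X : Type} [TopologicalSpace X]

theorem isCompact_image_tsupport [CompactSpace X] {V : Type*} [Zero V] {e : OpenPartialHomeomorph X ℂ} {g : X → V}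
    (hs : tsupport g ⊆ e.source) : IsCompact (e '' tsupport g) :=
  (isClosed_tsupport g).isCompact.image_of_continuousOn (e.continuousOn.mono hs)

theorem image_tsupport_subset {V : Type*} [Zero V] {e : OpenPartialHomeomorph X ℂ} {g : X → V}
    (hs : tsupport g ⊆ e.source) : e '' tsupport g ⊆ e.target := by
  rintro _ ⟨x, hx, rfl⟩
  exact e.map_source (hs hx)

theorem symm_notMem_tsupport {V : Type*} [Zero V] {e : OpenPartialHomeomorph X ℂ} {g : X → V}
    {z : ℂ} (hz : z ∈ e.target \ e '' tsupport g) : g (e.symm z) = 0 := by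
  by_contra h
  exact hz.2 ⟨e.symm z, subset_tsupport g h, e.right_inv hz.1⟩

theorem tsupport_mul_subset_left' (τ f : X → ℂ) : tsupport (fun x => τ x * f x) ⊆ tsupport τ :=
  tsupport_mul_subset_left

variable [ChartedSpace ℂ X]

/-- The tensor of type `(p, q)` encoded by `f` is continuous. -/
def IsContTensor {V : Type*} [NormedAddCommGroup V] [NormedSpace ℂ V] (p q : ℤ) (f : X → V) :
    Prop := ∀ e ∈ atlas ℂ X, ContinuousOn (inChart p q f e) e.target

theorem inChart_smul_left {V : Type*} [AddCommGroup V] [Module ℂ V] (p q : ℤ) (τ : X → ℂ)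
    (f : X → V) (e : OpenPartialHomeomorph X ℂ) (z : ℂ) :
    inChart p q (fun x => τ x • f x) e z = τ (e.symm z) • inChart p q f e z := by
  rw [inChart, inChart, smul_comm]

theorem inChart_mul_left (p q : ℤ) (τ f : X → ℂ) (e : OpenPartialHomeomorph X ℂ) (z : ℂ) :
    inChart p q (fun x => τ x * f x) e z = τ (e.symm z) * inChart p q f e z :=
  inChart_smul_left p q τ f e z

theorem IsContTensor.smul_left {V : Type*} [NormedAddCommGroup V] [NormedSpace ℂ V] {p q : ℤ}
    {f : X → V} (hf : IsContTensor p q f) {τ : X → ℂ} (hτ : Continuous τ) :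
    IsContTensor p q fun x => τ x • f x := fun e he =>
  ((hτ.comp_continuousOn e.symm.continuousOn).smul (hf e he)).congr
    fun z _ => inChart_smul_left p q τ f e z

theorem IsContTensor.add {V : Type*} [NormedAddCommGroup V] [NormedSpace ℂ V] {p q : ℤ}
    {f g : X → V} (hf : IsContTensor p q f) (hg : IsContTensor p q g) :
    IsContTensor p q fun x => f x + g x := fun e he =>
  ((hf e he).add (hg e he)).congr fun z _ => by simp [inChart]

theorem IsContTensor.sub {V : Type*} [NormedAddCommGroup V] [NormedSpace ℂ V] {p q : ℤ}
    {f g : X → V} (hf : IsContTensor p q f) (hg : IsContTensor p q g) :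
    IsContTensor p q fun x => f x - g x := fun e he =>
  ((hf e he).sub (hg e he)).congr fun z _ => by simp [inChart, smul_sub]

theorem IsContTensor.mul [IsManifold 𝓘(ℂ, ℂ) ω X] {p q p' q' r s : ℤ} {f g : X → ℂ}
    (hf : IsContTensor p q f) (hg : IsContTensor p' q' g) (hr : p + p' = r) (hs : q + q' = s) :
    IsContTensor r s fun x => f x * g x := fun e he => by
  subst hr hs
  exact ((hf e he).mul (hg e he)).congr fun _ hz => inChart_mul he hz p q p' q' f g

theorem IsContTensor.sum {p q : ℤ} {ι : Type*} (s : Finset ι) {f : ι → X → ℂ}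
    (hf : ∀ i ∈ s, IsContTensor p q (f i)) : IsContTensor p q fun x => ∑ i ∈ s, f i x := fun e he =>
  (continuousOn_finsetSum s fun i hi => hf i hi e he).congr
    fun z _ => by simp [inChart, Finset.mul_sum]

/-- The integral of the coefficient of the `(1,1)`-tensor `g` over the target of the chart `e`. -/
def chartIntegral (e : OpenPartialHomeomorph X ℂ) (g : X → ℂ) : ℂ :=
  ∫ z in e.target, inChart 1 1 g e z

theorem inChart_eq_zero {V : Type*} [AddCommGroup V] [Module ℂ V] {p q : ℤ} {f : X → V}
    {e : OpenPartialHomeomorph X ℂ} {z : ℂ} (h : f (e.symm z) = 0) : inChart p q f e z = 0 := by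
  rw [inChart, h, smul_zero]

/-- The real Jacobian of a holomorphic transition map is |φ'|², the factor by which the coefficient
of a (1,1)-tensor changes. The hypothesis on g confines both integrals to the overlap of the charts.
-/
theorem chartIntegral_change [IsManifold 𝓘(ℂ, ℂ) ω X] {e e' : OpenPartialHomeomorph X ℂ}
    (he : e ∈ atlas ℂ X) (he' : e' ∈ atlas ℂ X) {g : X → ℂ}
    (hg : ∀ x, g x ≠ 0 → x ∈ e.source ∧ x ∈ e'.source) :
    chartIntegral e g = chartIntegral e' g := by
  set W : Set ℂ := e.target ∩ e.symm ⁻¹' e'.source with hW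
  have hWo : IsOpen W := e.isOpen_inter_preimage_symm e'.open_source
  set φ : ℂ → ℂ := fun w => e' (e.symm w) with hφ
  have himg : φ '' W = e'.target ∩ e'.symm ⁻¹' e.source := by
    ext w
    constructor
    · rintro ⟨z, hz, rfl⟩
      exact ⟨e'.map_source hz.2, by
        rw [mem_preimage, hφ, e'.left_inv hz.2]
        exact e.map_target hz.1⟩
    · rintro ⟨hw, hw'⟩
      refine ⟨e (e'.symm w), ⟨e.map_source hw', ?_⟩, ?_⟩
      · rw [mem_preimage, e.left_inv hw']
        exact e'.map_target hw
      · simp only [hφ]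
        rw [e.left_inv hw', e'.right_inv hw]
  have hinj : InjOn φ W := by
    intro z hz w hw h
    have := e'.injOn hz.2 hw.2 h
    rw [← e.right_inv hz.1, ← e.right_inv hw.1, this]
  have hd : ∀ z ∈ W, HasFDerivWithinAt φ
      (((1 : ℂ →L[ℂ] ℂ).smulRight (deriv φ z)).restrictScalars ℝ) W z := fun z hz =>
    ((differentiableAt_transition he he' hz.1 hz.2).hasDerivAt.hasFDerivAt.restrictScalars
      ℝ).hasFDerivWithinAt
  have h1 : chartIntegral e g = ∫ z in W, inChart 1 1 g e z := by
    refine setIntegral_eq_of_subset_of_forall_sdiff_eq_zero e.open_target.measurableSet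
      inter_subset_left fun z hz => inChart_eq_zero ?_
    by_contra h
    exact hz.2 ⟨hz.1, (hg _ h).2⟩
  have h2 : chartIntegral e' g = ∫ z in φ '' W, inChart 1 1 g e' z := by
    rw [himg]
    refine setIntegral_eq_of_subset_of_forall_sdiff_eq_zero e'.open_target.measurableSet
      inter_subset_left fun z hz => inChart_eq_zero ?_
    by_contra h
    exact hz.2 ⟨hz.1, (hg _ h).1⟩
  rw [h1, h2, integral_image_eq_integral_abs_det_fderiv_smul _ hWo.measurableSet hd hinj]
  refine setIntegral_congr_fun hWo.measurableSet fun z hz => ?_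
  have hdet : (((1 : ℂ →L[ℂ] ℂ).smulRight (deriv φ z)).restrictScalars ℝ).det =
      Complex.normSq (deriv φ z) := by
    rw [ContinuousLinearMap.det, ContinuousLinearMap.coe_restrictScalars,
      LinearMap.det_restrictScalars]
    rw [Algebra.norm_complex_apply]
    simp
  rw [hdet, inChart_change 1 1 g he he' hz.1 hz.2, abs_of_nonneg (Complex.normSq_nonneg _),
    zpow_one, zpow_one, Complex.mul_conj, Complex.real_smul, smul_eq_mul]


theorem integrableOn_inChart [CompactSpace X] {e : OpenPartialHomeomorph X ℂ} {g : X → ℂ}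
    (hg : ContinuousOn (inChart 1 1 g e) e.target) (hs : tsupport g ⊆ e.source) :
    IntegrableOn (inChart 1 1 g e) e.target := by
  have h0 : ∀ z ∈ e.target \ e '' tsupport g, inChart 1 1 g e z = 0 := fun z hz =>
    inChart_eq_zero (symm_notMem_tsupport hz)
  rw [← integrable_indicator_iff e.open_target.measurableSet]
  refine Continuous.integrable_of_hasCompactSupport ?_
    (hasCompactSupport_indicator (isCompact_image_tsupport hs) h0)
  exact (contDiff_indicator (n := 0) e.open_target (isCompact_image_tsupport hs)
    (image_tsupport_subset hs) (contDiffOn_zero.2 hg) h0).continuous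

variable [CompactSpace X] [T2Space X]

variable (X) in
/-- The partition of unity used to define `surfaceIntegral`. -/
def cutoff (y x : X) : ℂ := (((exists_partition X).choose y x : ℝ) : ℂ)

variable (X) in
theorem finite_cutoff : {y : X | (Function.support ((exists_partition X).choose y)).Nonempty}.Finite :=
  (exists_partition X).choose.locallyFinite.finite_nonempty_of_compact

variable (X) in
/-- The charts that contribute to `surfaceIntegral`. -/
def cutoffIndex : Finset X := (finite_cutoff X).toFinset

theorem cutoff_eq_zero {y : X} (hy : y ∉ cutoffIndex X) (x : X) : cutoff X y x = 0 := by
  by_contra h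
  exact hy ((finite_cutoff X).mem_toFinset.2 ⟨x, fun h' => h (by simp [cutoff, h'])⟩)

theorem continuous_cutoff (y : X) : Continuous (cutoff X y) :=
  Complex.continuous_ofReal.comp ((exists_partition X).choose y).continuous

theorem tsupport_cutoff (y : X) : tsupport (cutoff X y) ⊆ (chartAt ℂ y).source := by
  refine Subset.trans (closure_mono fun x hx => ?_) ((exists_partition X).choose_spec y)
  intro h
  exact hx (by simp [cutoff, h])

theorem sum_cutoff (x : X) : ∑ y ∈ cutoffIndex X, cutoff X y x = 1 := by
  have h := (exists_partition X).choose.sum_eq_one (mem_univ x)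
  rw [finsum_eq_sum_of_support_subset (s := cutoffIndex X)] at h
  · simp only [cutoff]
    exact_mod_cast h
  · intro y hy
    by_contra h'
    have := cutoff_eq_zero h' x
    exact hy (by simpa [cutoff] using this)

theorem surfaceIntegral_eq_sum (f : X → ℂ) : surfaceIntegral f =
    ∑ y ∈ cutoffIndex X, 2 * Complex.I * chartIntegral (chartAt ℂ y)
      (fun x => cutoff X y x * f x) := by
  rw [surfaceIntegral, finsum_eq_sum_of_support_subset (s := cutoffIndex X)]
  · refine Finset.sum_congr rfl fun y _ => ?_
    simp only [chartIntegral, inChart_mul_left]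
    rfl
  · intro y hy
    by_contra h'
    refine hy ?_
    have (z : ℂ) : (((exists_partition X).choose y ((chartAt ℂ y).symm z) : ℝ) : ℂ) = 0 :=
      cutoff_eq_zero h' _
    simp [this]

theorem integrableOn_cutoff_mul {f : X → ℂ} (hf : IsContTensor 1 1 f) (y : X) :
    IntegrableOn (inChart 1 1 (fun x => cutoff X y x * f x) (chartAt ℂ y)) (chartAt ℂ y).target :=
  integrableOn_inChart (hf.smul_left (continuous_cutoff y) _ (chart_mem_atlas ℂ y))
    ((tsupport_mul_subset_left' _ _).trans (tsupport_cutoff y))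

theorem surfaceIntegral_add {f g : X → ℂ} (hf : IsContTensor 1 1 f) (hg : IsContTensor 1 1 g) :
    surfaceIntegral (fun x => f x + g x) = surfaceIntegral f + surfaceIntegral g := by
  simp only [surfaceIntegral_eq_sum, ← Finset.sum_add_distrib, ← mul_add]
  refine Finset.sum_congr rfl fun y _ => ?_
  rw [chartIntegral, chartIntegral, chartIntegral,
    ← integral_add (integrableOn_cutoff_mul hf y) (integrableOn_cutoff_mul hg y)]
  congr 2
  funext z
  simp only [inChart, smul_eq_mul]
  ring

theorem surfaceIntegral_const_mul (c : ℂ) (f : X → ℂ) :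
    surfaceIntegral (fun x => c * f x) = c * surfaceIntegral f := by
  simp only [surfaceIntegral_eq_sum, Finset.mul_sum]
  refine Finset.sum_congr rfl fun y _ => ?_
  rw [mul_left_comm c, chartIntegral, chartIntegral, ← integral_const_mul c]
  congr 2
  funext z
  simp only [inChart, smul_eq_mul]
  ring

theorem surfaceIntegral_neg (f : X → ℂ) :
    surfaceIntegral (fun x => -f x) = -surfaceIntegral f := by
  simpa using surfaceIntegral_const_mul (-1) f

theorem surfaceIntegral_sub {f g : X → ℂ} (hf : IsContTensor 1 1 f) (hg : IsContTensor 1 1 g) :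
    surfaceIntegral (fun x => f x - g x) = surfaceIntegral f - surfaceIntegral g := by
  have hg' : IsContTensor 1 1 fun x => -g x := fun e he =>
    (hg e he).neg.congr fun z _ => by simp [inChart]
  simpa only [sub_eq_add_neg, surfaceIntegral_neg] using surfaceIntegral_add hf hg'

theorem surfaceIntegral_zero : surfaceIntegral (fun _ : X => (0 : ℂ)) = 0 := by
  simpa using surfaceIntegral_const_mul (X := X) 0 0

theorem surfaceIntegral_sum {ι : Type*} (s : Finset ι) {f : ι → X → ℂ}
    (hf : ∀ i ∈ s, IsContTensor 1 1 (f i)) :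
    surfaceIntegral (fun x => ∑ i ∈ s, f i x) = ∑ i ∈ s, surfaceIntegral (f i) := by
  classical
  induction s using Finset.induction_on with
  | empty => simpa using surfaceIntegral_zero
  | insert i s hi ih =>
    have hs : ∀ j ∈ s, IsContTensor 1 1 (f j) := fun j hj => hf j (Finset.mem_insert_of_mem hj)
    simp only [Finset.sum_insert hi]
    rw [surfaceIntegral_add (hf i (Finset.mem_insert_self i s)) (IsContTensor.sum s hs), ih hs]

/-- The integral of a tensor supported in the domain of a chart is computed in that chart. -/
theorem surfaceIntegral_eq_chartIntegral [IsManifold 𝓘(ℂ, ℂ) ω X]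
    {e : OpenPartialHomeomorph X ℂ} (he : e ∈ atlas ℂ X) {g : X → ℂ} (hg : IsContTensor 1 1 g)
    (hs : tsupport g ⊆ e.source) :
    surfaceIntegral g = 2 * Complex.I * chartIntegral e g := by
  -- Each term of the partition is supported in both chart domains and can be moved to the chart e,
  -- where the cutoffs sum to 1.
  have h1 (y : X) : chartIntegral (chartAt ℂ y) (fun x => cutoff X y x * g x) =
      chartIntegral e fun x => cutoff X y x * g x :=
    chartIntegral_change (chart_mem_atlas ℂ y) he fun x hx =>
      ⟨tsupport_cutoff y (subset_tsupport _ (left_ne_zero_of_mul hx)),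
        hs (subset_tsupport _ (right_ne_zero_of_mul hx))⟩
  rw [surfaceIntegral_eq_sum, ← Finset.mul_sum]
  simp only [h1]
  congr 1
  simp only [chartIntegral]
  rw [← integral_finsetSum]
  · congr 1
    funext z
    simp only [inChart_mul_left, ← Finset.sum_mul, sum_cutoff, one_mul]
  · exact fun y _ => integrableOn_inChart (hg.smul_left (continuous_cutoff y) e he)
      ((tsupport_mul_subset_right (f := cutoff X y) (g := g)).trans hs)

/-- A nonnegative continuous `(1,1)`-tensor whose integral vanishes is zero. -/
theorem eq_zero_of_surfaceIntegral_eq_zero [IsManifold 𝓘(ℂ, ℂ) ω X] {g : X → ℝ}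
    (hg : ∀ x, 0 ≤ g x) (hc : IsContTensor 1 1 fun x => (g x : ℂ))
    (h0 : surfaceIntegral (fun x => (g x : ℂ)) = 0) (x : X) : g x = 0 := by
  set ψ : X → ℂ → ℝ := fun y z => (exists_partition X).choose y ((chartAt ℂ y).symm z) *
    (Complex.normSq (transitionDeriv (chartAt ℂ y) z) * g ((chartAt ℂ y).symm z)) with hψ
  have hψc (y : X) (z : ℂ) :
      inChart 1 1 (fun x => cutoff X y x * (g x : ℂ)) (chartAt ℂ y) z = (ψ y z : ℂ) := by
    simp only [inChart, zpow_one, Complex.mul_conj, cutoff, smul_eq_mul, hψ]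
    push_cast
    ring
  have hψ0 (y : X) (z : ℂ) : 0 ≤ ψ y z :=
    mul_nonneg ((exists_partition X).choose.nonneg y _)
      (mul_nonneg (Complex.normSq_nonneg _) (hg _))
  have hint (y : X) : chartIntegral (chartAt ℂ y) (fun x => cutoff X y x * (g x : ℂ)) =
      ((∫ z in (chartAt ℂ y).target, ψ y z : ℝ) : ℂ) := by
    rw [chartIntegral, ← integral_complex_ofReal]
    simp only [hψc]
  -- The common factor 2i is cancelled, leaving real nonnegative summands. Each is zero, and a
  -- continuous nonnegative compactly supported density with zero integral vanishes pointwise.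
  have hsum : ∑ y ∈ cutoffIndex X, ∫ z in (chartAt ℂ y).target, ψ y z = 0 := by
    rw [surfaceIntegral_eq_sum, ← Finset.mul_sum] at h0
    simp only [hint] at h0
    have := (mul_eq_zero.1 h0).resolve_left (by simp)
    exact_mod_cast this
  have hzero : ∀ y ∈ cutoffIndex X, ∫ z in (chartAt ℂ y).target, ψ y z = 0 :=
    (Finset.sum_eq_zero_iff_of_nonneg fun y _ => integral_nonneg (hψ0 y)).1 hsum
  have hpt : ∀ y ∈ cutoffIndex X, ∀ z ∈ (chartAt ℂ y).target, ψ y z = 0 := by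
    intro y hy z hz
    by_contra hne
    have hs := (tsupport_mul_subset_left' (cutoff X y) fun x => (g x : ℂ)).trans (tsupport_cutoff y)
    have hK0 : ∀ z ∈ (chartAt ℂ y).target \
        chartAt ℂ y '' tsupport (fun x => cutoff X y x * (g x : ℂ)), ψ y z = 0 := fun z hz => by
      have := inChart_eq_zero (p := 1) (q := 1) (symm_notMem_tsupport hz)
      rw [hψc] at this
      exact_mod_cast this
    have hcont : ContinuousOn (ψ y) (chartAt ℂ y).target := by
      have := Complex.continuous_re.comp_continuousOn
        (hc.smul_left (continuous_cutoff y) _ (chart_mem_atlas ℂ y))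
      refine this.congr fun z _ => ?_
      change ψ y z = (inChart 1 1 (fun x => cutoff X y x * (g x : ℂ)) (chartAt ℂ y) z).re
      rw [hψc, Complex.ofReal_re]
    have hcd := (contDiff_indicator (n := 0) (chartAt ℂ y).open_target (isCompact_image_tsupport hs)
      (image_tsupport_subset hs) (contDiffOn_zero.2 hcont) hK0).continuous
    have := hcd.integral_pos_of_hasCompactSupport_nonneg_nonzero (μ := volume) (x := z)
      (hasCompactSupport_indicator (isCompact_image_tsupport hs) hK0)
      (fun w => indicator_nonneg (fun w _ => hψ0 y w) w)
      (by rwa [indicator_of_mem hz])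
    rw [integral_indicator (chartAt ℂ y).open_target.measurableSet, hzero y hy] at this
    exact lt_irrefl _ this
  have hx : ∀ y ∈ cutoffIndex X, cutoff X y x * (g x : ℂ) = 0 := by
    intro y hy
    by_cases hxy : cutoff X y x = 0
    · rw [hxy, zero_mul]
    have hxs := tsupport_cutoff y (subset_tsupport _ hxy)
    have hz := (chartAt ℂ y).map_source hxs
    have := hψc y (chartAt ℂ y x)
    rw [hpt y hy _ hz, inChart, (chartAt ℂ y).left_inv hxs, Complex.ofReal_zero, smul_eq_mul] at this
    -- The scaling factor |du/dz|² of the coefficient is nonzero, so vanishing in the chart means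
    -- vanishing of the tensor.
    have hne := transitionDeriv_ne_zero (chart_mem_atlas ℂ y) hz
    refine (mul_eq_zero.1 this).resolve_left ?_
    simpa using hne
  have := sum_cutoff x
  have h2 : (g x : ℂ) = 0 := by
    rw [← one_mul (g x : ℂ), ← sum_cutoff x, Finset.sum_mul]
    exact Finset.sum_eq_zero hx
  exact_mod_cast h2

end Integration

end SlSystem

end

noncomputable section

namespace SlSystem

open Set Filter Topology MeasureTheory

/-! ### Rules for Wirtinger derivatives -/

section WirtingerRules

variable {V : Type*} [NormedAddCommGroup V] [NormedSpace ℂ V] {f g : ℂ → V} {z : ℂ}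

theorem wdz_congr (h : f =ᶠ[𝓝 z] g) : wdz f z = wdz g z := by
  rw [wdz, wdz, h.fderiv_eq]

theorem wdzbar_congr (h : f =ᶠ[𝓝 z] g) : wdzbar f z = wdzbar g z := by
  rw [wdzbar, wdzbar, h.fderiv_eq]

theorem wdz_const (c : V) : wdz (fun _ => c) z = 0 := by
  simp [wdz]

theorem wdzbar_const (c : V) : wdzbar (fun _ => c) z = 0 := by
  simp [wdzbar]

theorem wdz_add (hf : DifferentiableAt ℝ f z) (hg : DifferentiableAt ℝ g z) :
    wdz (fun w => f w + g w) z = wdz f z + wdz g z := by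
  rw [wdz, wdz, wdz, fderiv_fun_add hf hg]
  simp only [add_apply]
  module

theorem wdzbar_add (hf : DifferentiableAt ℝ f z) (hg : DifferentiableAt ℝ g z) :
    wdzbar (fun w => f w + g w) z = wdzbar f z + wdzbar g z := by
  rw [wdzbar, wdzbar, wdzbar, fderiv_fun_add hf hg]
  simp only [add_apply]
  module

theorem wdz_sum {ι : Type*} (s : Finset ι) {f : ι → ℂ → V}
    (hf : ∀ i ∈ s, DifferentiableAt ℝ (f i) z) :
    wdz (fun w => ∑ i ∈ s, f i w) z = ∑ i ∈ s, wdz (f i) z := by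
  simp only [wdz, fderiv_fun_sum hf, FunLike.coe_sum, Finset.sum_apply,
    Finset.smul_sum, ← Finset.sum_sub_distrib]

theorem wdzbar_sum {ι : Type*} (s : Finset ι) {f : ι → ℂ → V}
    (hf : ∀ i ∈ s, DifferentiableAt ℝ (f i) z) :
    wdzbar (fun w => ∑ i ∈ s, f i w) z = ∑ i ∈ s, wdzbar (f i) z := by
  simp only [wdzbar, fderiv_fun_sum hf, FunLike.coe_sum, Finset.sum_apply,
    Finset.smul_sum, ← Finset.sum_add_distrib]

theorem wdz_mul {R : Type*} [NormedRing R] [NormedAlgebra ℂ R] {f g : ℂ → R}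
    (hf : DifferentiableAt ℝ f z) (hg : DifferentiableAt ℝ g z) :
    wdz (fun w => f w * g w) z = wdz f z * g z + f z * wdz g z := by
  rw [wdz, wdz, wdz, fderiv_fun_mul' hf hg]
  simp only [add_apply, smul_apply, smul_eq_mul, MulOpposite.smul_eq_mul_unop,
    MulOpposite.unop_op, smul_add, smul_sub, sub_mul, mul_sub, smul_mul_assoc, mul_smul_comm]
  abel

theorem wdzbar_mul {R : Type*} [NormedRing R] [NormedAlgebra ℂ R] {f g : ℂ → R}
    (hf : DifferentiableAt ℝ f z) (hg : DifferentiableAt ℝ g z) :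
    wdzbar (fun w => f w * g w) z = wdzbar f z * g z + f z * wdzbar g z := by
  rw [wdzbar, wdzbar, wdzbar, fderiv_fun_mul' hf hg]
  simp only [add_apply, smul_apply, smul_eq_mul, MulOpposite.smul_eq_mul_unop,
    MulOpposite.unop_op, smul_add, add_mul, mul_add, smul_mul_assoc, mul_smul_comm]
  abel

theorem wdz_comp_holomorphic {φ : ℂ → ℂ} (hφ : DifferentiableAt ℂ φ z)
    (hf : DifferentiableAt ℝ f (φ z)) :
    wdz (fun w => f (φ w)) z = deriv φ z • wdz f (φ z) ∧
      wdzbar (fun w => f (φ w)) z = conj (deriv φ z) • wdzbar f (φ z) := by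
  apply hasFDerivAt_wirtingerForm
  have h := hf.hasFDerivAt.comp z (hφ.hasDerivAt.hasFDerivAt.restrictScalars ℝ)
  refine h.congr_fderiv ?_
  ext v
  change fderiv ℝ f (φ z) (v • deriv φ z) = _
  rw [fderiv_apply_eq_wirtinger, wirtingerForm_apply]
  simp only [smul_smul, smul_eq_mul, map_mul]

theorem wdzbar_eq_zero_of_holomorphic (hf : DifferentiableAt ℂ f z) : wdzbar f z = 0 := by
  have h := hf.hasFDerivAt.restrictScalars ℝ
  rw [wdzbar, h.fderiv]
  have : (fderiv ℂ f z) Complex.I = Complex.I • (fderiv ℂ f z) 1 := by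
    rw [← map_smul, smul_eq_mul, mul_one]
  simp only [ContinuousLinearMap.coe_restrictScalars', this, smul_smul, Complex.I_mul_I]
  module

theorem continuousOn_wdz {U : Set ℂ} (hU : IsOpen U) (hf : ContDiffOn ℝ 1 f U) :
    ContinuousOn (wdz f) U := by
  have h := hf.continuousOn_fderiv_of_isOpen hU le_rfl
  exact ((h.clm_apply continuousOn_const).sub
    ((h.clm_apply continuousOn_const).const_smul _)).const_smul _

theorem continuousOn_wdzbar {U : Set ℂ} (hU : IsOpen U) (hf : ContDiffOn ℝ 1 f U) :
    ContinuousOn (wdzbar f) U := by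
  have h := hf.continuousOn_fderiv_of_isOpen hU le_rfl
  exact ((h.clm_apply continuousOn_const).add
    ((h.clm_apply continuousOn_const).const_smul _)).const_smul _

theorem integral_fderiv_apply_eq_zero {f : ℂ → ℂ} (hf : ContDiff ℝ 1 f) (hs : HasCompactSupport f)
    (v : ℂ) : ∫ z, fderiv ℝ f z v = 0 := by
  have hi : Integrable f := hf.continuous.integrable_of_hasCompactSupport hs
  have hi' : Integrable fun z => fderiv ℝ f z v :=
    ((hf.continuous_fderiv one_ne_zero).clm_apply
      continuous_const).integrable_of_hasCompactSupport (hs.fderiv_apply (𝕜 := ℝ) v)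
  -- Integration by parts against the constant function 1.
  have := integral_mul_fderiv_eq_neg_fderiv_mul_of_integrable (μ := volume) (𝕜 := ℂ)
    (f := fun _ => 1) (g := f) (v := v) (by simp) (by simpa using hi') (by simpa using hi)
    (fun _ _ => differentiableAt_const _)
    (fun _ _ => (hf.differentiable one_ne_zero).differentiableAt)
  simpa using this

theorem integrable_fderiv_apply {f : ℂ → ℂ} (hf : ContDiff ℝ 1 f) (hs : HasCompactSupport f)
    (v : ℂ) : Integrable fun z => fderiv ℝ f z v :=
  ((hf.continuous_fderiv one_ne_zero).clm_apply
    continuous_const).integrable_of_hasCompactSupport (hs.fderiv_apply (𝕜 := ℝ) v)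

theorem integral_wdz_sub_wdzbar_eq_zero {f g : ℂ → ℂ} (hf : ContDiff ℝ 1 f)
    (hfs : HasCompactSupport f) (hg : ContDiff ℝ 1 g) (hgs : HasCompactSupport g) :
    ∫ z, (wdz f z - wdzbar g z) = 0 := by
  have i1 (v : ℂ) := integrable_fderiv_apply hf hfs v
  have i2 (v : ℂ) := integrable_fderiv_apply hg hgs v
  have j1 : Integrable (wdz f) := ((i1 1).sub ((i1 Complex.I).const_mul Complex.I)).const_mul _
  have j2 : Integrable (wdzbar g) := ((i2 1).add ((i2 Complex.I).const_mul Complex.I)).const_mul _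
  rw [integral_sub j1 j2]
  simp only [wdz, wdzbar, smul_eq_mul]
  rw [integral_const_mul, integral_const_mul, integral_sub (i1 1) ((i1 Complex.I).const_mul _),
    integral_add (i2 1) ((i2 Complex.I).const_mul _), integral_const_mul, integral_const_mul]
  simp only [integral_fderiv_apply_eq_zero hf hfs, integral_fderiv_apply_eq_zero hg hgs]
  ring

end WirtingerRules

/-! ### Stokes' theorem -/

section Stokes

variable {X : Type} [TopologicalSpace X] [ChartedSpace ℂ X]

/-- The function `T` is `C¹`. -/
def IsC1Fun {V : Type*} [NormedAddCommGroup V] [NormedSpace ℂ V] (T : X → V) : Prop :=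
  ∀ e ∈ atlas ℂ X, ContDiffOn ℝ 1 (fun w => T (e.symm w)) e.target

/-- The `(1,0)`-part of the differential of a function. -/
def del {V : Type*} [NormedAddCommGroup V] [NormedSpace ℂ V] (T : X → V) (x : X) : V :=
  wdz (fun w => T ((chartAt ℂ x).symm w)) (chartAt ℂ x x)

/-- The `(0,1)`-part of the differential of a function. -/
def delbar {V : Type*} [NormedAddCommGroup V] [NormedSpace ℂ V] (T : X → V) (x : X) : V :=
  wdzbar (fun w => T ((chartAt ℂ x).symm w)) (chartAt ℂ x x)

variable {V : Type*} [NormedAddCommGroup V] [NormedSpace ℂ V] {T : X → V}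
  {e : OpenPartialHomeomorph X ℂ} {z : ℂ}

theorem IsC1Fun.differentiableAt (hT : IsC1Fun T) (he : e ∈ atlas ℂ X) (hz : z ∈ e.target) :
    DifferentiableAt ℝ (fun w => T (e.symm w)) z :=
  ((hT e he).differentiableOn one_ne_zero).differentiableAt (e.open_target.mem_nhds hz)

theorem IsC1Fun.continuous (hT : IsC1Fun T) : Continuous T := by
  rw [continuous_iff_continuousAt]
  intro x
  have h := (hT _ (chart_mem_atlas ℂ x)).continuousOn.continuousAt
    ((chartAt ℂ x).open_target.mem_nhds (mem_chart_target ℂ x))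
  have h2 : ContinuousAt (fun y => T ((chartAt ℂ x).symm (chartAt ℂ x y))) x :=
    ContinuousAt.comp (f := chartAt ℂ x) (g := fun w => T ((chartAt ℂ x).symm w)) h
      ((chartAt ℂ x).continuousAt (mem_chart_source ℂ x))
  refine h2.congr ?_
  filter_upwards [(chartAt ℂ x).open_source.mem_nhds (mem_chart_source ℂ x)] with y hy
  rw [(chartAt ℂ x).left_inv hy]

/-- Both are defined only in the preferred chart at each point. The chain rule with a holomorphic
transition map keeps ∂ and ∂̄ apart, so they are tensors of types (1,0) and (0,1). -/
theorem inChart_del_delbar [IsManifold 𝓘(ℂ, ℂ) ω X] (hT : IsC1Fun T) (he : e ∈ atlas ℂ X)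
    (hz : z ∈ e.target) :
    inChart 1 0 (del T) e z = wdz (fun w => T (e.symm w)) z ∧
      inChart 0 1 (delbar T) e z = wdzbar (fun w => T (e.symm w)) z := by
  set e' := chartAt ℂ (e.symm z) with he'
  have hm : e.symm z ∈ e'.source := mem_chart_source ℂ _
  have h1 := differentiableAt_transition he (chart_mem_atlas ℂ (e.symm z)) hz hm
  have h2 := hT.differentiableAt (chart_mem_atlas ℂ (e.symm z)) (e'.map_source hm)
  have hev : (fun w => T (e.symm w)) =ᶠ[𝓝 z] fun w => T (e'.symm (e' (e.symm w))) := by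
    filter_upwards [eventually_transition hz hm] with w hw
    rw [e'.left_inv hw.2]
  obtain ⟨h3, h4⟩ := wdz_comp_holomorphic (φ := fun w => e' (e.symm w)) h1 h2
  rw [wdz_congr hev, wdzbar_congr hev, h3, h4]
  constructor <;> simp [inChart, transitionDeriv, del, delbar, he']

theorem inChart_del [IsManifold 𝓘(ℂ, ℂ) ω X] (hT : IsC1Fun T) (he : e ∈ atlas ℂ X)
    (hz : z ∈ e.target) : inChart 1 0 (del T) e z = wdz (fun w => T (e.symm w)) z :=
  (inChart_del_delbar hT he hz).1

theorem inChart_delbar [IsManifold 𝓘(ℂ, ℂ) ω X] (hT : IsC1Fun T) (he : e ∈ atlas ℂ X)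
    (hz : z ∈ e.target) : inChart 0 1 (delbar T) e z = wdzbar (fun w => T (e.symm w)) z :=
  (inChart_del_delbar hT he hz).2

theorem isContTensor_del [IsManifold 𝓘(ℂ, ℂ) ω X] (hT : IsC1Fun T) : IsContTensor 1 0 (del T) :=
  fun e he => (continuousOn_wdz e.open_target (hT e he)).congr fun _ hz => inChart_del hT he hz

theorem isContTensor_delbar [IsManifold 𝓘(ℂ, ℂ) ω X] (hT : IsC1Fun T) :
    IsContTensor 0 1 (delbar T) := fun e he =>
  (continuousOn_wdzbar e.open_target (hT e he)).congr fun _ hz => inChart_delbar hT he hz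

theorem del_eq_zero_of_notMem_tsupport {x : X} (hx : x ∉ tsupport T) :
    del T x = 0 ∧ delbar T x = 0 := by
  have : (fun w => T ((chartAt ℂ x).symm w)) =ᶠ[𝓝 (chartAt ℂ x x)] fun _ => 0 := by
    have h1 := (chartAt ℂ x).continuousAt_symm (mem_chart_target ℂ x)
    rw [ContinuousAt, (chartAt ℂ x).left_inv (mem_chart_source ℂ x)] at h1
    filter_upwards [h1.eventually_mem ((isClosed_tsupport T).isOpen_compl.mem_nhds hx)] with w hw
    exact image_eq_zero_of_notMem_tsupport hw
  exact ⟨(wdz_congr this).trans (wdz_const 0), (wdzbar_congr this).trans (wdzbar_const 0)⟩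

theorem isContTensor_exterior {a b f : X → ℂ} (h : IsC1Form a b)
    (hf : ∀ e ∈ atlas ℂ X, ∀ z ∈ e.target,
      inChart 1 1 f e z = dz (inChart 0 1 b e) z - dzbar (inChart 1 0 a e) z) :
    IsContTensor 1 1 f := fun e he => by
  have h1 := continuousOn_wdz e.open_target (h.contDiffOn01 e he)
  have h2 := continuousOn_wdzbar e.open_target (h.contDiffOn10 e he)
  rw [wdz_eq_dz] at h1
  rw [wdzbar_eq_dzbar] at h2
  exact (h1.sub h2).congr fun z hz => hf e he z hz

theorem IsC1Form.isContTensor10 {a b : X → ℂ} (h : IsC1Form a b) : IsContTensor 1 0 a :=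
  fun e he => (h.contDiffOn10 e he).continuousOn

theorem IsC1Form.isContTensor01 {a b : X → ℂ} (h : IsC1Form a b) : IsContTensor 0 1 b :=
  fun e he => (h.contDiffOn01 e he).continuousOn

variable [IsManifold 𝓘(ℂ, ℂ) ω X]

theorem isC1Fun_of_contMDiff {τ : X → ℝ} (hτ : ContMDiff 𝓘(ℝ, ℂ) 𝓘(ℝ, ℝ) ∞ τ) :
    IsC1Fun fun x => (τ x : ℂ) := fun e he => by
  have : IsManifold 𝓘(ℝ, ℂ) ∞ X := isManifold_real
  have h : ContDiffOn ℝ ∞ (fun w => τ (e.symm w)) e.target :=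
    contMDiffOn_iff_contDiffOn.1 (hτ.comp_contMDiffOn
      (contMDiffOn_symm_of_mem_maximalAtlas (IsManifold.subset_maximalAtlas he)))
  exact Complex.ofRealCLM.contDiff.comp_contDiffOn (h.of_le (by simp))

theorem isContTensor_exterior_mul {a b f τ : X → ℂ} (h : IsC1Form a b) (hf : IsContTensor 1 1 f)
    (hτ : IsC1Fun τ) :
    IsContTensor 1 1 fun x => τ x * f x + (del τ x * b x - delbar τ x * a x) :=
  (hf.smul_left hτ.continuous).add
    (((isContTensor_del hτ).mul h.isContTensor01 (by norm_num) (by norm_num)).sub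
      ((isContTensor_delbar hτ).mul h.isContTensor10 (by norm_num) (by norm_num)))

variable [CompactSpace X] [T2Space X]

/-- Stokes' theorem for `τ (a dz + b dz̄)`, where `τ` is supported in a chart domain. -/
theorem surfaceIntegral_exterior_mul_eq_zero {a b f τ : X → ℂ} (h : IsC1Form a b)
    (hf : ∀ e ∈ atlas ℂ X, ∀ z ∈ e.target,
      inChart 1 1 f e z = dz (inChart 0 1 b e) z - dzbar (inChart 1 0 a e) z)
    (hτ : IsC1Fun τ) (he : e ∈ atlas ℂ X) (hs : tsupport τ ⊆ e.source) :
    surfaceIntegral (fun x => τ x * f x + (del τ x * b x - delbar τ x * a x)) = 0 := by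
  set g : X → ℂ := fun x => τ x * f x + (del τ x * b x - delbar τ x * a x) with hg
  -- The integrand is the exterior coefficient of τ(a dz + b dz̄), supported where τ is. The
  -- statement thus becomes one about compactly supported functions on the plane.
  have hgs : tsupport g ⊆ tsupport τ := by
    refine closure_minimal (fun x hx => ?_) (isClosed_tsupport τ)
    by_contra hx'
    obtain ⟨h1, h2⟩ := del_eq_zero_of_notMem_tsupport hx'
    exact hx (by simp [hg, h1, h2, image_eq_zero_of_notMem_tsupport hx'])
  rw [surfaceIntegral_eq_chartIntegral he
    (isContTensor_exterior_mul h (isContTensor_exterior h hf) hτ) (hgs.trans hs)]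
  have hK := isCompact_image_tsupport hs
  have hKe := image_tsupport_subset hs
  have hK0 (k : ℂ → ℂ) : ∀ z ∈ e.target \ e '' tsupport τ, τ (e.symm z) * k z = 0 := fun z hz => by
    rw [symm_notMem_tsupport hz, zero_mul]
  have hcd {k : ℂ → ℂ} (hk : ContDiffOn ℝ 1 k e.target) :=
    contDiff_indicator e.open_target hK hKe ((hτ e he).mul hk) (hK0 k)
  have hcs (k : ℂ → ℂ) := hasCompactSupport_indicator hK (hK0 k)
  have hmain := integral_wdz_sub_wdzbar_eq_zero (hcd (h.contDiffOn01 e he))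
    (hcs (inChart 0 1 b e)) (hcd (h.contDiffOn10 e he)) (hcs (inChart 1 0 a e))
  rw [chartIntegral, mul_eq_zero]
  right
  rw [← hmain, ← integral_indicator e.open_target.measurableSet]
  congr 1
  funext z
  by_cases hz : z ∈ e.target
  · have hev (k : ℂ → ℂ) : e.target.indicator k =ᶠ[𝓝 z] k := by
      filter_upwards [e.open_target.mem_nhds hz] with w hw using indicator_of_mem hw k
    have hd {k : ℂ → ℂ} (hk : ContDiffOn ℝ 1 k e.target) : DifferentiableAt ℝ k z :=
      (hk.differentiableOn one_ne_zero).differentiableAt (e.open_target.mem_nhds hz)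
    have e1 : inChart 1 1 (fun x => del τ x * b x) e z = _ := inChart_mul he hz 1 0 0 1 (del τ) b
    have e2 : inChart 1 1 (fun x => delbar τ x * a x) e z = _ :=
      inChart_mul he hz 0 1 1 0 (delbar τ) a
    have e3 : inChart 1 1 g e z = inChart 1 1 (fun x => τ x * f x) e z +
        (inChart 1 1 (fun x => del τ x * b x) e z -
          inChart 1 1 (fun x => delbar τ x * a x) e z) := by
      simp only [inChart, hg, smul_eq_mul]
      ring
    rw [indicator_of_mem hz, wdz_congr (hev _), wdzbar_congr (hev _),
      wdz_mul (hd (hτ e he)) (hd (h.contDiffOn01 e he)),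
      wdzbar_mul (hd (hτ e he)) (hd (h.contDiffOn10 e he)), e3, e1, e2, inChart_mul_left, hf e he z hz,
      inChart_del hτ he hz, inChart_delbar hτ he hz]
    simp only [wdz_eq_dz, wdzbar_eq_dzbar]
    ring
  · have hev (k : ℂ → ℂ) : e.target.indicator (fun z => τ (e.symm z) * k z) =ᶠ[𝓝 z]
        fun _ => 0 := by
      filter_upwards [hK.isClosed.isOpen_compl.mem_nhds fun hzK => hz (hKe hzK)] with w hw
      by_cases hwU : w ∈ e.target
      · rw [indicator_of_mem hwU, hK0 k w ⟨hwU, hw⟩]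
      · exact indicator_of_notMem hwU _
    rw [indicator_of_notMem hz, wdz_congr (hev _), wdzbar_congr (hev _), wdz_const, wdzbar_const,
      sub_zero]

/-- Stokes' theorem on a closed Riemann surface: if `f dz ∧ dz̄` is the exterior derivative of
`a dz + b dz̄`, then its integral is zero. -/
theorem surfaceIntegral_exterior_eq_zero {a b f : X → ℂ} (h : IsC1Form a b)
    (hf : ∀ e ∈ atlas ℂ X, ∀ z ∈ e.target,
      inChart 1 1 f e z = dz (inChart 0 1 b e) z - dzbar (inChart 1 0 a e) z) :
    surfaceIntegral f = 0 := by
  have : IsManifold 𝓘(ℝ, ℂ) ∞ X := isManifold_real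
  -- The partition in the definition of the integral is merely continuous, whereas here the cutoffs
  -- must be differentiated.
  obtain ⟨τ, hτ⟩ := SmoothPartitionOfUnity.exists_isSubordinate 𝓘(ℝ, ℂ) (isClosed_univ (X := X))
    (fun x => (chartAt ℂ x).source) (fun x => (chartAt ℂ x).open_source)
    (fun x _ => mem_iUnion.2 ⟨x, mem_chart_source ℂ x⟩)
  set S := τ.locallyFinite.finite_nonempty_of_compact.toFinset with hS
  have hsum (x : X) : ∑ y ∈ S, (τ y x : ℂ) = 1 := by
    have h := τ.sum_eq_one (mem_univ x)
    rw [finsum_eq_sum_of_support_subset (s := S)] at h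
    · exact_mod_cast h
    · intro y hy
      exact (Finite.mem_toFinset _).2 ⟨x, hy⟩
  have hC (y : X) : IsC1Fun fun x => (τ y x : ℂ) := isC1Fun_of_contMDiff (τ y).contMDiff
  have hts (y : X) : tsupport (fun x => (τ y x : ℂ)) ⊆ (chartAt ℂ y).source := by
    refine Subset.trans (closure_mono fun x hx => ?_) (hτ y)
    intro h
    exact hx (by simp [h])
  have hdel (x : X) : ∑ y ∈ S, del (fun x => (τ y x : ℂ)) x = 0 := by
    simp only [del]
    rw [← wdz_sum S fun y _ => (hC y).differentiableAt (chart_mem_atlas ℂ x) (mem_chart_target ℂ x)]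
    simp only [hsum]
    exact wdz_const 1
  have hdelbar (x : X) : ∑ y ∈ S, delbar (fun x => (τ y x : ℂ)) x = 0 := by
    simp only [delbar]
    rw [← wdzbar_sum S fun y _ =>
      (hC y).differentiableAt (chart_mem_atlas ℂ x) (mem_chart_target ℂ x)]
    simp only [hsum]
    exact wdzbar_const 1
  -- The differentials of the cutoffs sum to the differential of 1, so the correction terms cancel
  -- and f is a sum of localized exact terms.
  have hfeq : f = fun x => ∑ y ∈ S, ((τ y x : ℂ) * f x +
      (del (fun x => (τ y x : ℂ)) x * b x - delbar (fun x => (τ y x : ℂ)) x * a x)) := by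
    funext x
    rw [Finset.sum_add_distrib, Finset.sum_sub_distrib, ← Finset.sum_mul, ← Finset.sum_mul,
      ← Finset.sum_mul, hsum, hdel, hdelbar]
    ring
  rw [hfeq, surfaceIntegral_sum S fun y _ =>
    isContTensor_exterior_mul h (isContTensor_exterior h hf) (hC y)]
  exact Finset.sum_eq_zero fun y _ =>
    surfaceIntegral_exterior_mul_eq_zero h hf (hC y) (chart_mem_atlas ℂ y) (hts y)

end Stokes

end SlSystem

end

noncomputable section

namespace SlSystem

open Set Filter Topology MeasureTheory

/-! ### Matrix-valued functions -/

/-- The operator norm on `2 × 2` matrices. -/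
@[reducible] def matNormedRing : NormedRing Mat2 := Matrix.linftyOpNormedRing

attribute [local instance] matNormedRing

/-- `2 × 2` matrices as a normed algebra. -/
@[reducible] def matNormedAlgebra : NormedAlgebra ℂ Mat2 := Matrix.linftyOpNormedAlgebra

attribute [local instance] matNormedAlgebra

/-- The topology of the operator norm. -/
@[reducible] def matTopology : TopologicalSpace Mat2 := PseudoMetricSpace.toUniformSpace.toTopologicalSpace

attribute [local instance] matTopology

/-- The uniform structure of the operator norm. -/
@[reducible] def matUniformity : UniformSpace Mat2 := PseudoMetricSpace.toUniformSpace

attribute [local instance] matUniformity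

section MatrixCalculus

/-- A matrix as the family of its entries. -/
def matCLE : Mat2 ≃L[ℂ] (Fin 2 → Fin 2 → ℂ) :=
  (Matrix.ofLinearEquiv ℂ).symm.toContinuousLinearEquiv

/-- An entry of a matrix. -/
def entryCLM (i j : Fin 2) : Mat2 →L[ℂ] ℂ :=
  ((ContinuousLinearMap.proj j).comp (ContinuousLinearMap.proj (R := ℂ)
    (φ := fun _ : Fin 2 => Fin 2 → ℂ) i)).comp (matCLE : Mat2 →L[ℂ] (Fin 2 → Fin 2 → ℂ))

@[simp] theorem entryCLM_apply (i j : Fin 2) (M : Mat2) : entryCLM i j M = M i j := rfl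

/-- The trace of a matrix. -/
def traceCLM : Mat2 →L[ℂ] ℂ := entryCLM 0 0 + entryCLM 1 1

@[simp] theorem traceCLM_apply (M : Mat2) : traceCLM M = M.trace := by
  simp [traceCLM, Matrix.trace_fin_two]

theorem hasDerivWithinAt_mat_iff {F : ℝ → Mat2} {F' : Mat2} {S : Set ℝ} {s : ℝ} :
    HasDerivWithinAt F F' S s ↔ ∀ i j, HasDerivWithinAt (fun u => F u i j) (F' i j) S s := by
  constructor
  · intro h i j
    exact ((entryCLM i j).restrictScalars ℝ).hasFDerivAt.comp_hasDerivWithinAt s h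
  · intro h
    have h' : HasDerivWithinAt (fun u => matCLE (F u)) (matCLE F') S s :=
      hasDerivWithinAt_pi.2 fun i => hasDerivWithinAt_pi.2 fun j => h i j
    exact (((matCLE.symm : (Fin 2 → Fin 2 → ℂ) →L[ℂ] Mat2).restrictScalars
      ℝ).hasFDerivAt.comp_hasDerivWithinAt s h').congr_deriv (by simp)

theorem hasDerivAt_mat_iff {F : ℝ → Mat2} {F' : Mat2} {s : ℝ} :
    HasDerivAt F F' s ↔ ∀ i j, HasDerivAt (fun u => F u i j) (F' i j) s := by
  simp only [← hasDerivWithinAt_univ]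
  exact hasDerivWithinAt_mat_iff (F := F) (F' := F') (S := univ) (s := s)

theorem contDiffOn_mat_iff {E : Type*} [NormedAddCommGroup E] [NormedSpace ℝ E] {F : E → Mat2}
    {S : Set E} {n : WithTop ℕ∞} :
    ContDiffOn ℝ n F S ↔ ∀ i j, ContDiffOn ℝ n (fun u => F u i j) S := by
  constructor
  · intro h i j
    exact ((entryCLM i j).restrictScalars ℝ).contDiff.comp_contDiffOn h
  · intro h
    have h' : ContDiffOn ℝ n (fun u => matCLE (F u)) S :=
      contDiffOn_pi.2 fun i => contDiffOn_pi.2 fun j => h i j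
    exact (((matCLE.symm : (Fin 2 → Fin 2 → ℂ) →L[ℂ] Mat2).restrictScalars
      ℝ).contDiff.comp_contDiffOn h').congr fun u _ => by simp

theorem wdz_entry {f : ℂ → Mat2} {z : ℂ} (hf : DifferentiableAt ℝ f z) (i j : Fin 2) :
    wdz f z i j = dz (fun w => f w i j) z := by
  rw [← wdz_eq_dz]
  exact (wdz_clm_comp (entryCLM i j) hf).symm

theorem wdzbar_entry {f : ℂ → Mat2} {z : ℂ} (hf : DifferentiableAt ℝ f z) (i j : Fin 2) :
    wdzbar f z i j = dzbar (fun w => f w i j) z := by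
  rw [← wdzbar_eq_dzbar]
  exact (wdzbar_clm_comp (entryCLM i j) hf).symm

theorem Ring_inverse_eq_inv (M : Mat2) : Ring.inverse M = M⁻¹ :=
  (Matrix.nonsing_inv_eq_ringInverse M).symm

end MatrixCalculus

/-! ### `sl₂`-valued forms as connection forms -/

section FormsAsConnections

variable {X : Type} [TopologicalSpace X] [ChartedSpace ℂ X] {e : OpenPartialHomeomorph X ℂ} {z : ℂ}

theorem inChart_entry (p q : ℤ) (f : X → Mat2) (e : OpenPartialHomeomorph X ℂ) (z : ℂ)
    (i j : Fin 2) : inChart p q (fun x => f x i j) e z = inChart p q f e z i j := rfl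

theorem SlForm.contDiffOn10 (χ : SlForm X) (he : e ∈ atlas ℂ X) :
    ContDiffOn ℝ ∞ (inChart 1 0 χ.part10 e) e.target :=
  contDiffOn_mat_iff.2 fun i j => χ.smooth10 i j e he

theorem SlForm.contDiffOn01 (χ : SlForm X) (he : e ∈ atlas ℂ X) :
    ContDiffOn ℝ ∞ (inChart 0 1 χ.part01 e) e.target :=
  contDiffOn_mat_iff.2 fun i j => χ.smooth01 i j e he

theorem SlForm.isC1Form (χ : SlForm X) : IsC1Form χ.part10 χ.part01 :=
  ⟨fun _ he => (χ.contDiffOn10 he).of_le (by simp), fun _ he => (χ.contDiffOn01 he).of_le (by simp)⟩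

theorem IsC1Form.differentiableAt10 {V : Type*} [NormedAddCommGroup V] [NormedSpace ℂ V]
    {P Q : X → V} (h : IsC1Form P Q) (he : e ∈ atlas ℂ X) (hz : z ∈ e.target) :
    DifferentiableAt ℝ (inChart 1 0 P e) z :=
  ((h.contDiffOn10 e he).differentiableOn one_ne_zero).differentiableAt (e.open_target.mem_nhds hz)

theorem IsC1Form.differentiableAt01 {V : Type*} [NormedAddCommGroup V] [NormedSpace ℂ V]
    {P Q : X → V} (h : IsC1Form P Q) (he : e ∈ atlas ℂ X) (hz : z ∈ e.target) :
    DifferentiableAt ℝ (inChart 0 1 Q e) z :=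
  ((h.contDiffOn01 e he).differentiableOn one_ne_zero).differentiableAt (e.open_target.mem_nhds hz)

theorem SlForm.dCoeff_eq (χ : SlForm X) (he : e ∈ atlas ℂ X) (hz : z ∈ e.target) :
    χ.dCoeff e z = wdz (inChart 0 1 χ.part01 e) z - wdzbar (inChart 1 0 χ.part10 e) z := by
  ext i j
  rw [Matrix.sub_apply, wdz_entry (χ.isC1Form.differentiableAt01 he hz),
    wdzbar_entry (χ.isC1Form.differentiableAt10 he hz)]
  rfl

theorem wdzbar_inChart_hol (A : HolSlForm X) (he : e ∈ atlas ℂ X) (hz : z ∈ e.target) :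
    wdzbar (inChart 1 0 A.toFun e) z = 0 := by
  ext i j
  have h : DifferentiableAt ℝ (inChart 1 0 A.toFun e) z :=
    A.toSlForm.isC1Form.differentiableAt10 he hz
  rw [wdzbar_entry h, ← wdzbar_eq_dzbar]
  exact wdzbar_eq_zero_of_holomorphic ((A.holo i j e he).differentiableAt (e.open_target.mem_nhds hz))

theorem isParallelFrame_iff {B : SlForm X} {x y : X} {p : Path x y} {F : ℝ → Mat2} :
    IsParallelFrame B p F ↔ IsFrame (pathValue B.part10 B.part01 p.extend) F :=
  and_congr_right fun _ => forall₂_congr fun _ _ => hasDerivWithinAt_mat_iff.symm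

theorem trace_alongPath (B : SlForm X) {x y : X} (p : Path x y) (s : ℝ) :
    (B.alongPath p s).trace = 0 := by
  simp [SlForm.alongPath, B.trace10, B.trace01]

/-- The linear combination `a χ + b ψ`. -/
def SlForm.comb (a : ℂ) (χ : SlForm X) (b : ℂ) (ψ : SlForm X) : SlForm X where
  part10 x := a • χ.part10 x + b • ψ.part10 x
  part01 x := a • χ.part01 x + b • ψ.part01 x
  trace10 x := by simp [χ.trace10, ψ.trace10]
  trace01 x := by simp [χ.trace01, ψ.trace01]
  smooth10 i j e he :=
    (((χ.smooth10 i j e he).const_smul a).add ((ψ.smooth10 i j e he).const_smul b)).congr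
      fun z _ => by
        simp [inChart]
        ring
  smooth01 i j e he :=
    (((χ.smooth01 i j e he).const_smul a).add ((ψ.smooth01 i j e he).const_smul b)).congr
      fun z _ => by
        simp [inChart]
        ring

theorem inChart_comb {V : Type*} [AddCommGroup V] [Module ℂ V] (p q : ℤ) (a b : ℂ) (f g : X → V)
    (e : OpenPartialHomeomorph X ℂ) (z : ℂ) :
    inChart p q (fun x => a • f x + b • g x) e z = a • inChart p q f e z + b • inChart p q g e z := by
  simp only [inChart, smul_add]
  rw [smul_comm _ a, smul_comm _ b]

theorem SlForm.dCoeff_comb (a : ℂ) (χ : SlForm X) (b : ℂ) (ψ : SlForm X) (he : e ∈ atlas ℂ X)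
    (hz : z ∈ e.target) :
    (SlForm.comb a χ b ψ).dCoeff e z = a • χ.dCoeff e z + b • ψ.dCoeff e z := by
  have h1 : inChart 0 1 (SlForm.comb a χ b ψ).part01 e = fun z =>
      a • inChart 0 1 χ.part01 e z + b • inChart 0 1 ψ.part01 e z :=
    funext fun z => inChart_comb 0 1 a b _ _ e z
  have h2 : inChart 1 0 (SlForm.comb a χ b ψ).part10 e = fun z =>
      a • inChart 1 0 χ.part10 e z + b • inChart 1 0 ψ.part10 e z :=
    funext fun z => inChart_comb 1 0 a b _ _ e z
  have hs (c : ℂ) {f : ℂ → Mat2} (hf : DifferentiableAt ℝ f z) :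
      wdz (fun w => c • f w) z = c • wdz f z := wdz_clm_comp (c • ContinuousLinearMap.id ℂ Mat2) hf
  have hs' (c : ℂ) {f : ℂ → Mat2} (hf : DifferentiableAt ℝ f z) :
      wdzbar (fun w => c • f w) z = c • wdzbar f z :=
    wdzbar_clm_comp (c • ContinuousLinearMap.id ℂ Mat2) hf
  have d1 := χ.isC1Form.differentiableAt01 he hz
  have d2 := ψ.isC1Form.differentiableAt01 he hz
  have d3 := χ.isC1Form.differentiableAt10 he hz
  have d4 := ψ.isC1Form.differentiableAt10 he hz
  rw [SlForm.dCoeff_eq _ he hz, SlForm.dCoeff_eq _ he hz, SlForm.dCoeff_eq _ he hz, h1, h2,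
    wdz_add (f := fun w => a • inChart 0 1 χ.part01 e w)
      (g := fun w => b • inChart 0 1 ψ.part01 e w) (d1.const_smul a) (d2.const_smul b),
    wdzbar_add (f := fun w => a • inChart 1 0 χ.part10 e w)
      (g := fun w => b • inChart 1 0 ψ.part10 e w) (d3.const_smul a) (d4.const_smul b),
    hs a d1, hs b d2, hs' a d3, hs' b d4]
  module

theorem SlForm.isCovClosed_comb {A : HolSlForm X} {χ ψ : SlForm X} (hχ : χ.IsCovClosed A)
    (hψ : ψ.IsCovClosed A) (a b : ℂ) : (SlForm.comb a χ b ψ).IsCovClosed A := by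
  intro e he z hz
  have h1 : inChart 0 1 (SlForm.comb a χ b ψ).part01 e z =
      a • inChart 0 1 χ.part01 e z + b • inChart 0 1 ψ.part01 e z := inChart_comb 0 1 a b _ _ e z
  have e1 := congrArg (a • ·) (hχ e he z hz)
  have e2 := congrArg (b • ·) (hψ e he z hz)
  have e3 := congrArg₂ (· + ·) e1 e2
  simp only [smul_zero, add_zero] at e3
  rw [SlForm.dCoeff_comb a χ b ψ he hz, h1, ← e3]
  simp only [mul_add, add_mul, mul_smul_comm, smul_mul_assoc]
  module

theorem SlForm.alongPath_comb (a : ℂ) (χ : SlForm X) (b : ℂ) (ψ : SlForm X) {x y : X}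
    (p : Path x y) (s : ℝ) : (SlForm.comb a χ b ψ).alongPath p s =
      a • χ.alongPath p s + b • ψ.alongPath p s := by
  simp only [SlForm.alongPath, SlForm.comb]
  module

/-- The forms of tangent vectors are `d_A`-closed. -/
theorem Deformation.isCovClosed {A : HolSlForm X} [IsManifold 𝓘(ℂ, ℂ) ω X] (v : Deformation A) :
    v.form.IsCovClosed A := by
  intro e he z hz
  -- In a chart the (0,1)-part is the scalar coefficient of μ times A, so its commutator with A
  -- vanishes and d_A-closedness is ordinary closedness.
  have h : inChart 0 1 v.form.part01 e z =
      inChart (-1) 1 v.mu e z • inChart 1 0 A.toFun e z := by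
    have h0 := transitionDeriv_ne_zero he hz
    simp only [inChart, v.compat, smul_smul, smul_eq_mul]
    congr 1
    simp only [zpow_neg, zpow_one, zpow_zero]
    field_simp
  rw [v.closed e he z hz, h]
  simp

end FormsAsConnections

end SlSystem

end

noncomputable section

namespace SlSystem

open Set Filter Topology MeasureTheory

attribute [local instance] matNormedRing matNormedAlgebra matTopology matUniformity

/-! ### The monodromy representation -/

section Monodromy

/-- Liouville's formula: (det F)' = -tr(M) det F, and M is traceless. -/
theorem IsFrame.det_eq_one {M F : ℝ → Mat2} (hM : ∀ s ∈ Icc (0 : ℝ) 1, (M s).trace = 0)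
    (hF : IsFrame M F) : ∀ s ∈ Icc (0 : ℝ) 1, (F s).det = 1 := by
  intro s hs
  have h0 : (F 0).det = 1 := by rw [hF.1, Matrix.det_one]
  rw [← h0]
  refine eqOn_Icc_of_hasDerivWithinAt_zero (f := fun s => (F s).det) (fun u hu => ?_) s hs
  have h := hasDerivWithinAt_mat_iff.1 (hF.2 u hu)
  have hd := ((h 0 0).mul (h 1 1)).sub ((h 0 1).mul (h 1 0))
  have htr := hM u hu
  rw [Matrix.trace_fin_two] at htr
  have heq : (fun s => (F s).det) = fun s => F s 0 0 * F s 1 1 - F s 0 1 * F s 1 0 :=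
    funext fun s => Matrix.det_fin_two (F s)
  rw [heq]
  refine hd.congr_deriv ?_
  simp only [Matrix.neg_apply, Matrix.mul_apply, Fin.sum_univ_two]
  linear_combination (F u 0 1 * F u 1 0 - F u 0 0 * F u 1 1) * htr

variable {X : Type} [TopologicalSpace X] [ChartedSpace ℂ X]

theorem trace_pathValue (B : SlForm X) (p : ℝ → X) (s : ℝ) :
    (pathValue B.part10 B.part01 p s).trace = 0 := by
  simp [pathValue, B.trace10, B.trace01]

theorem HolSlForm.isFlat (A : HolSlForm X) :
    IsFlatConnection A.toSlForm.part10 A.toSlForm.part01 where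
  toIsC1Form := A.toSlForm.isC1Form
  flat e he z hz := by
    have h1 : inChart 0 1 A.toSlForm.part01 e = fun _ => 0 := funext fun w => by
      simp [inChart, HolSlForm.toSlForm]
    have h2 := wdzbar_inChart_hol A he hz
    rw [h1, show A.toSlForm.part10 = A.toFun from rfl, h2, wdz_const]
    simp

variable [IsManifold 𝓘(ℂ, ℂ) ω X]

theorem HolSlForm.det_transport (A : HolSlForm X) {x y : X} (γ : Path.Homotopic.Quotient x y) :
    (A.isFlat.transport γ).det = 1 := by
  obtain ⟨q, hq, rfl⟩ := exists_isFlatEnded_mk γ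
  obtain ⟨F, hF⟩ := A.toSlForm.isC1Form.exists_isFrame_pathValue hq.isC1On
  rw [A.isFlat.transport_eq_of_isFrame hq.isC1On hF]
  exact hF.det_eq_one (fun s _ => trace_pathValue _ _ s) 1 (right_mem_Icc.2 zero_le_one)

/-- The monodromy representation of `d + A`. -/
def monodromy (A : HolSlForm X) (x₀ : X) :
    FundamentalGroup X x₀ →* Matrix.SpecialLinearGroup (Fin 2) ℂ where
  toFun γ := ⟨A.isFlat.transport (FundamentalGroup.toPath γ), A.det_transport _⟩
  map_one' := Subtype.ext (A.isFlat.transport_refl x₀)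
  map_mul' γ γ' := Subtype.ext (A.isFlat.transport_trans (FundamentalGroup.toPath γ')
    (FundamentalGroup.toPath γ))

theorem isMonodromy_monodromy (A : HolSlForm X) (x₀ : X) : IsMonodromy A (monodromy A x₀) := by
  intro p hp
  obtain ⟨F, hF⟩ := A.toSlForm.isC1Form.exists_isFrame_pathValue (p := p.extend) hp
  exact ⟨F, isParallelFrame_iff.2 hF, (A.isFlat.transport_eq_of_isFrame hp hF).symm⟩

theorem IsMonodromy.eq_frame {A : HolSlForm X} {x₀ : X}
    {ρ : FundamentalGroup X x₀ →* Matrix.SpecialLinearGroup (Fin 2) ℂ} (hρ : IsMonodromy A ρ)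
    {p : Path x₀ x₀} (hp : IsC1Path p) {F : ℝ → Mat2} (hF : IsParallelFrame A.toSlForm p F) :
    (ρ (loopClass p) : Mat2) = F 1 := by
  obtain ⟨F', hF', h1⟩ := hρ p hp
  rw [← h1]
  exact (isParallelFrame_iff.1 hF).unique (A.toSlForm.isC1Form.continuousOn_pathValue hp)
    (isParallelFrame_iff.1 hF') 1 (right_mem_Icc.2 zero_le_one)

/-- The monodromy is prescribed on C¹ loops only, but every element of the fundamental group is the
class of such a loop. -/
theorem IsMonodromy.eq_transport {A : HolSlForm X} {x₀ : X}
    {ρ : FundamentalGroup X x₀ →* Matrix.SpecialLinearGroup (Fin 2) ℂ} (hρ : IsMonodromy A ρ)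
    (γ : FundamentalGroup X x₀) :
    (ρ γ : Mat2) = A.isFlat.transport (FundamentalGroup.toPath γ) := by
  obtain ⟨q, hq, h⟩ := exists_isFlatEnded_mk (FundamentalGroup.toPath γ)
  obtain ⟨F, hF⟩ := A.toSlForm.isC1Form.exists_isFrame_pathValue hq.isC1On
  rw [← h, A.isFlat.transport_eq_of_isFrame hq.isC1On hF,
    ← hρ.eq_frame hq.isC1On (isParallelFrame_iff.2 hF)]
  exact congrArg (fun γ => (ρ γ : Mat2)) h.symm

end Monodromy

/-! ### Variation of the parallel transport -/

section Variation

/-- Joint smoothness in time and position gives a Lipschitz constant in time that is locally uniform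
in position. -/
theorem exists_lipschitz_time {G : ℝ × ℂ → Mat2} {U : Set ℂ} (hU : IsOpen U)
    (hG : ContDiffOn ℝ ∞ G (univ ×ˢ U)) {z₀ : ℂ} (hz : z₀ ∈ U) :
    ∃ K : ℝ, 0 ≤ K ∧ ∃ T ∈ 𝓝 (0 : ℝ), ∃ W ∈ 𝓝 z₀, ∀ t ∈ T, ∀ z ∈ W,
      ‖G (t, z) - G (0, z)‖ ≤ K * |t| := by
  have h1 : ContDiffAt ℝ 1 G (0, z₀) :=
    ((hG.contDiffAt ((isOpen_univ.prod hU).mem_nhds ⟨mem_univ _, hz⟩)).of_le (by simp))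
  obtain ⟨K, S, hS, hK⟩ := h1.exists_lipschitzOnWith
  obtain ⟨T, hT, W, hW, hTW⟩ := mem_nhds_prod_iff.1 hS
  refine ⟨K, K.2, T, hT, W, hW, fun t ht z hz => ?_⟩
  have h := hK.norm_sub_le (hTW (mk_mem_prod ht hz)) (hTW (mk_mem_prod (mem_of_mem_nhds hT) hz))
  refine h.trans_eq ?_
  congr 1
  rw [Prod.mk_sub_mk, sub_self, sub_zero, Prod.norm_mk, norm_zero, Real.norm_eq_abs,
    max_eq_left (abs_nonneg t)]

variable {X : Type} [TopologicalSpace X] [ChartedSpace ℂ X]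

/-- The affine family `χ + t ψ`. -/
theorem isSmoothFamily_line (χ ψ : SlForm X) :
    IsSmoothFamily χ ψ fun t => SlForm.comb 1 χ t ψ := by
  refine ⟨?_, fun e he i j => ⟨?_, ?_⟩, fun x i j => ⟨?_, ?_⟩⟩
  · cases χ
    simp [SlForm.comb]
  · have h1 : ContDiffOn ℝ ∞ (fun y : ℝ × ℂ => inChart 1 0 (fun x => χ.part10 x i j) e y.2)
        (univ ×ˢ e.target) :=
      (χ.smooth10 i j e he).comp contDiff_snd.contDiffOn fun y hy => hy.2
    have h2 : ContDiffOn ℝ ∞ (fun y : ℝ × ℂ => inChart 1 0 (fun x => ψ.part10 x i j) e y.2)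
        (univ ×ˢ e.target) :=
      (ψ.smooth10 i j e he).comp contDiff_snd.contDiffOn fun y hy => hy.2
    have h3 : ContDiff ℝ ∞ fun y : ℝ × ℂ => (y.1 : ℂ) :=
      Complex.ofRealCLM.contDiff.comp contDiff_fst
    refine (h1.add (h3.contDiffOn.mul h2)).congr fun y _ => ?_
    simp [inChart, SlForm.comb]
    ring
  · have h1 : ContDiffOn ℝ ∞ (fun y : ℝ × ℂ => inChart 0 1 (fun x => χ.part01 x i j) e y.2)
        (univ ×ˢ e.target) :=
      (χ.smooth01 i j e he).comp contDiff_snd.contDiffOn fun y hy => hy.2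
    have h2 : ContDiffOn ℝ ∞ (fun y : ℝ × ℂ => inChart 0 1 (fun x => ψ.part01 x i j) e y.2)
        (univ ×ˢ e.target) :=
      (ψ.smooth01 i j e he).comp contDiff_snd.contDiffOn fun y hy => hy.2
    have h3 : ContDiff ℝ ∞ fun y : ℝ × ℂ => (y.1 : ℂ) :=
      Complex.ofRealCLM.contDiff.comp contDiff_fst
    refine (h1.add (h3.contDiffOn.mul h2)).congr fun y _ => ?_
    simp [inChart, SlForm.comb]
    ring
  · have h : HasDerivAt (fun t : ℝ => (t : ℂ)) 1 0 := Complex.ofRealCLM.hasDerivAt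
    have h' := (h.mul_const (ψ.part10 x i j)).const_add (χ.part10 x i j)
    simpa [SlForm.comb] using h'
  · have h : HasDerivAt (fun t : ℝ => (t : ℂ)) 1 0 := Complex.ofRealCLM.hasDerivAt
    have h' := (h.mul_const (ψ.part01 x i j)).const_add (χ.part01 x i j)
    simpa [SlForm.comb] using h'

variable [IsManifold 𝓘(ℂ, ℂ) ω X]

/-- This is the uniform bound needed to differentiate transport in the parameter. Near each time it
follows in one fixed chart from the local estimate and the boundedness of the velocity, and [0, 1]
is compact. -/
theorem IsSmoothFamily.exists_lipschitz {χ χ' : SlForm X} {B : ℝ → SlForm X}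
    (hB : IsSmoothFamily χ χ' B) {p : ℝ → X} (hp : IsC1On p) :
    ∃ C : ℝ, ∀ᶠ t in 𝓝 (0 : ℝ), ∀ s ∈ Icc (0 : ℝ) 1,
      ‖pathValue (B t).part10 (B t).part01 p s - pathValue (B 0).part10 (B 0).part01 p s‖ ≤
        C * |t| := by
  refine isCompact_Icc.induction_on (p := fun S => ∃ C : ℝ, ∀ᶠ t in 𝓝 (0 : ℝ), ∀ s ∈ S,
      ‖pathValue (B t).part10 (B t).part01 p s - pathValue (B 0).part10 (B 0).part01 p s‖ ≤
        C * |t|) ⟨0, Eventually.of_forall fun t s hs => absurd hs (notMem_empty s)⟩ ?_ ?_ ?_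
  · rintro S S' hSS ⟨C, hC⟩
    exact ⟨C, hC.mono fun t ht s hs => ht s (hSS hs)⟩
  · rintro S S' ⟨C, hC⟩ ⟨C', hC'⟩
    refine ⟨max C C', (hC.and hC').mono fun t ht s hs => ?_⟩
    rcases hs with hs | hs
    · exact (ht.1 s hs).trans (mul_le_mul_of_nonneg_right (le_max_left _ _) (abs_nonneg t))
    · exact (ht.2 s hs).trans (mul_le_mul_of_nonneg_right (le_max_right _ _) (abs_nonneg t))
  · intro s₀ hs₀
    set e := chartAt ℂ (p s₀) with he_def
    have he : e ∈ atlas ℂ X := chart_mem_atlas ℂ _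
    have hps : p s₀ ∈ e.source := mem_chart_source ℂ _
    obtain ⟨K, hK0, T, hT, W, hW, hK⟩ := exists_lipschitz_time
      (G := fun y : ℝ × ℂ => inChart 1 0 (B y.1).part10 e y.2) e.open_target
      (contDiffOn_mat_iff.2 fun i j => (hB.2.1 e he i j).1) (e.map_source hps)
    obtain ⟨K', hK0', T', hT', W', hW', hK'⟩ := exists_lipschitz_time
      (G := fun y : ℝ × ℂ => inChart 0 1 (B y.1).part01 e y.2) e.open_target
      (contDiffOn_mat_iff.2 fun i j => (hB.2.1 e he i j).2) (e.map_source hps)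
    have hv := (hp.continuousWithinAt_velocity he hs₀ hps).norm
    set m := ‖velocity p e s₀‖ + 1 with hm
    have hev : ∀ᶠ s in 𝓝[Icc 0 1] s₀, s ∈ Icc (0 : ℝ) 1 ∧ p s ∈ e.source ∧
        e (p s) ∈ W ∩ W' ∧ ‖velocity p e s‖ ≤ m := by
      have h1 := (hp.continuousOn s₀ hs₀).eventually_mem (e.open_source.mem_nhds hps)
      have h2 := ((e.continuousAt hps).comp_continuousWithinAt
        (hp.continuousOn s₀ hs₀)).eventually_mem (inter_mem hW hW')
      have h3 := hv.eventually_mem (Iio_mem_nhds (show ‖velocity p e s₀‖ < m by rw [hm]; linarith))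
      filter_upwards [h1, h2, h3, self_mem_nhdsWithin] with s a1 a2 a3 a4
      exact ⟨a4, a1, a2, le_of_lt a3⟩
    refine ⟨_, hev, m * (K + K'), ?_⟩
    filter_upwards [hT, hT'] with t ht ht' s hs
    obtain ⟨hs, hsource, hW, hvel⟩ := hs
    rw [pathValue_eq_inChart _ _ hp he hs hsource, pathValue_eq_inChart _ _ hp he hs hsource,
      add_sub_add_comm, ← smul_sub, ← smul_sub]
    refine (norm_add_le _ _).trans ?_
    rw [norm_smul, norm_smul, RCLike.norm_conj]
    have b1 := hK t ht _ hW.1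
    have b2 := hK' t ht' _ hW.2
    have c1 := mul_le_mul hvel b1 (norm_nonneg _) ((norm_nonneg _).trans hvel)
    have c2 := mul_le_mul hvel b2 (norm_nonneg _) ((norm_nonneg _).trans hvel)
    refine (add_le_add c1 c2).trans_eq (by ring)

/-- The derivative of the parallel transport along a `C¹` path in a smooth family of
connections. -/
theorem IsSmoothFamily.hasDerivAt_frame {χ χ' : SlForm X} {B : ℝ → SlForm X}
    (hB : IsSmoothFamily χ χ' B) {x y : X} {p : Path x y} (hp : IsC1Path p) {F : ℝ → ℝ → Mat2}
    (hF : ∀ t, IsParallelFrame (B t) p (F t)) :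
    HasDerivAt (fun t => F t 1)
      (-(F 0 1 * ∫ s in (0 : ℝ)..1, (F 0 s)⁻¹ * χ'.alongPath p s * F 0 s)) 0 := by
  obtain ⟨C, hC⟩ := hB.exists_lipschitz hp
  have h := hasDerivAt_frame_apply_one
    (M := fun t => pathValue (B t).part10 (B t).part01 p.extend) (F := F)
    (N := χ'.alongPath p) (C := C) ((B 0).isC1Form.continuousOn_pathValue hp)
    (Eventually.of_forall fun t => (B t).isC1Form.continuousOn_pathValue hp)
    (fun s _ => ?_) hC (isParallelFrame_iff.1 (hF 0))
    (Eventually.of_forall fun t => isParallelFrame_iff.1 (hF t))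
  · simpa only [Ring_inverse_eq_inv] using h
  · have h1 : HasDerivAt (fun t => (B t).part10 (p.extend s)) (χ'.part10 (p.extend s)) 0 :=
      hasDerivAt_mat_iff.2 fun i j => (hB.2.2 (p.extend s) i j).1
    have h2 : HasDerivAt (fun t => (B t).part01 (p.extend s)) (χ'.part01 (p.extend s)) 0 :=
      hasDerivAt_mat_iff.2 fun i j => (hB.2.2 (p.extend s) i j).2
    exact (h1.const_smul (velocity p.extend (chartAt ℂ (p.extend s)) s)).add
      (h2.const_smul (conj (velocity p.extend (chartAt ℂ (p.extend s)) s)))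

end Variation

end SlSystem

end

noncomputable section

namespace SlSystem

open Set Filter Topology MeasureTheory

attribute [local instance] matNormedRing matNormedAlgebra matTopology matUniformity

/-! ### First-order deformations of a flat connection -/

/-- Matrices `M + ε N` with `ε² = 0`. -/
abbrev DualMat := TrivSqZeroExt Mat2 Mat2

/-- The `ℓ¹` norm on dual matrices. -/
@[reducible] def dualNormedRing : NormedRing DualMat := TrivSqZeroExt.instL1NormedRing

attribute [local instance] dualNormedRing

/-- Dual matrices as a complex normed algebra. -/
@[reducible] def dualNormedAlgebra : NormedAlgebra ℂ DualMat := TrivSqZeroExt.instL1NormedAlgebra ℂ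

attribute [local instance] dualNormedAlgebra

/-- Dual matrices as a real normed algebra. -/
@[reducible] def dualNormedAlgebraReal : NormedAlgebra ℝ DualMat := NormedAlgebra.complexToReal

attribute [local instance] dualNormedAlgebraReal

/-- The topology of the `ℓ¹` norm. -/
@[reducible] def dualTopology : TopologicalSpace DualMat :=
  PseudoMetricSpace.toUniformSpace.toTopologicalSpace

attribute [local instance] dualTopology

theorem completeSpace_dualMat : CompleteSpace DualMat :=
  inferInstanceAs (CompleteSpace (Mat2 × Mat2))

attribute [local instance] completeSpace_dualMat

section Dual

/-- The matrix part of a dual matrix. -/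
def fstL : DualMat →L[ℂ] Mat2 where
  toFun := TrivSqZeroExt.fst
  map_add' _ _ := rfl
  map_smul' _ _ := rfl
  cont := TrivSqZeroExt.continuous_fst

/-- The infinitesimal part of a dual matrix. -/
def sndL : DualMat →L[ℂ] Mat2 where
  toFun := TrivSqZeroExt.snd
  map_add' _ _ := rfl
  map_smul' _ _ := rfl
  cont := TrivSqZeroExt.continuous_snd

/-- Matrices as dual matrices. -/
def inlL : Mat2 →L[ℂ] DualMat where
  toFun := TrivSqZeroExt.inl
  map_add' := TrivSqZeroExt.inl_add _
  map_smul' := TrivSqZeroExt.inl_smul _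
  cont := TrivSqZeroExt.continuous_inl

/-- Infinitesimal dual matrices. -/
def inrL : Mat2 →L[ℂ] DualMat where
  toFun := TrivSqZeroExt.inr
  map_add' := TrivSqZeroExt.inr_add _
  map_smul' := TrivSqZeroExt.inr_smul _
  cont := TrivSqZeroExt.continuous_inr

/-- The dual matrix `M + ε N`. -/
def dualMk (M N : Mat2) : DualMat := inlL M + inrL N

@[simp] theorem fstL_dualMk (M N : Mat2) : fstL (dualMk M N) = M := by
  change M + 0 = M
  rw [add_zero]

@[simp] theorem sndL_dualMk (M N : Mat2) : sndL (dualMk M N) = N := by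
  change 0 + N = N
  rw [zero_add]

theorem fstL_mul (a b : DualMat) : fstL (a * b) = fstL a * fstL b := rfl

theorem sndL_mul (a b : DualMat) : sndL (a * b) = fstL a * sndL b + sndL a * fstL b := rfl

@[simp] theorem sndL_one : sndL 1 = 0 := rfl

theorem dualMat_ext {a b : DualMat} (h : fstL a = fstL b) (h' : sndL a = sndL b) : a = b :=
  TrivSqZeroExt.ext h h'

variable {X : Type} [TopologicalSpace X] [ChartedSpace ℂ X]

theorem fstL_inChart (p q : ℤ) (f g : X → Mat2) (e : OpenPartialHomeomorph X ℂ) (z : ℂ) :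
    fstL (inChart p q (fun x => dualMk (f x) (g x)) e z) = inChart p q f e z := by
  rw [inChart, map_smul, fstL_dualMk]
  rfl

theorem sndL_inChart (p q : ℤ) (f g : X → Mat2) (e : OpenPartialHomeomorph X ℂ) (z : ℂ) :
    sndL (inChart p q (fun x => dualMk (f x) (g x)) e z) = inChart p q g e z := by
  rw [inChart, map_smul, sndL_dualMk]
  rfl

theorem fstL_pathValue (P Q P' Q' : X → Mat2) (p : ℝ → X) (s : ℝ) :
    fstL (pathValue (fun x => dualMk (P x) (P' x)) (fun x => dualMk (Q x) (Q' x)) p s) =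
      pathValue P Q p s := by
  simp only [pathValue, map_add, map_smul, fstL_dualMk]

theorem sndL_pathValue (P Q P' Q' : X → Mat2) (p : ℝ → X) (s : ℝ) :
    sndL (pathValue (fun x => dualMk (P x) (P' x)) (fun x => dualMk (Q x) (Q' x)) p s) =
      pathValue P' Q' p s := by
  simp only [pathValue, map_add, map_smul, sndL_dualMk]

theorem contDiffOn_inChart_dualMk {p q : ℤ} {f g : X → Mat2} {e : OpenPartialHomeomorph X ℂ}
    {n : WithTop ℕ∞} (hf : ContDiffOn ℝ n (inChart p q f e) e.target)
    (hg : ContDiffOn ℝ n (inChart p q g e) e.target) :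
    ContDiffOn ℝ n (inChart p q (fun x => dualMk (f x) (g x)) e) e.target := by
  have h1 := (inlL.restrictScalars ℝ).contDiff.comp_contDiffOn hf
  have h2 := (inrL.restrictScalars ℝ).contDiff.comp_contDiffOn hg
  refine (h1.add h2).congr fun z _ => ?_
  simp only [inChart, dualMk, smul_add, ← map_smul]
  rfl

variable {A : HolSlForm X} {χ : SlForm X}

/-- The connection `d + A + ε χ` is flat if `χ` is `d_A`-closed. -/
theorem SlForm.IsCovClosed.isFlat (hχ : χ.IsCovClosed A) :
    IsFlatConnection (fun x => dualMk (A.toSlForm.part10 x) (χ.part10 x))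
      (fun x => dualMk (A.toSlForm.part01 x) (χ.part01 x)) where
  contDiffOn10 e he := contDiffOn_inChart_dualMk (A.toSlForm.isC1Form.contDiffOn10 e he)
    (χ.isC1Form.contDiffOn10 e he)
  contDiffOn01 e he := contDiffOn_inChart_dualMk (A.toSlForm.isC1Form.contDiffOn01 e he)
    (χ.isC1Form.contDiffOn01 e he)
  flat e he z hz := by
    have d1 : IsC1Form (fun x => dualMk (A.toSlForm.part10 x) (χ.part10 x))
        (fun x => dualMk (A.toSlForm.part01 x) (χ.part01 x)) :=
      ⟨fun e he => contDiffOn_inChart_dualMk (A.toSlForm.isC1Form.contDiffOn10 e he)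
        (χ.isC1Form.contDiffOn10 e he),
      fun e he => contDiffOn_inChart_dualMk (A.toSlForm.isC1Form.contDiffOn01 e he)
        (χ.isC1Form.contDiffOn01 e he)⟩
    have hfl := A.isFlat.flat e he z hz
    have hcl := hχ e he z hz
    rw [χ.dCoeff_eq he hz] at hcl
    -- The curvature of d + A + εχ has matrix part the curvature of d + A and ε-part d_A χ.
    refine dualMat_ext ?_ ?_
    · simp only [map_add, map_sub, fstL_mul, fstL_inChart, ← wdz_clm_comp fstL
        (d1.differentiableAt01 he hz), ← wdzbar_clm_comp fstL (d1.differentiableAt10 he hz)]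
      exact hfl
    · simp only [map_add, map_sub, sndL_mul, sndL_inChart, fstL_inChart, ← wdz_clm_comp sndL
        (d1.differentiableAt01 he hz), ← wdzbar_clm_comp sndL (d1.differentiableAt10 he hz)]
      have h0 : inChart 0 1 A.toSlForm.part01 e z = 0 := by
        simp [inChart, HolSlForm.toSlForm]
      rw [h0, zero_mul, zero_add, mul_zero, add_zero]
      exact hcl

variable [IsManifold 𝓘(ℂ, ℂ) ω X]

theorem IsFrame.matrixPart {M G : ℝ → DualMat} (hG : IsFrame M G) :
    IsFrame (fun s => fstL (M s)) fun s => fstL (G s) := by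
  refine ⟨congrArg fstL hG.1, fun s hs => ?_⟩
  refine ((fstL.restrictScalars ℝ).hasFDerivAt.comp_hasDerivWithinAt s
    (hG.2 s hs)).congr_deriv ?_
  change fstL (-(M s * G s)) = _
  rw [map_neg, fstL_mul]

theorem IsFrame.hasDerivWithinAt_sndL {M G : ℝ → DualMat} (hG : IsFrame M G) :
    ∀ s ∈ Icc (0 : ℝ) 1, HasDerivWithinAt (fun s => sndL (G s))
      (-(fstL (M s) * sndL (G s) + sndL (M s) * fstL (G s))) (Icc 0 1) s := by
  intro s hs
  refine ((sndL.restrictScalars ℝ).hasFDerivAt.comp_hasDerivWithinAt s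
    (hG.2 s hs)).congr_deriv ?_
  change sndL (-(M s * G s)) = _
  rw [map_neg, sndL_mul]

/-- The infinitesimal part of a dual parallel frame. -/
theorem IsFrame.sndL_apply_one {M G : ℝ → DualMat}
    (hM : ContinuousOn (fun s => fstL (M s)) (Icc 0 1))
    (hN : ContinuousOn (fun s => sndL (M s)) (Icc 0 1)) (hG : IsFrame M G) :
    sndL (G 1) = -(fstL (G 1) * ∫ s in (0 : ℝ)..1,
      (fstL (G s))⁻¹ * sndL (M s) * fstL (G s)) := by
  have hF := hG.matrixPart
  have hu := hF.isUnit hM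
  have hinv (s : ℝ) (hs : s ∈ Icc (0 : ℝ) 1) :=
    hasDerivWithinAt_inverse_frame (hu s hs) (hF.2 s hs)
  have hd : ∀ s ∈ Icc (0 : ℝ) 1, HasDerivWithinAt
      -- Variation of constants in the ε-part: multiplied by the inverse of the matrix part, it has
      -- derivative minus the conjugated coefficient, and it starts at 0 because the frame starts at
      -- 1.
      (fun s => Ring.inverse (fstL (G s)) * sndL (G s))
      (-(Ring.inverse (fstL (G s)) * sndL (M s) * fstL (G s))) (Icc 0 1) s :=
    fun s hs => ((hinv s hs).mul (hG.hasDerivWithinAt_sndL s hs)).congr_deriv (by noncomm_ring)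
  have hcont : ContinuousOn (fun s => Ring.inverse (fstL (G s)) * sndL (M s) *
      fstL (G s)) (Icc 0 1) :=
    (ContinuousOn.mul (fun s hs => (hinv s hs).continuousWithinAt) hN).mul hF.continuousOn
  have h := integral_eq_sub_of_hasDerivWithinAt_Icc hd hcont.neg
  rw [intervalIntegral.integral_neg, hG.1, sndL_one, mul_zero, sub_zero] at h
  simp only [← Ring_inverse_eq_inv]
  rw [← mul_neg, h, ← mul_assoc, Ring.mul_inverse_cancel _ (hu 1 (right_mem_Icc.2 zero_le_one)),
    one_mul]

end Dual

end SlSystem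

end

noncomputable section

namespace SlSystem

open Set Filter Topology MeasureTheory

attribute [local instance] matNormedRing matNormedAlgebra matTopology matUniformity
attribute [local instance] dualNormedRing dualNormedAlgebra dualNormedAlgebraReal dualTopology
  completeSpace_dualMat

/-! ### Periods of closed forms -/

section Periods

theorem coe_inv_specialLinearGroup (g : Matrix.SpecialLinearGroup (Fin 2) ℂ) :
    ((g⁻¹ : Matrix.SpecialLinearGroup (Fin 2) ℂ) : Mat2) = (g : Mat2)⁻¹ := by
  symm
  apply Matrix.inv_eq_left_inv
  rw [← Matrix.SpecialLinearGroup.coe_mul, inv_mul_cancel, Matrix.SpecialLinearGroup.coe_one]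

variable {X : Type} [TopologicalSpace X] [ChartedSpace ℂ X] {A : HolSlForm X} {χ : SlForm X}

theorem frame_isUnit_det {x y : X} {p : Path x y} {F : ℝ → Mat2}
    (hF : IsParallelFrame A.toSlForm p F) {s : ℝ} (hs : s ∈ Icc (0 : ℝ) 1) : IsUnit (F s).det := by
  rw [(isParallelFrame_iff.1 hF).det_eq_one (fun s _ => trace_pathValue _ _ s) s hs]
  exact isUnit_one

variable [IsManifold 𝓘(ℂ, ℂ) ω X]

/-- The dual parallel frame along a `C¹` path projects to a parallel frame. -/
theorem SlForm.IsCovClosed.transport_spec (hχ : χ.IsCovClosed A) {x y : X} {p : Path x y}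
    (hp : IsC1Path p) {F : ℝ → Mat2} (hF : IsParallelFrame A.toSlForm p F) :
    fstL (hχ.isFlat.transport (Path.Homotopic.Quotient.mk p)) = F 1 ∧
      sndL (hχ.isFlat.transport (Path.Homotopic.Quotient.mk p)) =
        -(F 1 * ∫ s in (0 : ℝ)..1, (F s)⁻¹ * χ.alongPath p s * F s) := by
  obtain ⟨G, hG⟩ := hχ.isFlat.toIsC1Form.exists_isFrame_pathValue (p := p.extend) hp
  have hA := A.toSlForm.isC1Form.continuousOn_pathValue (p := p.extend) hp
  have hFG : ∀ s ∈ Icc (0 : ℝ) 1, fstL (G s) = F s := by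
    have h := hG.matrixPart
    simp only [fstL_pathValue] at h
    exact (isParallelFrame_iff.1 hF).unique hA h
  have h1 := hFG 1 (right_mem_Icc.2 zero_le_one)
  rw [hχ.isFlat.transport_eq_of_isFrame hp hG]
  refine ⟨h1, ?_⟩
  rw [hG.sndL_apply_one (by simpa only [fstL_pathValue] using hA)
    (by simpa only [sndL_pathValue] using χ.isC1Form.continuousOn_pathValue (p := p.extend) hp), h1]
  congr 2
  refine intervalIntegral.integral_congr fun s hs => ?_
  rw [uIcc_of_le zero_le_one] at hs
  simp only [sndL_pathValue, hFG s hs]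
  rfl

theorem SlForm.IsCovClosed.fstL_transport (hχ : χ.IsCovClosed A) {x y : X}
    (γ : Path.Homotopic.Quotient x y) :
    fstL (hχ.isFlat.transport γ) = A.isFlat.transport γ := by
  obtain ⟨q, hq, rfl⟩ := exists_isFlatEnded_mk γ
  obtain ⟨F, hF⟩ := A.toSlForm.isC1Form.exists_isFrame_pathValue hq.isC1On
  rw [(hχ.transport_spec hq.isC1On (isParallelFrame_iff.2 hF)).1,
    A.isFlat.transport_eq_of_isFrame hq.isC1On hF]

/-- The integral of `χ` along a path class, with the values of `χ` carried to the end point. -/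
def SlForm.IsCovClosed.period (hχ : χ.IsCovClosed A) {x y : X} (γ : Path.Homotopic.Quotient x y) :
    Mat2 :=
  -(sndL (hχ.isFlat.transport γ) * (A.isFlat.transport γ)⁻¹)

theorem HolSlForm.isUnit_det_transport (A : HolSlForm X) {x y : X}
    (γ : Path.Homotopic.Quotient x y) : IsUnit (A.isFlat.transport γ).det := by
  rw [A.det_transport]
  exact isUnit_one

theorem SlForm.IsCovClosed.period_mk (hχ : χ.IsCovClosed A) {x y : X} {p : Path x y}
    (hp : IsC1Path p) {F : ℝ → Mat2} (hF : IsParallelFrame A.toSlForm p F) :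
    hχ.period (Path.Homotopic.Quotient.mk p) =
      F 1 * (∫ s in (0 : ℝ)..1, (F s)⁻¹ * χ.alongPath p s * F s) * (F 1)⁻¹ := by
  rw [SlForm.IsCovClosed.period, ← hχ.fstL_transport, (hχ.transport_spec hp hF).1,
    (hχ.transport_spec hp hF).2, neg_mul, neg_neg]

theorem continuousOn_conj_alongPath (χ : SlForm X) {x y : X} {p : Path x y}
    (hp : IsC1Path p) {F : ℝ → Mat2} (hF : IsParallelFrame A.toSlForm p F) :
    ContinuousOn (fun s => (F s)⁻¹ * χ.alongPath p s * F s) (Icc 0 1) := by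
  have hF' := isParallelFrame_iff.1 hF
  have hA := A.toSlForm.isC1Form.continuousOn_pathValue (p := p.extend) hp
  simp only [← Ring_inverse_eq_inv]
  exact (ContinuousOn.mul (fun s hs => (hasDerivWithinAt_inverse_frame (hF'.isUnit hA s hs)
    (hF'.2 s hs)).continuousWithinAt) (χ.isC1Form.continuousOn_pathValue (p := p.extend) hp)).mul
      hF'.continuousOn

theorem clm_integral_conj_alongPath {V : Type*} [NormedAddCommGroup V] [NormedSpace ℂ V]
    [CompleteSpace V] (L : Mat2 →L[ℂ] V) (χ : SlForm X) {x y : X} {p : Path x y}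
    (hp : IsC1Path p) {F : ℝ → Mat2} (hF : IsParallelFrame A.toSlForm p F) :
    L (∫ s in (0 : ℝ)..1, (F s)⁻¹ * χ.alongPath p s * F s) =
      ∫ s in (0 : ℝ)..1, L ((F s)⁻¹ * χ.alongPath p s * F s) :=
  (ContinuousLinearMap.intervalIntegral_comp_comm (L.restrictScalars ℝ)
    ((continuousOn_conj_alongPath χ hp hF).intervalIntegrable_of_Icc zero_le_one)).symm

theorem conj_integral_apply (χ : SlForm X) {x y : X} {p : Path x y}
    (hp : IsC1Path p) {F : ℝ → Mat2} (hF : IsParallelFrame A.toSlForm p F) (M N : Mat2)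
    (i j : Fin 2) :
    (M * (∫ s in (0 : ℝ)..1, (F s)⁻¹ * χ.alongPath p s * F s) * N) i j =
      ∫ s in (0 : ℝ)..1, (M * (F s)⁻¹ * χ.alongPath p s * F s * N) i j := by
  have h := clm_integral_conj_alongPath ((entryCLM i j).comp
    (((ContinuousLinearMap.mul ℂ Mat2).flip N).comp (ContinuousLinearMap.mul ℂ Mat2 M))) χ hp hF
  simp only [ContinuousLinearMap.comp_apply, ContinuousLinearMap.flip_apply,
    ContinuousLinearMap.mul_apply', entryCLM_apply] at h
  rw [h]
  simp only [mul_assoc]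

theorem SlForm.IsCovClosed.trace_period (hχ : χ.IsCovClosed A) {x y : X}
    (γ : Path.Homotopic.Quotient x y) : (hχ.period γ).trace = 0 := by
  obtain ⟨q, hq, rfl⟩ := exists_isFlatEnded_mk γ
  obtain ⟨F, hF⟩ := A.toSlForm.isC1Form.exists_isFrame_pathValue hq.isC1On
  have hF' : IsParallelFrame A.toSlForm q F := isParallelFrame_iff.2 hF
  rw [hχ.period_mk hq.isC1On hF', Matrix.trace_mul_comm, ← mul_assoc,
    Matrix.nonsing_inv_mul _ (frame_isUnit_det hF' (right_mem_Icc.2 zero_le_one)), one_mul,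
    ← traceCLM_apply, clm_integral_conj_alongPath traceCLM χ hq.isC1On hF']
  rw [intervalIntegral.integral_congr (g := fun _ => (0 : ℂ)), intervalIntegral.integral_zero]
  intro s hs
  rw [uIcc_of_le zero_le_one] at hs
  simp only [traceCLM_apply]
  rw [Matrix.trace_mul_comm, ← mul_assoc, Matrix.mul_nonsing_inv _ (frame_isUnit_det hF' hs),
    one_mul]
  exact trace_alongPath χ q s

/-- This is the ε-part of multiplicativity of the dual transport, and it is the cocycle rule for the
adjoint action. -/
theorem SlForm.IsCovClosed.period_trans (hχ : χ.IsCovClosed A) {x y z : X}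
    (γ : Path.Homotopic.Quotient x y) (γ' : Path.Homotopic.Quotient y z) :
    hχ.period (γ.trans γ') =
      A.isFlat.transport γ' * hχ.period γ * (A.isFlat.transport γ')⁻¹ + hχ.period γ' := by
  have h := Matrix.mul_nonsing_inv _ (A.isUnit_det_transport γ)
  simp only [SlForm.IsCovClosed.period, IsFlatConnection.transport_trans, sndL_mul,
    hχ.fstL_transport, Matrix.mul_inv_rev]
  rw [add_mul, mul_assoc (sndL _) (A.isFlat.transport γ),
    ← mul_assoc (A.isFlat.transport γ) (A.isFlat.transport γ)⁻¹, h, one_mul]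
  noncomm_ring

variable {x₀ : X} {ρ : FundamentalGroup X x₀ →* Matrix.SpecialLinearGroup (Fin 2) ℂ}

/-- The period cocycle of a `d_A`-closed form. -/
def IsMonodromy.periodCocycle (hρ : IsMonodromy A ρ) (hχ : χ.IsCovClosed A) :
    groupCohomology.cocycles₁ (adRho ρ) :=
  ⟨fun γ => (⟨hχ.period (FundamentalGroup.toPath γ), hχ.trace_period _⟩ : Sl2), by
    rw [groupCohomology.mem_cocycles₁_iff]
    intro g h
    refine Subtype.ext ?_
    refine (hχ.period_trans (FundamentalGroup.toPath h) (FundamentalGroup.toPath g)).trans ?_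
    change _ = (ρ g : Mat2) * hχ.period (FundamentalGroup.toPath h) *
      (((ρ g)⁻¹ : Matrix.SpecialLinearGroup (Fin 2) ℂ) : Mat2) +
        hχ.period (FundamentalGroup.toPath g)
    rw [coe_inv_specialLinearGroup, hρ.eq_transport g]⟩

/-- The derivative of the monodromy in the direction of a deformation. -/
theorem IsMonodromy.isVariationCocycle (hρ : IsMonodromy A ρ) (z : Deformation A) :
    IsVariationCocycle A ρ z (-hρ.periodCocycle z.isCovClosed) := by
  intro B hB p hp H hH i j
  choose F hF hFH using hH
  have h := hB.hasDerivAt_frame hp hF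
  have hF0 : IsParallelFrame A.toSlForm p (F 0) := by
    have := hF 0
    rwa [hB.1] at this
  have h1 := hasDerivAt_mat_iff.1 h i j
  simp only [hFH] at h1
  refine h1.congr_deriv (congrFun (congrFun ?_ i) j)
  have h2 : ((hρ.periodCocycle z.isCovClosed).1 (loopClass p) : Sl2).1 =
      z.isCovClosed.period (Path.Homotopic.Quotient.mk p) := rfl
  have h3 : ((-hρ.periodCocycle z.isCovClosed).1 (loopClass p) : Sl2).1 =
      -((hρ.periodCocycle z.isCovClosed).1 (loopClass p) : Sl2).1 := rfl
  rw [h3, h2, z.isCovClosed.period_mk hp hF0, hρ.eq_frame hp hF0, ← hFH 0, neg_mul,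
    mul_assoc _ (F 0 1)⁻¹,
    Matrix.nonsing_inv_mul _ (frame_isUnit_det hF0 (right_mem_Icc.2 zero_le_one)), mul_one]

/-- The derivative of the monodromy is minus the de Rham class of the deformation. -/
theorem IsMonodromy.isDeRhamClass_of_isVariationCocycle (hρ : IsMonodromy A ρ)
    {z : Deformation A} {c : groupCohomology.cocycles₁ (adRho ρ)}
    (hc : IsVariationCocycle A ρ z c) :
    IsDeRhamClass A ρ (SlForm.comb (-1) z.form 0 z.form) (groupCohomology.H1π (adRho ρ) c) := by
  refine ⟨SlForm.isCovClosed_comb z.isCovClosed z.isCovClosed _ _, c, rfl, fun p hp F hF i j => ?_⟩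
  -- Values on C¹ loops can be tested with any one admissible family, and the affine family A + tȦ
  -- is the simplest. The form attached to the class is -Ȧ; the second slot of `SlForm.comb` carries
  -- coefficient 0.
  have hB := isSmoothFamily_line A.toSlForm z.form
  have hex (t : ℝ) : ∃ F, IsParallelFrame (SlForm.comb 1 A.toSlForm t z.form) p F := by
    obtain ⟨F, hF⟩ := (SlForm.comb 1 A.toSlForm t z.form).isC1Form.exists_isFrame_pathValue
      (p := p.extend) hp
    exact ⟨F, isParallelFrame_iff.2 hF⟩
  choose G hG using hex
  have h1 := hc _ hB p hp (fun t => G t 1) fun t => ⟨G t, hG t, rfl⟩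
  have h2 := hasDerivAt_mat_iff.1 (hB.hasDerivAt_frame hp hG)
  have h3 : ((c.1 (loopClass p) : Sl2).1 * (ρ (loopClass p) : Mat2)) =
      -(G 0 1 * ∫ s in (0 : ℝ)..1, (G 0 s)⁻¹ * z.form.alongPath p s * G 0 s) := by
    ext i j
    exact (h1 i j).unique (h2 i j)
  have hG0 : IsParallelFrame A.toSlForm p (G 0) := by
    have h0 : SlForm.comb 1 A.toSlForm ((0 : ℝ) : ℂ) z.form = A.toSlForm := hB.1
    exact h0 ▸ hG 0
  have hGF : ∀ s ∈ Icc (0 : ℝ) 1, G 0 s = F s :=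
    (isParallelFrame_iff.1 hF).unique (A.toSlForm.isC1Form.continuousOn_pathValue hp)
      (isParallelFrame_iff.1 hG0)
  have h11 : (1 : ℝ) ∈ Icc (0 : ℝ) 1 := right_mem_Icc.2 zero_le_one
  rw [hρ.eq_frame hp hF, hGF 1 h11] at h3
  have hint : ∫ s in (0 : ℝ)..1, (G 0 s)⁻¹ * z.form.alongPath p s * G 0 s =
      ∫ s in (0 : ℝ)..1, (F s)⁻¹ * z.form.alongPath p s * F s := by
    refine intervalIntegral.integral_congr fun s hs => ?_
    rw [uIcc_of_le zero_le_one] at hs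
    simp only [hGF s hs]
  rw [hint] at h3
  have hu := frame_isUnit_det hF h11
  have h4 : (c.1 (loopClass p) : Sl2).1 =
      -(F 1 * (∫ s in (0 : ℝ)..1, (F s)⁻¹ * z.form.alongPath p s * F s) * (F 1)⁻¹) := by
    have := congrArg (· * (F 1)⁻¹) h3
    simp only [mul_assoc _ (F 1) (F 1)⁻¹, Matrix.mul_nonsing_inv _ hu, mul_one, neg_mul] at this
    exact this
  rw [h4, Matrix.neg_apply, conj_integral_apply z.form hp hF, ← intervalIntegral.integral_neg]
  refine intervalIntegral.integral_congr fun s _ => ?_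
  simp only [SlForm.alongPath_comb, neg_smul, one_smul, zero_smul, add_zero, mul_neg, neg_mul,
    Matrix.neg_apply]

end Periods

end SlSystem

end

noncomputable section

namespace SlSystem

open Set Filter Topology MeasureTheory

attribute [local instance] matNormedRing matNormedAlgebra matTopology matUniformity
attribute [local instance] dualNormedRing dualNormedAlgebra dualNormedAlgebraReal dualTopology
  completeSpace_dualMat

/-! ### Primitives of closed forms with trivial class -/

section Primitive

/-- A local solution of d_A T = θ arises from its value T at one point as (uT - n)u⁻¹, where u + εn
is a dual flat frame. This is its first-order expansion at the point where the frame is 1. -/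
theorem hasFDerivAt_gauge {𝔸 : Type*} [NormedRing 𝔸] [NormedAlgebra ℝ 𝔸] [CompleteSpace 𝔸]
    {u n : ℂ → 𝔸} {U N L : ℂ →L[ℝ] 𝔸} {z : ℂ} (hu : HasFDerivAt u U z) (hn : HasFDerivAt n N z)
    (hu1 : u z = 1) (hn0 : n z = 0) (T : 𝔸) (hL : ∀ v, L v = U v * T - N v - T * U v) :
    HasFDerivAt (fun w => (u w * T - n w) * Ring.inverse (u w)) L z := by
  have hinv : HasFDerivAt (fun w => Ring.inverse (u w)) (-U) z := by
    have h1 := hasFDerivAt_ringInverse (𝕜 := ℝ) (1 : 𝔸ˣ)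
    rw [Units.val_one, ← hu1] at h1
    refine (h1.comp z hu).congr_fderiv ?_
    ext v
    simp
  refine (((hu.mul_const' T).sub hn).mul' hinv).congr_fderiv ?_
  ext v
  simp [hL, hu1, hn0]
  noncomm_ring

/-- The coefficients of the derivative may involve T itself, so their continuity is asked for only
once T is known to be continuous, which follows from differentiability. -/
theorem isC1Fun_of_hasFDerivAt {X : Type} [TopologicalSpace X] [ChartedSpace ℂ X]
    {V : Type*} [NormedAddCommGroup V] [NormedSpace ℂ V] {T : X → V}
    {a b : OpenPartialHomeomorph X ℂ → ℂ → V}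
    (h : ∀ e ∈ atlas ℂ X, ∀ z ∈ e.target,
      HasFDerivAt (fun w => T (e.symm w)) (wirtingerForm (a e z) (b e z)) z)
    (hc : ∀ e ∈ atlas ℂ X, ContinuousOn (fun w => T (e.symm w)) e.target →
      ContinuousOn (a e) e.target ∧ ContinuousOn (b e) e.target) : IsC1Fun T := fun e he => by
  have hT : DifferentiableOn ℝ (fun w => T (e.symm w)) e.target := fun z hz =>
    (h e he z hz).differentiableAt.differentiableWithinAt
  obtain ⟨ha, hb⟩ := hc e he hT.continuousOn
  have := (contDiffOn_succ_iff_fderiv_of_isOpen (𝕜 := ℝ) (n := 0)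
    (f := fun w => T (e.symm w)) e.open_target).2 ⟨hT, by simp, contDiffOn_zero.2 ?_⟩
  · simpa using this
  · refine ContinuousOn.congr (f := fun z => wirtingerForm (a e z) (b e z)) ?_
      fun z hz => (h e he z hz).fderiv
    rw [continuousOn_clm_apply]
    exact fun v => (ha.const_smul v).add (hb.const_smul (conj v))

variable {X : Type} [TopologicalSpace X] [ChartedSpace ℂ X] [IsManifold 𝓘(ℂ, ℂ) ω X]
  {A : HolSlForm X} {θ : SlForm X} {x₀ : X}

/-- The value at the end of a path of the solution of `d_A T = θ` with initial value `-M`. -/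
def SlForm.IsCovClosed.primitiveAlong (hθ : θ.IsCovClosed A) (M : Mat2) {x y : X}
    (γ : Path.Homotopic.Quotient x y) : Mat2 :=
  hθ.period γ - A.isFlat.transport γ * M * (A.isFlat.transport γ)⁻¹

theorem SlForm.IsCovClosed.primitiveAlong_trans (hθ : θ.IsCovClosed A) (M : Mat2) {x y z : X}
    (γ : Path.Homotopic.Quotient x y) (γ' : Path.Homotopic.Quotient y z) :
    hθ.primitiveAlong M (γ.trans γ') = A.isFlat.transport γ' * hθ.primitiveAlong M γ *
      (A.isFlat.transport γ')⁻¹ + hθ.period γ' := by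
  simp only [SlForm.IsCovClosed.primitiveAlong, hθ.period_trans, IsFlatConnection.transport_trans,
    Matrix.mul_inv_rev]
  noncomm_ring

/-- The hypothesis says that the solution starting from -M returns to -M along every loop at x₀. Two
paths with the same ends differ by such a loop, so the value at the end point is well defined. -/
theorem SlForm.IsCovClosed.primitiveAlong_eq (hθ : θ.IsCovClosed A) {M : Mat2}
    (hM : ∀ γ : Path.Homotopic.Quotient x₀ x₀, hθ.period γ =
      A.isFlat.transport γ * M * (A.isFlat.transport γ)⁻¹ - M) {x : X}
    (γ γ' : Path.Homotopic.Quotient x₀ x) :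
    hθ.primitiveAlong M γ = hθ.primitiveAlong M γ' := by
  have h1 : γ = (γ.trans γ'.symm).trans γ' := by
    rw [Path.Homotopic.Quotient.trans_assoc, Path.Homotopic.Quotient.symm_trans,
      Path.Homotopic.Quotient.trans_refl]
  rw [h1, hθ.primitiveAlong_trans]
  simp only [SlForm.IsCovClosed.primitiveAlong, hM]
  noncomm_ring

variable [PathConnectedSpace X]

/-- A solution of `d_A T = θ`, when the periods of `θ` are those of a coboundary. -/
def SlForm.IsCovClosed.primitive (hθ : θ.IsCovClosed A) (M : Mat2) (x₀ x : X) : Mat2 :=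
  hθ.primitiveAlong M (Path.Homotopic.Quotient.mk (PathConnectedSpace.somePath x₀ x))

/-- The path to y may be chosen through x and inside the disc at x. There the dual frame provides
both the transport and, through its ε-part, the period. -/
theorem SlForm.IsCovClosed.primitive_eq_of_mem_disc (hθ : θ.IsCovClosed A) {M : Mat2}
    (hM : ∀ γ : Path.Homotopic.Quotient x₀ x₀, hθ.period γ =
      A.isFlat.transport γ * M * (A.isFlat.transport γ)⁻¹ - M) {x y : X}
    (hy : y ∈ hθ.isFlat.disc x) :
    hθ.primitive M x₀ y = (fstL (hθ.isFlat.frame x y) * hθ.primitive M x₀ x -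
      sndL (hθ.isFlat.frame x y)) * (fstL (hθ.isFlat.frame x y))⁻¹ := by
  have hx := hθ.isFlat.mem_disc x
  obtain ⟨p, -, hp⟩ := exists_isFlatEnded_of_convex (chart_mem_atlas ℂ x) (convex_ball _ _)
    (hθ.isFlat.ball_subset_target x) hx.1 hx.2 hy.1 hy.2
  have h := hθ.isFlat.transport_of_mem_disc p hp
  rw [← h, hθ.fstL_transport, SlForm.IsCovClosed.primitive,
    hθ.primitiveAlong_eq hM _ ((Path.Homotopic.Quotient.mk
      (PathConnectedSpace.somePath x₀ x)).trans (Path.Homotopic.Quotient.mk p)),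
    hθ.primitiveAlong_trans, SlForm.IsCovClosed.primitive, SlForm.IsCovClosed.period]
  noncomm_ring

/-- The derivative of the primitive, in the preferred chart at the given point. -/
theorem SlForm.IsCovClosed.hasFDerivAt_primitive_chartAt (hθ : θ.IsCovClosed A) {M : Mat2}
    (hM : ∀ γ : Path.Homotopic.Quotient x₀ x₀, hθ.period γ =
      A.isFlat.transport γ * M * (A.isFlat.transport γ)⁻¹ - M) (x : X) :
    HasFDerivAt (fun w => hθ.primitive M x₀ ((chartAt ℂ x).symm w))
      (connForm θ.part10 θ.part01 (chartAt ℂ x) (chartAt ℂ x x) -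
        ((ContinuousLinearMap.mul ℝ Mat2).flip (hθ.primitive M x₀ x) -
          ContinuousLinearMap.mul ℝ Mat2 (hθ.primitive M x₀ x)).comp
            (connForm A.toSlForm.part10 A.toSlForm.part01 (chartAt ℂ x) (chartAt ℂ x x)))
      (chartAt ℂ x x) := by
  set c := chartAt ℂ x with hc
  set h := hθ.isFlat with hh
  set T₁ := hθ.primitive M x₀ x with hT₁
  set g := h.coordFrame x with hg_def
  have hself : g (c x) = 1 := h.frame_self x
  have hball : Metric.ball (c x) (h.radius x) ∈ 𝓝 (c x) := Metric.ball_mem_nhds _ (h.radius_pos x)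
  -- Near x the primitive is the gauge expression of the dual frame at x, which equals 1 at x. The
  -- derivative is thus read off at the centre of the disc only.
  have hev : (fun w => hθ.primitive M x₀ (c.symm w)) =ᶠ[𝓝 (c x)] fun w =>
      (fstL (g w) * T₁ - sndL (g w)) * Ring.inverse (fstL (g w)) := by
    filter_upwards [hball] with w hw
    have hwt := h.ball_subset_target x hw
    have hmem : c.symm w ∈ h.disc x := ⟨c.map_target hwt, by
      rw [mem_preimage, c.right_inv hwt]
      exact hw⟩
    rw [hθ.primitive_eq_of_mem_disc hM hmem, Ring_inverse_eq_inv]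
    simp only [IsFlatConnection.frame, ← hc, c.right_inv hwt, hg_def, hT₁]
  refine HasFDerivAt.congr_of_eventuallyEq ?_ hev
  have hg := (h.coordFrame_spec x (mem_of_mem_nhds hball)).2
  have hu : HasFDerivAt (fun w => fstL (g w)) _ (c x) :=
    (fstL.restrictScalars ℝ).hasFDerivAt.comp (c x) hg
  have hn : HasFDerivAt (fun w => sndL (g w)) _ (c x) :=
    (sndL.restrictScalars ℝ).hasFDerivAt.comp (c x) hg
  have hc1 (v : ℂ) : fstL (connForm (fun x => dualMk (A.toSlForm.part10 x) (θ.part10 x))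
      (fun x => dualMk (A.toSlForm.part01 x) (θ.part01 x)) c (c x) v) =
      connForm A.toSlForm.part10 A.toSlForm.part01 c (c x) v := by
    simp only [connForm, wirtingerForm_apply, map_add, map_smul, fstL_inChart]
  have hc2 (v : ℂ) : sndL (connForm (fun x => dualMk (A.toSlForm.part10 x) (θ.part10 x))
      (fun x => dualMk (A.toSlForm.part01 x) (θ.part01 x)) c (c x) v) =
      connForm θ.part10 θ.part01 c (c x) v := by
    simp only [connForm, wirtingerForm_apply, map_add, map_smul, sndL_inChart]
  have hflat (v : ℂ) : flatDeriv (connForm (fun x => dualMk (A.toSlForm.part10 x) (θ.part10 x))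
      (fun x => dualMk (A.toSlForm.part01 x) (θ.part01 x)) c (c x)) (g (c x)) v =
      -connForm (fun x => dualMk (A.toSlForm.part10 x) (θ.part10 x))
      (fun x => dualMk (A.toSlForm.part01 x) (θ.part01 x)) c (c x) v := by
    rw [flatDeriv_apply, hself, mul_one]
  refine hasFDerivAt_gauge hu hn (congrArg fstL hself) (congrArg sndL hself) T₁ fun v => ?_
  change connForm θ.part10 θ.part01 c (c x) v -
    (connForm A.toSlForm.part10 A.toSlForm.part01 c (c x) v * T₁ -
      T₁ * connForm A.toSlForm.part10 A.toSlForm.part01 c (c x) v) =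
    fstL (flatDeriv _ (g (c x)) v) * T₁ - sndL (flatDeriv _ (g (c x)) v) -
      T₁ * fstL (flatDeriv _ (g (c x)) v)
  rw [hflat, map_neg, map_neg, hc1, hc2]
  noncomm_ring

/-- The primitive is `C¹` and solves `d_A T = θ`. -/
theorem SlForm.IsCovClosed.hasFDerivAt_primitive (hθ : θ.IsCovClosed A) {M : Mat2}
    (hM : ∀ γ : Path.Homotopic.Quotient x₀ x₀, hθ.period γ =
      A.isFlat.transport γ * M * (A.isFlat.transport γ)⁻¹ - M) {e : OpenPartialHomeomorph X ℂ}
    (he : e ∈ atlas ℂ X) {z : ℂ} (hz : z ∈ e.target) :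
    HasFDerivAt (fun w => hθ.primitive M x₀ (e.symm w))
      (wirtingerForm (inChart 1 0 θ.part10 e z -
        (inChart 1 0 A.toFun e z * hθ.primitive M x₀ (e.symm z) -
          hθ.primitive M x₀ (e.symm z) * inChart 1 0 A.toFun e z)) (inChart 0 1 θ.part01 e z)) z := by
  set x := e.symm z with hx
  set c := chartAt ℂ x with hc
  have hxc : e.symm z ∈ c.source := mem_chart_source ℂ _
  -- Every point is the centre of its own preferred chart, and the chain rule carries the derivative
  -- found there to the chart e.
  have hev : (fun w => hθ.primitive M x₀ (e.symm w)) =ᶠ[𝓝 z]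
      fun w => hθ.primitive M x₀ (c.symm (c (e.symm w))) := by
    filter_upwards [eventually_transition hz hxc] with w hw
    rw [c.left_inv hw.2]
  have hd := (differentiableAt_transition he (chart_mem_atlas ℂ x) hz hxc).hasDerivAt
  refine HasFDerivAt.congr_of_eventuallyEq ?_ hev
  have h1 := hθ.hasFDerivAt_primitive_chartAt hM x
  refine (HasFDerivAt.comp (f := fun w => c (e.symm w)) z h1
    (hd.hasFDerivAt.restrictScalars ℝ)).congr_fderiv ?_
  ext1 v
  have hθ' := connForm_change θ.part10 θ.part01 he (chart_mem_atlas ℂ x) hz hxc v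
  have hA' := connForm_change A.toSlForm.part10 A.toSlForm.part01 he (chart_mem_atlas ℂ x) hz hxc v
  change connForm θ.part10 θ.part01 c (c x) (v * deriv (fun w => c (e.symm w)) z) -
    (connForm A.toSlForm.part10 A.toSlForm.part01 c (c x) (v * deriv (fun w => c (e.symm w)) z) *
      hθ.primitive M x₀ x - hθ.primitive M x₀ x *
      connForm A.toSlForm.part10 A.toSlForm.part01 c (c x) (v * deriv (fun w => c (e.symm w)) z)) = _
  rw [mul_comm v, hx, ← hθ', ← hA']
  have h0 : inChart 0 1 A.toSlForm.part01 e z = 0 := by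
    simp [inChart, HolSlForm.toSlForm]
  simp only [connForm, wirtingerForm_apply, h0, smul_zero, add_zero, smul_sub, smul_mul_assoc,
    mul_smul_comm]
  rw [show A.toSlForm.part10 = A.toFun from rfl]
  abel

theorem SlForm.IsCovClosed.isC1Fun_primitive (hθ : θ.IsCovClosed A) {M : Mat2}
    (hM : ∀ γ : Path.Homotopic.Quotient x₀ x₀, hθ.period γ =
      A.isFlat.transport γ * M * (A.isFlat.transport γ)⁻¹ - M) :
    IsC1Fun (hθ.primitive M x₀) :=
  isC1Fun_of_hasFDerivAt (fun e he z hz => hθ.hasFDerivAt_primitive hM he hz) fun e he hT => by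
    have hA : ContinuousOn (inChart 1 0 A.toFun e) e.target := (A.toSlForm.contDiffOn10 he).continuousOn
    exact ⟨(θ.contDiffOn10 he).continuousOn.sub ((hA.mul hT).sub (hT.mul hA)),
      (θ.contDiffOn01 he).continuousOn⟩

end Primitive

/-! ### The integral of an exact form against a closed form -/

section TraceStokes

variable {X : Type} [TopologicalSpace X] [ChartedSpace ℂ X] [IsManifold 𝓘(ℂ, ℂ) ω X]
  [CompactSpace X] [T2Space X]

/-- `∫ tr(d_B T ∧ ψ) = 0` if `d_B ψ = 0`, for a `(1,0)`-form `B`. -/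
theorem surfaceIntegral_trace_exact {T : X → Mat2} (hT : IsC1Fun T) {B θ₁₀ θ₀₁ : X → Mat2}
    {ψ : SlForm X}
    (hψ : ∀ e ∈ atlas ℂ X, ∀ z ∈ e.target, ψ.dCoeff e z + (inChart 1 0 B e z *
      inChart 0 1 ψ.part01 e z - inChart 0 1 ψ.part01 e z * inChart 1 0 B e z) = 0)
    (h10 : ∀ e ∈ atlas ℂ X, ∀ z ∈ e.target, inChart 1 0 θ₁₀ e z =
      wdz (fun w => T (e.symm w)) z +
        (inChart 1 0 B e z * T (e.symm z) - T (e.symm z) * inChart 1 0 B e z))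
    (h01 : ∀ e ∈ atlas ℂ X, ∀ z ∈ e.target, inChart 0 1 θ₀₁ e z =
      wdzbar (fun w => T (e.symm w)) z) :
    surfaceIntegral (fun x => (θ₀₁ x * ψ.part10 x - θ₁₀ x * ψ.part01 x).trace) = 0 := by
  have htr (p q : ℤ) (g : X → Mat2) (e : OpenPartialHomeomorph X ℂ) (z : ℂ) :
      inChart p q (fun x => (g x).trace) e z = (inChart p q g e z).trace := by
    simp [inChart, Matrix.trace_smul]
  have hTm (p q : ℤ) (g : X → Mat2) (e : OpenPartialHomeomorph X ℂ) :
      inChart p q (fun x => (T x * g x).trace) e =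
        fun z => traceCLM (T (e.symm z) * inChart p q g e z) := by
    funext z
    rw [htr, traceCLM_apply]
    simp [inChart]
  have hC1 : IsC1Form (fun x => (T x * ψ.part10 x).trace) (fun x => (T x * ψ.part01 x).trace) := by
    refine ⟨fun e he => ?_, fun e he => ?_⟩
    · rw [hTm]
      exact (traceCLM.restrictScalars ℝ).contDiff.comp_contDiffOn
        ((hT e he).mul (ψ.isC1Form.contDiffOn10 e he))
    · rw [hTm]
      exact (traceCLM.restrictScalars ℝ).contDiff.comp_contDiffOn
        ((hT e he).mul (ψ.isC1Form.contDiffOn01 e he))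
  -- Stokes for the scalar form tr(Tψ), whose differential is tr(d_B T ∧ ψ) + tr(T d_B ψ). The minus
  -- sign passes from dz ∧ dz̄ in the exterior derivative to dz̄ ∧ dz in the integral.
  have h := surfaceIntegral_exterior_eq_zero hC1
    (f := fun x => -(θ₀₁ x * ψ.part10 x - θ₁₀ x * ψ.part01 x).trace) fun e he z hz => ?_
  · rw [surfaceIntegral_neg, neg_eq_zero] at h
    exact h
  · have dT := hT.differentiableAt he hz
    have d10 := ψ.isC1Form.differentiableAt10 he hz
    have d01 := ψ.isC1Form.differentiableAt01 he hz
    rw [hTm, hTm, ← wdz_eq_dz, ← wdzbar_eq_dzbar,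
      wdz_clm_comp traceCLM (f := fun w => T (e.symm w) * inChart 0 1 ψ.part01 e w) (dT.mul d01),
      wdzbar_clm_comp traceCLM (f := fun w => T (e.symm w) * inChart 1 0 ψ.part10 e w)
        (dT.mul d10), wdz_mul dT d01, wdzbar_mul dT d10]
    have e1 : inChart 1 1 (fun x => θ₀₁ x * ψ.part10 x) e z = _ :=
      inChart_mul he hz 0 1 1 0 θ₀₁ ψ.part10
    have e2 : inChart 1 1 (fun x => θ₁₀ x * ψ.part01 x) e z = _ :=
      inChart_mul he hz 1 0 0 1 θ₁₀ ψ.part01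
    have e3 : inChart 1 1 (fun x => -(θ₀₁ x * ψ.part10 x - θ₁₀ x * ψ.part01 x).trace) e z =
        -((inChart 1 1 (fun x => θ₀₁ x * ψ.part10 x) e z).trace -
          (inChart 1 1 (fun x => θ₁₀ x * ψ.part01 x) e z).trace) := by
      simp only [inChart, Matrix.trace_smul, Matrix.trace_sub, smul_eq_mul]
      ring
    rw [e3, e1, e2, h10 e he z hz, h01 e he z hz]
    have hcl := hψ e he z hz
    rw [ψ.dCoeff_eq he hz] at hcl
    set t := T (e.symm z)
    set t₁ := wdz (fun w => T (e.symm w)) z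
    set t₂ := wdzbar (fun w => T (e.symm w)) z
    set p := inChart 1 0 ψ.part10 e z
    set q := inChart 0 1 ψ.part01 e z
    set b := inChart 1 0 B e z
    have hdq : wdz (inChart 0 1 ψ.part01 e) z =
        wdzbar (inChart 1 0 ψ.part10 e) z - (b * q - q * b) := by
      rw [eq_sub_iff_add_eq, ← sub_eq_zero, ← hcl]
      abel
    rw [hdq]
    -- Cyclicity of the trace moves the commutator with B from ψ to T.
    have hcyc : (t * (q * b)).trace = (b * (t * q)).trace := by
      rw [← mul_assoc, Matrix.trace_mul_comm]
    simp only [traceCLM_apply, Matrix.trace_add, Matrix.trace_sub, add_mul, sub_mul, mul_sub,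
      mul_assoc, hcyc]
    ring

end TraceStokes

end SlSystem

end

noncomputable section

namespace SlSystem

open Set Filter Topology MeasureTheory

attribute [local instance] matNormedRing matNormedAlgebra matTopology matUniformity

/-! ### The Goldman form in terms of differential forms -/

section Goldman

variable {X : Type} [TopologicalSpace X] [ChartedSpace ℂ X]

theorem SlForm.isContTensor10 (χ : SlForm X) (i j : Fin 2) :
    IsContTensor 1 0 fun x => χ.part10 x i j := fun e he => (χ.smooth10 i j e he).continuousOn

theorem SlForm.isContTensor01 (χ : SlForm X) (i j : Fin 2) :
    IsContTensor 0 1 fun x => χ.part01 x i j := fun e he => (χ.smooth01 i j e he).continuousOn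

theorem traceWedgeIntegral_swap [CompactSpace X] [T2Space X] (χ ψ : SlForm X) :
    traceWedgeIntegral χ ψ = -traceWedgeIntegral ψ χ := by
  rw [traceWedgeIntegral, traceWedgeIntegral, ← surfaceIntegral_neg]
  congr 1
  funext x
  rw [Matrix.trace_sub, Matrix.trace_sub, Matrix.trace_mul_comm (χ.part01 x),
    Matrix.trace_mul_comm (χ.part10 x)]
  ring

theorem traceWedgeIntegral_neg_left [CompactSpace X] [T2Space X] (χ ψ : SlForm X) :
    traceWedgeIntegral (SlForm.comb (-1) χ 0 χ) ψ = -traceWedgeIntegral χ ψ := by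
  rw [traceWedgeIntegral, traceWedgeIntegral, ← surfaceIntegral_neg]
  congr 1
  funext x
  simp [SlForm.comb]
  ring

variable [IsManifold 𝓘(ℂ, ℂ) ω X]
  {A : HolSlForm X} {x₀ : X} {ρ : FundamentalGroup X x₀ →* Matrix.SpecialLinearGroup (Fin 2) ℂ}

/-- Since C¹ loops represent all classes, the integral formula determines the cocycle itself and not
only its cohomology class. -/
theorem IsMonodromy.cocycle_eq_period (hρ : IsMonodromy A ρ) {χ : SlForm X} (hχ : χ.IsCovClosed A)
    {c : groupCohomology.cocycles₁ (adRho ρ)}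
    (hc : ∀ p : Path x₀ x₀, IsC1Path p → ∀ F : ℝ → Mat2, IsParallelFrame A.toSlForm p F →
      ∀ i j, (c.1 (loopClass p) : Sl2).1 i j =
        ∫ s in (0 : ℝ)..1, (F 1 * (F s)⁻¹ * χ.alongPath p s * F s * (F 1)⁻¹) i j) :
    c = hρ.periodCocycle hχ := by
  refine Subtype.ext (funext fun γ => Subtype.ext ?_)
  obtain ⟨q, hq, h⟩ := exists_isFlatEnded_mk (FundamentalGroup.toPath γ)
  obtain ⟨F, hF⟩ := A.toSlForm.isC1Form.exists_isFrame_pathValue hq.isC1On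
  have hF' : IsParallelFrame A.toSlForm q F := isParallelFrame_iff.2 hF
  have hγ : γ = loopClass q := h.symm
  rw [hγ]
  ext i j
  rw [hc q hq.isC1On F hF' i j, ← conj_integral_apply χ hq.isC1On hF',
    ← hχ.period_mk hq.isC1On hF']
  rfl

theorem SlForm.IsCovClosed.period_comb {χ χ' : SlForm X} (hχ : χ.IsCovClosed A)
    (hχ' : χ'.IsCovClosed A) (a b : ℂ) {x y : X} (γ : Path.Homotopic.Quotient x y) :
    (SlForm.isCovClosed_comb hχ hχ' a b).period γ = a • hχ.period γ + b • hχ'.period γ := by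
  obtain ⟨q, hq, rfl⟩ := exists_isFlatEnded_mk γ
  obtain ⟨F, hF⟩ := A.toSlForm.isC1Form.exists_isFrame_pathValue hq.isC1On
  have hF' : IsParallelFrame A.toSlForm q F := isParallelFrame_iff.2 hF
  have hi (a : ℂ) (χ : SlForm X) : IntervalIntegrable
      (fun s => a • ((F s)⁻¹ * χ.alongPath q s * F s)) volume 0 1 :=
    ((continuousOn_conj_alongPath χ hq.isC1On hF').const_smul a).intervalIntegrable_of_Icc zero_le_one
  rw [SlForm.IsCovClosed.period_mk _ hq.isC1On hF', SlForm.IsCovClosed.period_mk _ hq.isC1On hF',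
    SlForm.IsCovClosed.period_mk _ hq.isC1On hF', ← smul_mul_assoc, ← mul_smul_comm,
    ← smul_mul_assoc, ← mul_smul_comm, ← add_mul, ← mul_add, ← intervalIntegral.integral_smul,
    ← intervalIntegral.integral_smul, ← intervalIntegral.integral_add (hi a χ) (hi b χ')]
  congr 3
  funext s
  rw [SlForm.alongPath_comb]
  simp only [mul_add, add_mul, mul_smul_comm, smul_mul_assoc]

theorem isContTensor_trace_mul {p q p' q' r s : ℤ} {f g : X → Mat2}
    (hf : ∀ i j, IsContTensor p q fun x => f x i j) (hg : ∀ i j, IsContTensor p' q' fun x => g x i j)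
    (hr : p + p' = r) (hs : q + q' = s) : IsContTensor r s fun x => (f x * g x).trace := by
  simp only [Matrix.trace_fin_two, Matrix.mul_apply, Fin.sum_univ_two]
  exact ((((hf _ _).mul (hg _ _) hr hs)).add ((hf _ _).mul (hg _ _) hr hs)).add
    (((hf _ _).mul (hg _ _) hr hs).add ((hf _ _).mul (hg _ _) hr hs))

theorem isContTensor_traceWedge (χ ψ : SlForm X) : IsContTensor 1 1 fun x =>
    (χ.part01 x * ψ.part10 x - χ.part10 x * ψ.part01 x).trace := by
  simp only [Matrix.trace_sub]
  exact (isContTensor_trace_mul χ.isContTensor01 ψ.isContTensor10 (by norm_num) (by norm_num)).sub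
    (isContTensor_trace_mul χ.isContTensor10 ψ.isContTensor01 (by norm_num) (by norm_num))

variable [CompactSpace X] [T2Space X]

theorem traceWedgeIntegral_sub (χ χ' ψ : SlForm X) :
    traceWedgeIntegral χ ψ - traceWedgeIntegral χ' ψ = surfaceIntegral fun x =>
      ((χ.part01 x - χ'.part01 x) * ψ.part10 x - (χ.part10 x - χ'.part10 x) * ψ.part01 x).trace := by
  rw [traceWedgeIntegral, traceWedgeIntegral, ← surfaceIntegral_sub (isContTensor_traceWedge χ ψ)
    (isContTensor_traceWedge χ' ψ)]
  congr 1
  funext x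
  simp only [sub_mul, Matrix.trace_sub]
  ring

/-- The integral `∫ tr(χ ∧ ψ)` against a `d_A`-closed form `ψ` only depends on the class of `χ`. -/
theorem IsDeRhamClass.traceWedgeIntegral_eq [ConnectedSpace X] (hρ : IsMonodromy A ρ)
    {χ χ' ψ : SlForm X} {a : TangentR ρ} (h : IsDeRhamClass A ρ χ a) (h' : IsDeRhamClass A ρ χ' a)
    (hψ : ψ.IsCovClosed A) : traceWedgeIntegral χ ψ = traceWedgeIntegral χ' ψ := by
  have := pathConnectedSpace_of_charted (X := X)
  obtain ⟨hχ, c, hc, hcχ⟩ := h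
  obtain ⟨hχ', c', hc', hcχ'⟩ := h'
  have e1 := hρ.cocycle_eq_period hχ hcχ
  have e2 := hρ.cocycle_eq_period hχ' hcχ'
  -- Equality in H¹ provides m in sl₂ whose coboundary is the difference of the period cocycles. It
  -- supplies the initial value -m of the primitive of χ - χ'.
  have hcob : ⇑c - ⇑c' ∈ groupCohomology.coboundaries₁ (adRho ρ) :=
    (groupCohomology.H1π_eq_iff c c').1 (hc.trans hc'.symm)
  obtain ⟨m, hm⟩ := hcob
  have hθ := SlForm.isCovClosed_comb hχ hχ' 1 (-1)
  have hM : ∀ γ : Path.Homotopic.Quotient x₀ x₀, hθ.period γ =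
      A.isFlat.transport γ * (m : Sl2).1 * (A.isFlat.transport γ)⁻¹ - (m : Sl2).1 := by
    intro γ
    have h1 := congrArg (fun y : Sl2 => y.1) (congrFun hm (FundamentalGroup.fromPath γ))
    have h2 : (((⇑c - ⇑c') (FundamentalGroup.fromPath γ) : Sl2).1 : Mat2) =
        hχ.period γ - hχ'.period γ := by
      rw [e1, e2]
      rfl
    have h3 : ((((groupCohomology.d₀₁ (adRho ρ)).hom m) (FundamentalGroup.fromPath γ) : Sl2).1 : Mat2) =
        (ρ (FundamentalGroup.fromPath γ) : Mat2) * (m : Sl2).1 *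
          (((ρ (FundamentalGroup.fromPath γ))⁻¹ : Matrix.SpecialLinearGroup (Fin 2) ℂ) : Mat2) -
            (m : Sl2).1 := rfl
    rw [hχ.period_comb hχ' 1 (-1) γ, one_smul, neg_smul, one_smul, ← sub_eq_add_neg, ← h2, ← h1, h3,
      coe_inv_specialLinearGroup, hρ.eq_transport]
  have hT := hθ.isC1Fun_primitive hM
  have h10 := fun e he z hz => (hasFDerivAt_wirtingerForm (hθ.hasFDerivAt_primitive hM (e := e) he (z := z) hz)).1
  have h01 := fun e he z hz => (hasFDerivAt_wirtingerForm (hθ.hasFDerivAt_primitive hM (e := e) he (z := z) hz)).2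
  have := surfaceIntegral_trace_exact hT (B := A.toFun) (ψ := ψ) hψ
    (θ₁₀ := (SlForm.comb 1 χ (-1) χ').part10) (θ₀₁ := (SlForm.comb 1 χ (-1) χ').part01)
    (fun e he z hz => by rw [h10 e he z hz]; abel) (fun e he z hz => (h01 e he z hz).symm)
  rw [← sub_eq_zero, traceWedgeIntegral_sub, ← this]
  congr 1
  funext x
  simp only [SlForm.comb, one_smul, neg_smul, sub_eq_add_neg]

end Goldman

end SlSystem

end

noncomputable section

namespace SlSystem

open Set Filter Topology MeasureTheory

attribute [local instance] matNormedRing matNormedAlgebra matTopology matUniformity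

/-! ### Holomorphic and antiholomorphic differentials -/

section Antiholomorphic

theorem wdz_wdzbar_comm {V : Type*} [NormedAddCommGroup V] [NormedSpace ℂ V] {f : ℂ → V} {z : ℂ}
    (hf : ContDiffAt ℝ 2 f z) : wdz (wdzbar f) z = wdzbar (wdz f) z := by
  have hd : HasFDerivAt (fderiv ℝ f) (fderiv ℝ (fderiv ℝ f) z) z :=
    ((hf.fderiv_right (m := 1) (by norm_num)).differentiableAt one_ne_zero).hasFDerivAt
  have hv (v : ℂ) : HasFDerivAt (fun w => fderiv ℝ f w v) ((fderiv ℝ (fderiv ℝ f) z).flip v) z :=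
    (hd.clm_apply (hasFDerivAt_const v z)).congr_fderiv (by ext; simp)
  have h1 : HasFDerivAt (wdzbar f) _ z :=
    ((hv 1).add ((hv Complex.I).const_smul Complex.I)).const_smul (2⁻¹ : ℂ)
  have h2 : HasFDerivAt (wdz f) _ z :=
    ((hv 1).sub ((hv Complex.I).const_smul Complex.I)).const_smul (2⁻¹ : ℂ)
  have hs := hf.isSymmSndFDerivAt (by simp) 1 Complex.I
  rw [wdz, h1.fderiv, wdzbar, h2.fderiv]
  simp only [smul_apply, add_apply, sub_apply, ContinuousLinearMap.flip_apply, hs]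
  module

theorem differentiableAt_conj_of_wdz_eq_zero {f : ℂ → ℂ} {z : ℂ} (hf : DifferentiableAt ℝ f z)
    (h : wdz f z = 0) : DifferentiableAt ℂ (fun w => conj (f w)) z := by
  have hc : HasFDerivAt (fun w => conj (f w))
      ((Complex.conjCLE : ℂ →L[ℝ] ℂ).comp (fderiv ℝ f z)) z :=
    (Complex.conjCLE : ℂ →L[ℝ] ℂ).hasFDerivAt.comp z hf.hasFDerivAt
  refine HasFDerivAt.differentiableAt (f' := (1 : ℂ →L[ℂ] ℂ).smulRight (conj (wdzbar f z))) ?_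
  refine hasFDerivAt_of_restrictScalars ℝ hc ?_
  ext v
  change v * _ = conj (fderiv ℝ f z v)
  rw [fderiv_apply_eq_wirtinger, h]
  simp

variable {X : Type} [TopologicalSpace X] [ChartedSpace ℂ X]

theorem inChart_conj (f : X → ℂ) (e : OpenPartialHomeomorph X ℂ) (z : ℂ) :
    inChart 1 0 (fun x => conj (f x)) e z = conj (inChart 0 1 f e z) := by
  simp [inChart]

theorem isHolomorphicTensor_conj {f : X → ℂ}
    (hf : ∀ e ∈ atlas ℂ X, DifferentiableOn ℝ (inChart 0 1 f e) e.target)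
    (h : ∀ e ∈ atlas ℂ X, ∀ z ∈ e.target, wdz (inChart 0 1 f e) z = 0) :
    IsHolomorphicTensor 1 fun x => conj (f x) := fun e he z hz => by
  simp only [funext (inChart_conj f e)]
  exact (differentiableAt_conj_of_wdz_eq_zero
    ((hf e he).differentiableAt (e.open_target.mem_nhds hz)) (h e he z hz)).differentiableWithinAt

theorem IsHolomorphicTensor.isContTensor {k : ℤ} {f : X → ℂ} (hf : IsHolomorphicTensor k f) :
    IsContTensor k 0 f := fun e he => (hf e he).continuousOn

variable [IsManifold 𝓘(ℂ, ℂ) ω X]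

theorem IsHolomorphicTensor.mul {f g : X → ℂ} (hf : IsHolomorphicTensor 1 f)
    (hg : IsHolomorphicTensor 1 g) : IsQuadraticDifferential fun x => f x * g x := fun e he =>
  ((hf e he).mul (hg e he)).congr fun _ hz => inChart_mul he hz 1 0 1 0 f g

variable [CompactSpace X] [T2Space X]

/-- Since β is holomorphic, the integrand is the differential of the (1,0)-form Tβ up to sign. -/
theorem surfaceIntegral_delbar_mul_eq_zero {T β : X → ℂ} (hT : IsC1Fun T)
    (hβ : IsHolomorphicTensor 1 β) : surfaceIntegral (fun x => delbar T x * β x) = 0 := by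
  have ha (e : OpenPartialHomeomorph X ℂ) : inChart 1 0 (fun x => T x * β x) e =
      fun z => T (e.symm z) * inChart 1 0 β e z := funext fun z => inChart_mul_left 1 0 T β e z
  have hb (e : OpenPartialHomeomorph X ℂ) : inChart 0 1 (fun _ : X => (0 : ℂ)) e = fun _ => 0 :=
    funext fun z => inChart_eq_zero rfl
  have h := surfaceIntegral_exterior_eq_zero (a := fun x => T x * β x) (b := fun _ : X => (0 : ℂ))
    (f := fun x => -(delbar T x * β x)) ⟨fun e he => ?_, fun e _ => ?_⟩ fun e he z hz => ?_
  · rwa [surfaceIntegral_neg, neg_eq_zero] at h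
  · rw [ha]
    exact (hT e he).mul (((hβ e he).contDiffOn e.open_target).restrict_scalars ℝ)
  · rw [hb]
    exact contDiffOn_const
  · have hd := (hβ e he).differentiableAt (e.open_target.mem_nhds hz)
    have e1 : inChart 1 1 (fun x => delbar T x * β x) e z = _ :=
      inChart_mul he hz 0 1 1 0 (delbar T) β
    have e2 : inChart 1 1 (fun x => -(delbar T x * β x)) e z =
        -inChart 1 1 (fun x => delbar T x * β x) e z := by simp [inChart]
    rw [ha, hb, ← wdz_eq_dz, ← wdzbar_eq_dzbar, wdz_const,
      wdzbar_mul (hT.differentiableAt he hz) (hd.restrictScalars ℝ),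
      wdzbar_eq_zero_of_holomorphic hd, e2, e1, inChart_delbar hT he hz]
    ring

/-- If `ν` is orthogonal to `QD(X)` and `ν α - ∂̄T` is antiholomorphic, then `ν α = ∂̄T`. -/
theorem mul_eq_delbar_of_orthogonal {ν α T : X → ℂ} (hν : IsContTensor (-1) 1 ν)
    (h0 : ∀ φ : X → ℂ, IsQuadraticDifferential φ → surfaceIntegral (fun x => ν x * φ x) = 0)
    (hα : IsHolomorphicTensor 1 α) (hT : IsC1Fun T)
    (hβ : IsHolomorphicTensor 1 fun x => conj (ν x * α x - delbar T x)) (x : X) :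
    ν x * α x = delbar T x := by
  set η : X → ℂ := fun x => ν x * α x - delbar T x with hη
  have hφ := hα.mul hβ
  have hηc : IsContTensor 0 1 η :=
    (hν.mul hα.isContTensor (by norm_num) (by norm_num)).sub (isContTensor_delbar hT)
  have hc : IsContTensor 1 1 fun x => ((Complex.normSq (η x) : ℝ) : ℂ) := by
    simp only [← Complex.mul_conj]
    exact hηc.mul hβ.isContTensor (by norm_num) (by norm_num)
  -- ∫ |η|² = ∫ ν(αη̄) - ∫ ∂̄T η̄. Since η̄ is holomorphic, αη̄ is a quadratic differential,
  -- orthogonal to ν by hypothesis, and the second integral vanishes by Stokes.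
  have hint : surfaceIntegral (fun x => ((Complex.normSq (η x) : ℝ) : ℂ)) = 0 := by
    have hs := surfaceIntegral_sub
      (hν.mul (r := 1) (s := 1) hφ.isContTensor (by norm_num) (by norm_num))
      ((isContTensor_delbar hT).mul (r := 1) (s := 1) hβ.isContTensor (by norm_num) (by norm_num))
    rw [h0 _ hφ, surfaceIntegral_delbar_mul_eq_zero hT hβ, sub_zero] at hs
    rw [← hs]
    congr 1
    funext x
    rw [← Complex.mul_conj, ← mul_assoc, ← sub_mul]
  have := eq_zero_of_surfaceIntegral_eq_zero (fun x => Complex.normSq_nonneg (η x)) hc hint x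
  exact sub_eq_zero.1 (Complex.normSq_eq_zero.1 this)

end Antiholomorphic

/-! ### Independence of the representative of a tangent vector -/

section Independence

variable {X : Type} [TopologicalSpace X] [ChartedSpace ℂ X] {A : HolSlForm X}

theorem contDiffOn_of_isSmoothTensor {T : X → Mat2}
    (hT : ∀ i j, IsSmoothTensor 0 0 fun x => T x i j) {e : OpenPartialHomeomorph X ℂ}
    (he : e ∈ atlas ℂ X) : ContDiffOn ℝ ∞ (fun w => T (e.symm w)) e.target :=
  contDiffOn_mat_iff.2 fun i j => (hT i j e he).congr fun _ _ => (inChart_zero fun x => T x i j).symm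

theorem delCoeff_eq {T : X → Mat2} {e : OpenPartialHomeomorph X ℂ} {z : ℂ}
    (hT : DifferentiableAt ℝ (fun w => T (e.symm w)) z) :
    delCoeff T e z = wdz (fun w => T (e.symm w)) z := by
  ext i j
  rw [wdz_entry hT]
  simp only [delCoeff, Matrix.of_apply, funext fun z => inChart_zero (z := z) (e := e) fun x => T x i j]

theorem contDiffOn_wdzbar {V : Type*} [NormedAddCommGroup V] [NormedSpace ℂ V] {f : ℂ → V}
    {U : Set ℂ} (hU : IsOpen U) (hf : ContDiffOn ℝ ∞ f U) : ContDiffOn ℝ ∞ (wdzbar f) U := by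
  have h := hf.fderiv_of_isOpen (m := ∞) hU (by simp)
  exact ((h.clm_apply contDiffOn_const).add
    ((h.clm_apply contDiffOn_const).const_smul _)).const_smul _

theorem contDiffOn_wdz {V : Type*} [NormedAddCommGroup V] [NormedSpace ℂ V] {f : ℂ → V}
    {U : Set ℂ} (hU : IsOpen U) (hf : ContDiffOn ℝ ∞ f U) : ContDiffOn ℝ ∞ (wdz f) U := by
  have h := hf.fderiv_of_isOpen (m := ∞) hU (by simp)
  exact ((h.clm_apply contDiffOn_const).sub
    ((h.clm_apply contDiffOn_const).const_smul _)).const_smul _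

theorem wdz_sub {V : Type*} [NormedAddCommGroup V] [NormedSpace ℂ V] {f g : ℂ → V} {z : ℂ}
    (hf : DifferentiableAt ℝ f z) (hg : DifferentiableAt ℝ g z) :
    wdz (fun w => f w - g w) z = wdz f z - wdz g z := by
  rw [wdz, wdz, wdz, fderiv_fun_sub hf hg]
  simp only [sub_apply]
  module

theorem wdzbar_sub {V : Type*} [NormedAddCommGroup V] [NormedSpace ℂ V] {f g : ℂ → V} {z : ℂ}
    (hf : DifferentiableAt ℝ f z) (hg : DifferentiableAt ℝ g z) :
    wdzbar (fun w => f w - g w) z = wdzbar f z - wdzbar g z := by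
  rw [wdzbar, wdzbar, wdzbar, fderiv_fun_sub hf hg]
  simp only [sub_apply]
  module

/-- By closedness ∂ of the (0,1)-difference equals ∂̄ of the (1,0)-difference, that is, of ∂T + [A,
C]. The commutator is holomorphic because C is constant, so only ∂̄∂T = ∂∂̄T remains. -/
theorem wdz_part01_sub_eq_zero {χ χ' : SlForm X} (hχ : χ.IsClosed) (hχ' : χ'.IsClosed)
    {T : X → Mat2} (hT : ∀ i j, IsSmoothTensor 0 0 fun x => T x i j) {C : Mat2}
    (h : ∀ e ∈ atlas ℂ X, ∀ z ∈ e.target,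
      inChart 1 0 χ.part10 e z - inChart 1 0 χ'.part10 e z - delCoeff T e z =
        inChart 1 0 A.toFun e z * C - C * inChart 1 0 A.toFun e z)
    {e : OpenPartialHomeomorph X ℂ} (he : e ∈ atlas ℂ X) {z : ℂ} (hz : z ∈ e.target) :
    wdz (fun w => inChart 0 1 χ.part01 e w - inChart 0 1 χ'.part01 e w -
      wdzbar (fun w => T (e.symm w)) w) z = 0 := by
  have hn := e.open_target.mem_nhds hz
  have hTc := contDiffOn_of_isSmoothTensor hT he
  have d1 := χ.isC1Form.differentiableAt01 he hz
  have d2 := χ'.isC1Form.differentiableAt01 he hz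
  have d3 := χ.isC1Form.differentiableAt10 he hz
  have d4 := χ'.isC1Form.differentiableAt10 he hz
  have d5 := ((contDiffOn_wdzbar e.open_target hTc).differentiableOn (by simp)).differentiableAt hn
  have d6 := ((contDiffOn_wdz e.open_target hTc).differentiableOn (by simp)).differentiableAt hn
  have dA := A.toSlForm.isC1Form.differentiableAt10 he hz
  have hA : wdzbar (fun w => inChart 1 0 A.toFun e w * C - C * inChart 1 0 A.toFun e w) z = 0 := by
    rw [wdzbar_sub (f := fun w => inChart 1 0 A.toFun e w * C)
      (g := fun w => C * inChart 1 0 A.toFun e w) (dA.mul_const C) (dA.const_mul C),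
      wdzbar_mul (f := inChart 1 0 A.toFun e) (g := fun _ => C) dA (differentiableAt_const C),
      wdzbar_mul (g := inChart 1 0 A.toFun e) (f := fun _ => C) (differentiableAt_const C) dA,
      wdzbar_inChart_hol A he hz, wdzbar_const]
    simp
  have hev : (fun w => inChart 1 0 A.toFun e w * C - C * inChart 1 0 A.toFun e w) =ᶠ[𝓝 z]
      fun w => inChart 1 0 χ.part10 e w - inChart 1 0 χ'.part10 e w -
        wdz (fun w => T (e.symm w)) w := by
    filter_upwards [hn] with w hw
    rw [← h e he w hw, delCoeff_eq ((hTc.differentiableOn (by simp)).differentiableAt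
      (e.open_target.mem_nhds hw))]
  rw [wdzbar_congr hev, wdzbar_sub (f := fun w => inChart 1 0 χ.part10 e w -
    inChart 1 0 χ'.part10 e w) (d3.sub d4) d6, wdzbar_sub d3 d4] at hA
  rw [wdz_sub (f := fun w => inChart 0 1 χ.part01 e w - inChart 0 1 χ'.part01 e w) (d1.sub d2) d5,
    wdz_sub d1 d2, wdz_wdzbar_comm ((hTc.contDiffAt hn).of_le (by norm_cast)), ← hA]
  have c1 := hχ e he z hz
  have c2 := hχ' e he z hz
  rw [SlForm.dCoeff_eq _ he hz, sub_eq_zero] at c1 c2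
  rw [c1, c2]

variable [IsManifold 𝓘(ℂ, ℂ) ω X] [CompactSpace X] [T2Space X]

/-- Equivalent deformations differ by `dT + [A, C]`. -/
theorem Deformation.part01_sub_eq_delbar {z₁ z₂ : Deformation A}
    (h : ∀ φ : X → ℂ, IsQuadraticDifferential φ → beltramiPairing z₁.mu φ = beltramiPairing z₂.mu φ)
    {T : X → Mat2} (hT : ∀ i j, IsSmoothTensor 0 0 fun x => T x i j) {C : Mat2}
    (hC : ∀ e ∈ atlas ℂ X, ∀ z ∈ e.target,
      inChart 1 0 z₁.form.part10 e z - inChart 1 0 z₂.form.part10 e z - delCoeff T e z =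
        inChart 1 0 A.toFun e z * C - C * inChart 1 0 A.toFun e z) (x : X) :
    z₁.form.part01 x - z₂.form.part01 x = delbar T x := by
  have hT1 : IsC1Fun T := fun e he => (contDiffOn_of_isSmoothTensor hT he).of_le (by simp)
  have hTe (i j : Fin 2) : IsC1Fun fun x => T x i j := fun e he =>
    contDiffOn_mat_iff.1 (hT1 e he) i j
  have hdel (i j : Fin 2) (x : X) : delbar (fun x => T x i j) x = delbar T x i j :=
    wdzbar_clm_comp (entryCLM i j) (hT1.differentiableAt (chart_mem_atlas ℂ x) (mem_chart_target ℂ x))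
  have hμ (z : Deformation A) : IsContTensor (-1) 1 z.mu := fun e he =>
    (z.mu_smooth e he).continuousOn
  ext i j
  -- The argument is entrywise: for each i, j the scalar orthogonality statement is used with α the
  -- (i, j) entry of A and T replaced by its (i, j) entry.
  have hη : (fun x => (z₁.mu x - z₂.mu x) * A.toFun x i j - delbar (fun x => T x i j) x) =
      fun x => (z₁.form.part01 x - z₂.form.part01 x - delbar T x) i j := by
    funext x
    simp only [hdel, z₁.compat, z₂.compat, Matrix.sub_apply, Matrix.smul_apply, smul_eq_mul]
    ring
  have hch (e) (he : e ∈ atlas ℂ X) (z) (hz : z ∈ e.target) :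
      inChart 0 1 (fun x => (z₁.form.part01 x - z₂.form.part01 x - delbar T x) i j) e z =
      entryCLM i j (inChart 0 1 z₁.form.part01 e z - inChart 0 1 z₂.form.part01 e z -
        wdzbar (fun w => T (e.symm w)) z) := by
    rw [inChart_entry, ← inChart_delbar hT1 he hz]
    simp only [inChart, smul_sub, entryCLM_apply]
  have hcd (e) (he : e ∈ atlas ℂ X) : ContDiffOn ℝ ∞ (fun z => inChart 0 1 z₁.form.part01 e z -
      inChart 0 1 z₂.form.part01 e z - wdzbar (fun w => T (e.symm w)) z) e.target :=
    ((z₁.form.contDiffOn01 he).sub (z₂.form.contDiffOn01 he)).sub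
      (contDiffOn_wdzbar e.open_target (contDiffOn_of_isSmoothTensor hT he))
  have hβ : IsHolomorphicTensor 1 fun x =>
      conj ((z₁.mu x - z₂.mu x) * A.toFun x i j - delbar (fun x => T x i j) x) := by
    refine isHolomorphicTensor_conj (fun e he => ?_) fun e he z hz => ?_
    · rw [hη]
      exact ((((entryCLM i j).restrictScalars ℝ).contDiff.comp_contDiffOn (hcd e he)).congr
        (hch e he)).differentiableOn (by simp)
    · have hd := ((hcd e he).differentiableOn (by simp)).differentiableAt
        (e.open_target.mem_nhds hz)
      have hev : inChart 0 1 (fun x => (z₁.form.part01 x - z₂.form.part01 x - delbar T x) i j) e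
          =ᶠ[𝓝 z] _ := eventually_of_mem (e.open_target.mem_nhds hz) (hch e he)
      rw [hη, wdz_congr hev, wdz_clm_comp (entryCLM i j) hd,
        wdz_part01_sub_eq_zero z₁.closed z₂.closed hT hC he hz, map_zero]
  have key := mul_eq_delbar_of_orthogonal (ν := fun x => z₁.mu x - z₂.mu x)
    ((hμ z₁).sub (hμ z₂)) (fun φ hφ => ?_) (A.holo i j) (hTe i j) hβ x
  · rw [← hdel, ← key, z₁.compat, z₂.compat]
    simp only [Matrix.sub_apply, Matrix.smul_apply, smul_eq_mul]
    ring
  · have hs := surfaceIntegral_sub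
      ((hμ z₁).mul (r := 1) (s := 1) hφ.isContTensor (by norm_num) (by norm_num))
      ((hμ z₂).mul (r := 1) (s := 1) hφ.isContTensor (by norm_num) (by norm_num))
    have h' := h φ hφ
    rw [beltramiPairing, beltramiPairing, ← sub_eq_zero, ← hs] at h'
    rw [← h']
    congr 1
    funext x
    ring

/-- Pairing with a deformation only depends on the tangent vector. -/
theorem Deformation.traceWedgeIntegral_eq {z₁ z₂ : Deformation A} (h : z₁ ≈ z₂)
    (y : Deformation A) :
    traceWedgeIntegral z₁.form y.form = traceWedgeIntegral z₂.form y.form := by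
  obtain ⟨hμ, T, -, hT, C, -, hC⟩ := h
  have hT1 : IsC1Fun T := fun e he => (contDiffOn_of_isSmoothTensor hT he).of_le (by simp)
  have h01 := Deformation.part01_sub_eq_delbar hμ hT hC
  -- The summand dT is exact for the untwisted differential, and the form of y is closed in the
  -- ordinary sense, so Stokes is used with B = 0.
  have hex := surfaceIntegral_trace_exact hT1 (B := fun _ => 0) (ψ := y.form)
    (θ₁₀ := del T) (θ₀₁ := delbar T)
    (fun e he z hz => by rw [y.closed e he z hz, inChart_eq_zero rfl]; simp)
    (fun e he z hz => by rw [inChart_del hT1 he hz, inChart_eq_zero (f := fun _ => 0) rfl]; simp)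
    (fun e he z hz => inChart_delbar hT1 he hz)
  rw [← sub_eq_zero, traceWedgeIntegral_sub, ← hex]
  congr 1
  funext x
  have h10 : z₁.form.part10 x - z₂.form.part10 x = del T x + (A.toFun x * C - C * A.toFun x) := by
    have h := hC _ (chart_mem_atlas ℂ x) _ (mem_chart_target ℂ x)
    rw [delCoeff_eq (hT1.differentiableAt (chart_mem_atlas ℂ x) (mem_chart_target ℂ x)),
      ← inChart_del hT1 (chart_mem_atlas ℂ x) (mem_chart_target ℂ x)] at h
    simp only [inChart_chartAt] at h
    rw [← h]
    abel
  rw [h01, h10, y.compat, add_mul, ← sub_sub, Matrix.trace_sub _ ((_ - _) * _)]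
  -- The bracket [A, C] meets only the (0,1)-part μA of the other form, and tr([A, C]A) = 0 by
  -- cyclicity.
  have : ((A.toFun x * C - C * A.toFun x) * y.mu x • A.toFun x).trace = 0 := by
    rw [mul_smul_comm, Matrix.trace_smul, sub_mul, Matrix.trace_sub, mul_assoc C,
      Matrix.trace_mul_comm C, Matrix.trace_mul_comm (_ * C), ← mul_assoc, sub_self, smul_zero]
  rw [this, sub_zero]

end Independence

/-! ### The symplectic form on the space of `sl₂`-systems -/

section Final

/-- On traceless 2 × 2 matrices det M = -½ tr M², and this is its polarization. -/
theorem dDet_eq {X : Type} {P Q : X → Mat2} {x : X} (hP : (P x).trace = 0) (hQ : (Q x).trace = 0) :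
    dDet P Q x = -(P x * Q x).trace := by
  have h : (fun t : ℂ => detForm (P + t • Q) x) = fun t => (P x 0 0 + t * Q x 0 0) *
      (P x 1 1 + t * Q x 1 1) - (P x 0 1 + t * Q x 0 1) * (P x 1 0 + t * Q x 1 0) := by
    funext t
    simp [detForm, Matrix.det_fin_two]
  have hd (a b : ℂ) : HasDerivAt (fun t : ℂ => a + t * b) b 0 := by
    simpa using ((hasDerivAt_id (0 : ℂ)).mul_const b).const_add a
  rw [Matrix.trace_fin_two, add_eq_zero_iff_eq_neg'] at hP hQ
  have hm := ((hd (P x 0 0) (Q x 0 0)).mul (hd (P x 1 1) (Q x 1 1))).sub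
    ((hd (P x 0 1) (Q x 0 1)).mul (hd (P x 1 0) (Q x 1 0)))
  rw [dDet, h]
  refine hm.deriv.trans ?_
  simp only [Matrix.trace_fin_two, Matrix.mul_apply, Fin.sum_univ_two, hP, hQ]
  ring

variable {X : Type} [TopologicalSpace X] [ChartedSpace ℂ X]
  {A : HolSlForm X} {x₀ : X} {ρ : FundamentalGroup X x₀ →* Matrix.SpecialLinearGroup (Fin 2) ℂ}

/-- The chosen representative is meaningful only when some form represents the class. For
derivatives of the Riemann-Hilbert map such a form is -Ȧ. -/
theorem isDeRhamClass_deRhamRep {χ : SlForm X} {a : TangentR ρ} (h : IsDeRhamClass A ρ χ a) :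
    IsDeRhamClass A ρ (deRhamRep A ρ a) a :=
  Classical.epsilon_spec (p := fun χ => IsDeRhamClass A ρ χ a) ⟨χ, h⟩

theorem IsMonodromy.exists_isDerivRH [IsManifold 𝓘(ℂ, ℂ) ω X] [CompactSpace X] [T2Space X]
    (hρ : IsMonodromy A ρ)
    (z : Deformation A) : ∃ a, IsDerivRH A ρ (TangentS.mk z) a :=
  ⟨_, z, rfl, _, hρ.isVariationCocycle z, rfl⟩

variable [CompactSpace X] [T2Space X]

/-- When the second form has type (1,0), only the (0,1)-part μA of the first contributes. -/
theorem traceWedgeIntegral_of_mu_eq_zero (z₁ z₂ : Deformation A) (h : ∀ x, z₂.mu x = 0) :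
    traceWedgeIntegral z₁.form z₂.form =
      -beltramiPairing z₁.mu (dDet A.toFun z₂.form.part10) := by
  rw [traceWedgeIntegral, beltramiPairing, ← surfaceIntegral_neg]
  congr 1
  funext x
  rw [dDet_eq (A.trace_eq x) (z₂.form.trace10 x), z₁.compat, z₂.compat, h]
  simp

variable [IsManifold 𝓘(ℂ, ℂ) ω X] [ConnectedSpace X]

/-- The chosen representatives are replaced one slot at a time, antisymmetry of the pairing reducing
the second slot to the first. -/
theorem IsMonodromy.goldmanForm_eq (hρ : IsMonodromy A ρ) {χ ψ : SlForm X} {a b : TangentR ρ}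
    (ha : IsDeRhamClass A ρ χ a) (hb : IsDeRhamClass A ρ ψ b) :
    goldmanForm A ρ a b = traceWedgeIntegral χ ψ := by
  have hb' := isDeRhamClass_deRhamRep hb
  rw [goldmanForm, (isDeRhamClass_deRhamRep ha).traceWedgeIntegral_eq hρ ha hb'.1,
    traceWedgeIntegral_swap, hb'.traceWedgeIntegral_eq hρ hb ha.1, ← traceWedgeIntegral_swap]

/-- The classes a and b may come from other representatives of the tangent vectors. Each contributes
minus the class of its form, the two signs cancel, and the remaining integral depends on the tangent
vectors alone. -/
theorem IsMonodromy.goldmanForm_derivRH (hρ : IsMonodromy A ρ) (z₁ z₂ : Deformation A)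
    {a b : TangentR ρ} (ha : IsDerivRH A ρ (TangentS.mk z₁) a)
    (hb : IsDerivRH A ρ (TangentS.mk z₂) b) :
    goldmanForm A ρ a b = traceWedgeIntegral z₁.form z₂.form := by
  obtain ⟨y₁, hy₁, c₁, hc₁, rfl⟩ := ha
  obtain ⟨y₂, hy₂, c₂, hc₂, rfl⟩ := hb
  have e₁ : y₁ ≈ z₁ := Quotient.exact hy₁
  have e₂ : y₂ ≈ z₂ := Quotient.exact hy₂
  rw [hρ.goldmanForm_eq (hρ.isDeRhamClass_of_isVariationCocycle hc₁)
    (hρ.isDeRhamClass_of_isVariationCocycle hc₂), traceWedgeIntegral_neg_left,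
    traceWedgeIntegral_swap, traceWedgeIntegral_neg_left, neg_neg, neg_eq_iff_eq_neg,
    Deformation.traceWedgeIntegral_eq e₂, traceWedgeIntegral_swap,
    Deformation.traceWedgeIntegral_eq e₁]

end Final

end SlSystem

end

/-! ### The pullback of the Goldman form under the Riemann-Hilbert map -/

theorem proposition8p1 {X : Type} [TopologicalSpace X] [T2Space X] [CompactSpace X]
    [ConnectedSpace X] [ChartedSpace ℂ X] [IsManifold (modelWithCornersSelf ℂ ℂ) ω X]
    (A : SlSystem.HolSlForm X) (x₀ : X)
    (z₁ z₂ : SlSystem.Deformation A) (hz₂ : ∀ x, z₂.mu x = 0)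
    (v w : SlSystem.TangentS A)
    (hv : v = SlSystem.TangentS.mk z₁) (hw : w = SlSystem.TangentS.mk z₂) :
    (∃ ρ : FundamentalGroup X x₀ →* Matrix.SpecialLinearGroup (Fin 2) ℂ,
      SlSystem.IsMonodromy A ρ) ∧
    ∀ ρ : FundamentalGroup X x₀ →* Matrix.SpecialLinearGroup (Fin 2) ℂ,
      SlSystem.IsMonodromy A ρ →
      (∃ a : SlSystem.TangentR ρ, SlSystem.IsDerivRH A ρ v a) ∧
      (∃ b : SlSystem.TangentR ρ, SlSystem.IsDerivRH A ρ w b) ∧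
      ∀ a b : SlSystem.TangentR ρ,
        SlSystem.IsDerivRH A ρ v a → SlSystem.IsDerivRH A ρ w b →
        SlSystem.goldmanForm A ρ a b =
          -SlSystem.beltramiPairing z₁.mu (SlSystem.dDet A.toFun z₂.form.part10) := by
  subst hv hw
  refine ⟨⟨_, SlSystem.isMonodromy_monodromy A x₀⟩, fun ρ hρ => ⟨hρ.exists_isDerivRH z₁,
    hρ.exists_isDerivRH z₂, fun a b ha hb => ?_⟩⟩
  rw [hρ.goldmanForm_derivRH z₁ z₂ ha hb, SlSystem.traceWedgeIntegral_of_mu_eq_zero z₁ z₂ hz₂]
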